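/- **Graphs.** A (connected directed) graph $\Gamma$ consists of a finite nonempty linearly ordered set $V(\Gamma)$ of vertices, a finite set of half-edges, each adjacent to exactly one vertex, a linear order (the local order) of the half-edges adjacent to each vertex, an involution on half-edges, and a linear order of the set of legs (the fixed points of the involution); the two-element orbits are the internal edges, and $\Gamma$ is connected. The vertices of all graphs are taken from a fixed linearly ordered set, inducing the order of $V(\Gamma)$, and the half-edges from a fixed set (for instance both may be $\mathbb N$). The half-edges of $\Gamma$ are also ordered lexicographically: first by vertices, then by local orders. A map $\tau:\Gamma'\to\Gamma''$ is a pair of a surjection $\phi$ of vertices and an injection $\psi$ from the half-edges of $\Gamma''$ to those of $\Gamma'$ such that: if $\psi(f)$ is adjacent to $x$ then $f$ is adjacent to $\phi(x)$; $\psi$ commutes with the involutions; $\psi$ restricts to an order-preserving bijection of legs; $\phi$ identifies the two ends of each edge of $\Gamma'$ not in the image of $\psi$; and all fibres are connected. The fibre $\tau^{-1}(i)$ over a vertex $i$ has the vertices and half-edges of $\Gamma'$ lying over $i$ with their local orders; its internal edges are the edges of $\Gamma'$ over $i$ not in the image of $\psi$; its legs are ordered, via $\psi$, as the half-edges of $\Gamma''$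 at $i$. Let ${\tt Grc}$ be the resulting category. A fibre is trivial if it has one vertex, no internal edges, and its local order agrees with the order of its legs. A map is elementary if $\phi$ is order-preserving and all its fibres are trivial except exactly one, which has at least one internal edge. A map $\pi:\Gamma'\to\Gamma''$ is a canonical contraction over $i\in V(\Gamma'')$ if $\phi$ sends all vertices over $i$ to the smallest of them, which is $i$, and fixes all other vertices; $\psi$ is an inclusion; the local orders at the vertices $\neq i$ of $\Gamma''$ are those of $\Gamma'$; the half-edges at $i$ are ordered as in the lexicographic order of $\Gamma'$; and $\pi^{-1}(i)$ has at least one internal edge. **Labelled towers.** Objects of the groupoid ${\tt lTw}(\Gamma)$ are labelled towers $\Gamma\xrightarrow{\ell}\Delta_0\xrightarrow{\tau_1}\Delta_1\to\cdots\xrightarrow{\tau_{k-1}}\Delta_{k-1}$, $k\ge 1$, with $\ell$ an isomorphism, all $\tau_i$ elementary, and $\Delta_{k-1}$ having at least one internal edge. Its morphisms are generated by isomorphisms of the first type, which are commutative ladders of isomorphisms $\Delta_i'\cong\Delta_i''$ under $\Gamma$, and of the second type, which replace two consecutive maps $\Delta\xrightarrow{\tau_1}P\xrightarrow{\tau_2}S$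 by $\Delta\xrightarrow{\rho_1}Q\xrightarrow{\rho_2}S$, where $\tau_2\tau_1=\rho_2\rho_1$ and, for some vertices $i\ne j$ of $S$, the nontrivial fibre of $\tau_1$ lies over a vertex mapped to $i$ and that of $\tau_2$ over $j$, while the nontrivial fibre of $\rho_1$ lies over a vertex mapped to $j$ and that of $\rho_2$ over $i$. **Graph-trees.** A graph-tree $T$ is a rooted tree with at least one vertex, whose leaves carry distinct labels from the linearly ordered set of vertex names, whose internal edges are labelled by the minimum of the labels of the leaves below them, and each of whose vertices $u$ is decorated by a graph $\Gamma_u\in{\tt Grc}$ with at least one internal edge, such that: (1) $V(\Gamma_u)$ is the set of labels of the input edges of $u$; (2) for each internal edge $e$ from $u$ to $v$, the ordered set of legs of $\Gamma_u$ equals the ordered set of half-edges of $\Gamma_v$ at its vertex $e$; (3) in this situation, the order of the legs of $\Gamma_u$ is the one induced by the lexicographic order of the half-edges of $\Gamma_u$. The graph ${\rm gr}(T)$ is obtained by contracting all internal edges of $T$, inserting $\Gamma_u$ into the vertex $e$ of $\Gamma_v$ for each internal edge $e$ from $u$ to $v$. Let ${\rm gTr}(\Gamma)$ be the set of graph-trees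 $T$ with ${\rm gr}(T)=\Gamma$. **The tree of a tower.** A labelled tower with $k=1$ presents the one-vertex graph-tree decorated by $\Gamma$. For $k\ge 2$, a labelled tower presents $T$ if there are a canonical contraction $\pi:\Gamma\to\Gamma_1$ over some vertex $x$ and an isomorphism $\sigma:\Gamma_1\cong\Delta_1$ with $\sigma\pi=\tau_1\ell$ such that $T$ is obtained from a tree presented by $\Gamma_1\xrightarrow{\sigma}\Delta_1\xrightarrow{\tau_2}\cdots\to\Delta_{k-1}$ by grafting the one-vertex tree decorated by $\pi^{-1}(x)$ onto the leaf labelled by $x$. **Theorem.** For every $\Gamma\in{\tt Grc}$ there is a bijection $e:\pi_0({\tt lTw}(\Gamma))\to{\rm gTr}(\Gamma)$ from the set of connected components of the groupoid ${\tt lTw}(\Gamma)$ to ${\rm gTr}(\Gamma)$ which is canonical in the sense that, for every labelled tower $\mathcal T$ and every $T\in{\rm gTr}(\Gamma)$, $e([\mathcal T])=T$ if and only if $\mathcal T$ presents $T$. -/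

import Mathlib

open CategoryTheory

universe u v

/-! ### Directed graphs -/

/-- The data of a graph whose vertices are named by elements of the linearly ordered type `α` and
whose half-edges (flags) are named by elements of `β`:
* `V` is the finite set of vertices, ordered as a subset of `α`;
* `star x` lists, in increasing order, the half-edges adjacent to the vertex `x`;
* `link f f'` says that `f` and `f'` are the two half-edges of an internal edge, that is, `{f, f'}`
  is a two-element orbit of the involution;
* `legs` lists, in increasing order, the legs, that is, the fixed points of the involution. -/
structure RawGraph (α : Type u) (β : Type v) where
  V : Finset α
  star : α → List β
  link : β → β → Prop
  legs : List β

namespace RawGraph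

variable {α : Type u} {β : Type v}

/-- `f` is a half-edge of the graph. -/
def IsFlag (G : RawGraph α β) (f : β) : Prop := ∃ x ∈ G.V, f ∈ G.star x

/-- The graph has at least one internal edge. -/
def HasEdge (G : RawGraph α β) : Prop := ∃ f f', G.link f f'

/-- The axioms of a directed graph. -/
structure IsDirectedGraph (G : RawGraph α β) : Prop where
  star_eq_nil : ∀ x, x ∉ G.V → G.star x = []
  star_nodup : ∀ x, (G.star x).Nodup
  star_disjoint : ∀ x y f, f ∈ G.star x → f ∈ G.star y → x = y
  link_isFlag : ∀ f f', G.link f f' → G.IsFlag f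
  link_symm : ∀ f f', G.link f f' → G.link f' f
  link_irrefl : ∀ f, ¬ G.link f f
  link_unique : ∀ f a b, G.link f a → G.link f b → a = b
  legs_nodup : G.legs.Nodup
  mem_legs : ∀ f, f ∈ G.legs ↔ G.IsFlag f ∧ ∀ f', ¬ G.link f f'

/-- Two vertices are joined by an internal edge. -/
def Joined (G : RawGraph α β) (x y : α) : Prop :=
  ∃ f f', f ∈ G.star x ∧ f' ∈ G.star y ∧ G.link f f'

/-- The graph is nonempty and connected. -/
def IsConnected (G : RawGraph α β) : Prop :=
  G.V.Nonempty ∧ ∀ x ∈ G.V, ∀ y ∈ G.V, Relation.ReflTransGen G.Joined x y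

/-- A corolla whose local order of half-edges and global order of legs agree. -/
def IsTrivial (G : RawGraph α β) : Prop :=
  ¬ G.HasEdge ∧ ∃ x, G.V = {x} ∧ G.star x = G.legs

/-- The corolla with the single vertex `x` and the half-edges `s`, both orders being that
of `s`. -/
def corolla [DecidableEq α] (x : α) (s : List β) : RawGraph α β where
  V := {x}
  star y := if y = x then s else []
  link _ _ := False
  legs := s

/-- All half-edges in the lexicographic order: first by vertices, then by the local orders. -/
def flagList [LinearOrder α] (G : RawGraph α β) : List β :=
  G.V.sort.flatMap G.star

/-- Simultaneous vertex insertion: each vertex `x` of `G` is replaced by the graph `H x`, the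
half-edges of `G` at `x` being the legs of `H x`. -/
def insertion [LinearOrder α] (G : RawGraph α β) (H : α → RawGraph α β) : RawGraph α β where
  V := G.V.biUnion fun x => (H x).V
  star y := G.V.sort.flatMap fun x => (H x).star y
  link f f' := G.link f f' ∨ ∃ x ∈ G.V, (H x).link f f'
  legs := G.legs

end RawGraph

/-- Objects of the category of connected directed graphs. -/
structure Grc (α : Type u) (β : Type v) extends RawGraph α β where
  isDirectedGraph : toRawGraph.IsDirectedGraph
  isConnected : toRawGraph.IsConnected

namespace Grc

variable {α : Type u} {β : Type v}

/-- The ordered set of vertices. -/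
abbrev Vert (G : Grc α β) : Type u := {x : α // x ∈ G.V}

/-- The set of half-edges. -/
abbrev Flag (G : Grc α β) : Type v := {f : β // G.IsFlag f}

open Classical in
/-- An injection of half-edges as a map on names (the value outside of its domain is
irrelevant). -/
noncomputable def flagMap {G G' : Grc α β} (ψ : G'.Flag → G.Flag) (f : β) : β :=
  if h : G'.IsFlag f then (ψ ⟨f, h⟩ : β) else f

open Classical in
/-- The fibre over the vertex `i` of a map of graphs given by `φ` on vertices and, in the opposite
direction, by `ψ` on half-edges: the vertices and half-edges of `G` over `i` with the local orders
of `G`, only the edges of `G` which are not in the image of `ψ` being kept; the other half-edges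
become legs, ordered via `ψ` as the half-edges of `G'` at `i`. -/
noncomputable def fiberGraph {G G' : Grc α β} (φ : G.Vert → G'.Vert) (ψ : G'.Flag → G.Flag)
    (i : G'.Vert) : RawGraph α β where
  V := G.V.filter fun x => ∃ h : x ∈ G.V, φ ⟨x, h⟩ = i
  star x := if ∃ h : x ∈ G.V, φ ⟨x, h⟩ = i then G.star x else []
  link f f' := G.link f f' ∧ (∃ x : G.Vert, φ x = i ∧ f ∈ G.star x) ∧
    ¬ ∃ h : G'.Flag, (ψ h : β) = f
  legs := (G'.star i).map (flagMap ψ)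

/-- Maps of connected directed graphs: a surjection `φ` of vertices and an injection `ψ`, in the
opposite direction, of half-edges, compatible with the adjacency of half-edges and with the
involutions, such that the half-edges which are not in the image of `ψ` form internal edges
contracted by `φ`, the ordered set of legs is preserved and all fibres are connected. -/
@[ext]
structure Hom (G G' : Grc α β) where
  φ : G.Vert → G'.Vert
  ψ : G'.Flag → G.Flag
  φ_surjective : Function.Surjective φ
  ψ_injective : Function.Injective ψ
  adj : ∀ (f : G'.Flag) (x : G.Vert), (ψ f : β) ∈ G.star x → (f : β) ∈ G'.star (φ x)
  link_iff : ∀ (f : G'.Flag) (h : β),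
    G.link (ψ f) h ↔ ∃ f' : G'.Flag, (ψ f' : β) = h ∧ G'.link f f'
  contracted : ∀ (h h' : G.Flag) (x y : G.Vert), (¬ ∃ f, ψ f = h) → G.link h h' →
    (h : β) ∈ G.star x → (h' : β) ∈ G.star y → φ x = φ y
  legs_map : G'.legs.map (flagMap ψ) = G.legs
  fiber_connected : ∀ i, (fiberGraph φ ψ i).IsConnected

/-- The fibre of a map of graphs over a vertex of the target. -/
noncomputable def Hom.fiber {G G' : Grc α β} (τ : Hom G G') (i : G'.Vert) : RawGraph α β :=
  fiberGraph τ.φ τ.ψ i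

theorem flagMap_id (G : Grc α β) : flagMap (id : G.Flag → G.Flag) = id := by
  funext f
  unfold flagMap
  split <;> rfl

theorem flagMap_val {G G' : Grc α β} (ψ : G'.Flag → G.Flag) (f : G'.Flag) :
    flagMap ψ (f : β) = ψ f := by
  simp [flagMap, f.2]

theorem isFlag_of_mem_legs (G : Grc α β) {f : β} (h : f ∈ G.legs) : G.IsFlag f :=
  ((G.isDirectedGraph.mem_legs f).1 h).1

theorem mem_V_of_mem_star (G : Grc α β) {f : β} {x : α} (h : f ∈ G.star x) : x ∈ G.V := by
  by_contra hx
  rw [G.isDirectedGraph.star_eq_nil x hx] at h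
  simp at h

theorem fiberGraph_mem_V {G G' : Grc α β} (φ : G.Vert → G'.Vert) (ψ : G'.Flag → G.Flag)
    (i : G'.Vert) (x : α) :
    x ∈ (fiberGraph φ ψ i).V ↔ ∃ h : x ∈ G.V, φ ⟨x, h⟩ = i := by
  simp only [fiberGraph, Finset.mem_filter]
  exact ⟨fun h => h.2, fun h => ⟨h.1, h⟩⟩

theorem fiberGraph_mem_star {G G' : Grc α β} (φ : G.Vert → G'.Vert) (ψ : G'.Flag → G.Flag)
    (i : G'.Vert) (x : α) (f : β) :
    f ∈ (fiberGraph φ ψ i).star x ↔ (∃ h : x ∈ G.V, φ ⟨x, h⟩ = i) ∧ f ∈ G.star x := by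
  simp only [fiberGraph]
  split <;> simp_all

/-- The identity map. -/
def Hom.id (G : Grc α β) : Hom G G where
  φ := _root_.id
  ψ := _root_.id
  φ_surjective := Function.surjective_id
  ψ_injective := Function.injective_id
  adj _ _ h := h
  link_iff f h := by
    constructor
    · intro hl
      exact ⟨⟨h, G.isDirectedGraph.link_isFlag _ _ (G.isDirectedGraph.link_symm _ _ hl)⟩, rfl, hl⟩
    · rintro ⟨f', rfl, hl⟩
      exact hl
  contracted h _ _ _ hn := absurd ⟨h, rfl⟩ hn
  legs_map := by rw [flagMap_id, List.map_id]
  fiber_connected i := by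
    refine ⟨⟨i, (fiberGraph_mem_V _ _ _ _).2 ⟨i.2, rfl⟩⟩, ?_⟩
    intro x hx y hy
    obtain ⟨hx, rfl⟩ := (fiberGraph_mem_V _ _ _ _).1 hx
    obtain ⟨hy, h⟩ := (fiberGraph_mem_V _ _ _ _).1 hy
    have : y = x := congrArg Subtype.val h
    subst this
    exact Relation.ReflTransGen.refl

theorem fiber_comp_small {G₁ G₂ G₃ : Grc α β} (Φ : Hom G₁ G₂) (Ψ : Hom G₂ G₃) (i : G₂.Vert)
    {x y : α} (h : (fiberGraph Φ.φ Φ.ψ i).Joined x y) :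
    (fiberGraph (Ψ.φ ∘ Φ.φ) (Φ.ψ ∘ Ψ.ψ) (Ψ.φ i)).Joined x y := by
  obtain ⟨f, f', hf, hf', hl, ⟨z, hz, hfz⟩, hn⟩ := h
  rw [fiberGraph_mem_star] at hf hf'
  obtain ⟨⟨hx, hxi⟩, hf⟩ := hf
  obtain ⟨⟨hy, hyi⟩, hf'⟩ := hf'
  refine ⟨f, f', ?_, ?_, hl, ⟨z, ?_, hfz⟩, ?_⟩
  · rw [fiberGraph_mem_star]
    exact ⟨⟨hx, congrArg Ψ.φ hxi⟩, hf⟩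
  · rw [fiberGraph_mem_star]
    exact ⟨⟨hy, congrArg Ψ.φ hyi⟩, hf'⟩
  · exact congrArg Ψ.φ hz
  · rintro ⟨a, ha⟩
    exact hn ⟨Ψ.ψ a, ha⟩

theorem exists_vert {G G' : Grc α β} (Φ : Hom G G') (f : G'.Flag) {i : α}
    (hf : (f : β) ∈ G'.star i) :
    ∃ x : G.Vert, (Φ.ψ f : β) ∈ G.star x ∧ (Φ.φ x : α) = i := by
  obtain ⟨x, hx, hfx⟩ := (Φ.ψ f).2
  exact ⟨⟨x, hx⟩, hfx, G'.isDirectedGraph.star_disjoint _ _ _ (Φ.adj f ⟨x, hx⟩ hfx) hf⟩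

theorem fiber_comp_connected {G₁ G₂ G₃ : Grc α β} (Φ : Hom G₁ G₂) (Ψ : Hom G₂ G₃) (k : G₃.Vert) :
    (fiberGraph (Ψ.φ ∘ Φ.φ) (Φ.ψ ∘ Ψ.ψ) k).IsConnected := by
  have small : ∀ i : G₂.Vert, Ψ.φ i = k → ∀ x y : G₁.Vert, Φ.φ x = i → Φ.φ y = i →
      Relation.ReflTransGen (fiberGraph (Ψ.φ ∘ Φ.φ) (Φ.ψ ∘ Ψ.ψ) k).Joined (x : α) y := by
    rintro i rfl x y hx hy
    exact Relation.ReflTransGen.lift id (fun a b hab => fiber_comp_small Φ Ψ i hab) _ _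
      ((Φ.fiber_connected i).2 x ((fiberGraph_mem_V _ _ _ _).2 ⟨x.2, hx⟩) y
        ((fiberGraph_mem_V _ _ _ _).2 ⟨y.2, hy⟩))
  refine ⟨?_, ?_⟩
  · obtain ⟨i, hi⟩ := Ψ.φ_surjective k
    obtain ⟨x, hx⟩ := Φ.φ_surjective i
    exact ⟨x, (fiberGraph_mem_V _ _ _ _).2 ⟨x.2, by simp [hx, hi]⟩⟩
  · intro x hx y hy
    obtain ⟨hx, hxk⟩ := (fiberGraph_mem_V _ _ _ _).1 hx
    obtain ⟨hy, hyk⟩ := (fiberGraph_mem_V _ _ _ _).1 hy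
    have main : ∀ j : α, Relation.ReflTransGen (fiberGraph Ψ.φ Ψ.ψ k).Joined
        (Φ.φ ⟨x, hx⟩ : α) j → ∀ z : G₁.Vert, Ψ.φ (Φ.φ z) = k → (Φ.φ z : α) = j →
        Relation.ReflTransGen (fiberGraph (Ψ.φ ∘ Φ.φ) (Φ.ψ ∘ Ψ.ψ) k).Joined x (z : α) := by
      intro j hj
      induction hj with
      | refl =>
        intro z hz hzj
        exact small _ hxk ⟨x, hx⟩ z rfl (Subtype.ext hzj)
      | @tail i j _ hij ih =>
        intro z hz hzj
        obtain ⟨f, f', hf, hf', hl, ⟨w, hw, hfw⟩, hn⟩ := hij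
        rw [fiberGraph_mem_star] at hf hf'
        obtain ⟨⟨hi, hik⟩, hf⟩ := hf
        obtain ⟨⟨hj, hjk⟩, hf'⟩ := hf'
        obtain ⟨a, ha, hai⟩ := exists_vert Φ ⟨f, i, hi, hf⟩ hf
        obtain ⟨b, hb, hbj⟩ := exists_vert Φ ⟨f', j, hj, hf'⟩ hf'
        have hai' : Φ.φ a = ⟨i, hi⟩ := Subtype.ext hai
        have hbj' : Φ.φ b = ⟨j, hj⟩ := Subtype.ext hbj
        have h1 := ih a (by rw [hai', hik]) hai
        have h2 : (fiberGraph (Ψ.φ ∘ Φ.φ) (Φ.ψ ∘ Ψ.ψ) k).Joined (a : α) b := by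
          refine ⟨_, _, ?_, ?_, (Φ.link_iff ⟨f, i, hi, hf⟩ _).2 ⟨⟨f', j, hj, hf'⟩, rfl, hl⟩,
            ⟨a, ?_, ha⟩, ?_⟩
          · rw [fiberGraph_mem_star]
            exact ⟨⟨a.2, by simp [hai', hik]⟩, ha⟩
          · rw [fiberGraph_mem_star]
            exact ⟨⟨b.2, by simp [hbj', hjk]⟩, hb⟩
          · simp [hai', hik]
          · rintro ⟨c, hc⟩
            have := Φ.ψ_injective (Subtype.ext hc)
            exact hn ⟨c, congrArg Subtype.val this⟩
        exact (h1.tail h2).trans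
          (small ⟨j, hj⟩ hjk b z hbj' (Subtype.ext hzj))
    exact main _ ((Ψ.fiber_connected k).2 _ ((fiberGraph_mem_V _ _ _ _).2 ⟨(Φ.φ ⟨x, hx⟩).2, hxk⟩) _
      ((fiberGraph_mem_V _ _ _ _).2 ⟨(Φ.φ ⟨y, hy⟩).2, hyk⟩)) ⟨y, hy⟩ hyk rfl

/-- Composition of maps of graphs. -/
def Hom.comp {G₁ G₂ G₃ : Grc α β} (Φ : Hom G₁ G₂) (Ψ : Hom G₂ G₃) : Hom G₁ G₃ where
  φ := Ψ.φ ∘ Φ.φ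
  ψ := Φ.ψ ∘ Ψ.ψ
  φ_surjective := Ψ.φ_surjective.comp Φ.φ_surjective
  ψ_injective := Φ.ψ_injective.comp Ψ.ψ_injective
  adj f x h := Ψ.adj f _ (Φ.adj _ x h)
  link_iff f h := by
    constructor
    · intro hl
      obtain ⟨f₂, rfl, h₂⟩ := (Φ.link_iff (Ψ.ψ f) h).1 hl
      obtain ⟨f₃, h₃, h₃'⟩ := (Ψ.link_iff f f₂).1 h₂
      exact ⟨f₃, by rw [Function.comp_apply, Subtype.ext h₃], h₃'⟩
    · rintro ⟨f', rfl, hl⟩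
      exact (Φ.link_iff _ _).2 ⟨Ψ.ψ f', rfl, (Ψ.link_iff _ _).2 ⟨f', rfl, hl⟩⟩
  contracted h h' x y hn hl hx hy := by
    by_cases hh : ∃ f, Φ.ψ f = h
    · obtain ⟨f, rfl⟩ := hh
      obtain ⟨f', hf', hl'⟩ := (Φ.link_iff f h').1 hl
      have hf'' : Φ.ψ f' = h' := Subtype.ext hf'
      subst hf''
      refine Ψ.contracted f f' _ _ ?_ hl' (Φ.adj f x hx) (Φ.adj f' y hy)
      rintro ⟨g, rfl⟩
      exact hn ⟨g, rfl⟩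
    · exact congrArg Ψ.φ (Φ.contracted h h' x y hh hl hx hy)
  legs_map := by
    rw [← Φ.legs_map, ← Ψ.legs_map, List.map_map]
    refine List.map_congr_left fun f hf => ?_
    have h := G₃.isFlag_of_mem_legs hf
    change flagMap _ ((⟨f, h⟩ : G₃.Flag) : β) = flagMap _ (flagMap _ ((⟨f, h⟩ : G₃.Flag) : β))
    rw [flagMap_val, flagMap_val, flagMap_val]
    rfl
  fiber_connected := fiber_comp_connected Φ Ψ

instance : Category (Grc α β) where
  Hom := Hom
  id := Hom.id
  comp := Hom.comp

/-- The map `τ` is elementary with its nontrivial fibre over `i`: it is order-preserving on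
vertices, its fibre over `i` has at least one internal edge, and all other fibres are trivial. -/
structure IsElementaryAt [LinearOrder α] {G G' : Grc α β} (τ : G ⟶ G') (i : G'.Vert) : Prop where
  monotone : Monotone τ.φ
  hasEdge : (τ.fiber i).HasEdge
  isTrivial : ∀ j, j ≠ i → (τ.fiber j).IsTrivial

/-- The map `π` is the canonical contraction of its fibre over `i`: the vertices over `i` are sent
to their minimum, all other vertices are fixed, `π` is the inclusion on half-edges, the local orders
at the vertices other than `i` are unchanged, and the half-edges at `i` are ordered
lexicographically. The contracted set of edges is required to be nonempty. -/
structure IsCanonicalContraction [LinearOrder α] {G G' : Grc α β} (π : G ⟶ G') (i : G'.Vert) :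
    Prop where
  φ_eq : ∀ x, π.φ x ≠ i → (π.φ x : α) = x
  isLeast : IsLeast ((π.fiber i).V : Set α) i
  ψ_eq : ∀ f, (π.ψ f : β) = f
  star_eq : ∀ x ∈ G'.V, x ≠ (i : α) → G'.star x = G.star x
  star_sublist : (G'.star i).Sublist (π.fiber i).flagList
  hasEdge : (π.fiber i).HasEdge

end Grc

/-! ### Graph-trees -/

/-- Rooted trees with vertices decorated by graphs: `leaf` is the tree without vertices, and
`node G sub` is the tree whose root is decorated by `G`, with input edges labelled by the vertices
`x` of `G`, onto which the trees `sub x` are grafted. So `sub x = leaf` means that the input edge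
labelled by `x` is a leaf of the tree. -/
inductive GTree (α : Type u) (β : Type v) : Type (max u v)
  | leaf : GTree α β
  | node (G : RawGraph α β) (sub : α → GTree α β) : GTree α β

namespace GTree

variable {α : Type u} {β : Type v}

/-- The rooted corolla whose only vertex is decorated by `G`. -/
def corolla (G : RawGraph α β) : GTree α β := node G fun _ => leaf

/-- The graph obtained by contracting all internal edges of a tree, that is, by inserting,
recursively, the graph of each branch into the corresponding vertex of the decoration of the root.
For the tree without vertices the result is the second argument. -/
def grOn [LinearOrder α] : GTree α β → RawGraph α β → RawGraph α β
  | leaf, C => C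
  | node G sub, _ => G.insertion fun x => (sub x).grOn (RawGraph.corolla x (G.star x))

/-- The graph of a tree (with junk value the empty graph at `leaf`). -/
def gr [LinearOrder α] (T : GTree α β) : RawGraph α β :=
  T.grOn ⟨∅, fun _ => [], fun _ _ => False, []⟩

/-- The labels of the leaves of a tree hanging on an edge labelled by `x`. -/
def leafLabels [LinearOrder α] : GTree α β → α → Finset α
  | leaf, x => {x}
  | node G sub, _ => G.V.biUnion fun y => (sub y).leafLabels y

/-- The conditions on the graph `G` decorating the initial vertex of an internal edge whose terminal
vertex has the ordered set `s` of half-edges at its vertex labelled by that edge: the ordered set of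
legs of `G` is `s`, and this order is the one induced by the lexicographic order of half-edges
of `G`. -/
def Compatible [LinearOrder α] : GTree α β → List β → Prop
  | leaf, _ => True
  | node G _, s => G.legs = s ∧ G.legs.Sublist G.flagList

/-- The conditions defining graph-trees, on all vertices of a tree: each decoration is a connected
directed graph with at least one internal edge, the input edges of a vertex are labelled by the
vertices of its decoration, leaves have mutually distinct labels, an internal edge is labelled by
the minimum of the labels of leaves below it, and the half-edges are compatible. -/
def IsGood [LinearOrder α] : GTree α β → Prop
  | leaf => True
  | node G sub => G.IsDirectedGraph ∧ G.IsConnected ∧ G.HasEdge ∧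
      (∀ x, x ∉ G.V → sub x = leaf) ∧
      (∀ x ∈ G.V, ∀ y ∈ G.V, x ≠ y → Disjoint ((sub x).leafLabels x) ((sub y).leafLabels y)) ∧
      (∀ x ∈ G.V, IsLeast ((sub x).leafLabels x : Set α) x) ∧
      (∀ x ∈ G.V, (sub x).Compatible (G.star x)) ∧
      ∀ x ∈ G.V, (sub x).IsGood

/-- Graph-trees: decorated trees with at least one vertex satisfying the above conditions. -/
def IsGraphTree [LinearOrder α] (T : GTree α β) : Prop := T ≠ leaf ∧ T.IsGood

/-- The tree obtained from a tree hanging on an edge labelled by `y` by grafting the corolla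
decorated by `G` onto the leaf labelled by `x`. -/
def graft [LinearOrder α] (x : α) (G : RawGraph α β) : GTree α β → α → GTree α β
  | leaf, y => if y = x then corolla G else leaf
  | node H sub, _ => node H fun z => if z ∈ H.V then graft x G (sub z) z else leaf

end GTree

/-- The set of graph-trees `T` with `gr T = Γ`. -/
def GTr {α : Type u} {β : Type v} [LinearOrder α] (Γ : Grc α β) : Type (max u v) :=
  {T : GTree α β // T.IsGraphTree ∧ T.gr = Γ.toRawGraph}

/-! ### Labelled towers -/

/-- Towers `Δ₀ ⟶ Δ₁ ⟶ ⋯ ⟶ Δₖ₋₁`, `k ≥ 1`, of elementary maps with the given initial graph `Δ₀`, such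
that `Δₖ₋₁` has at least one internal edge. The vertex `i` over which the nontrivial fibre lives is
determined by the elementary map. -/
inductive Tower {α : Type u} {β : Type v} [LinearOrder α] : Grc α β → Type (max u v)
  | last (Δ : Grc α β) (h : Δ.HasEdge) : Tower Δ
  | step {Δ Δ' : Grc α β} (τ : Δ ⟶ Δ') (i : Δ'.Vert) (h : Grc.IsElementaryAt τ i) (R : Tower Δ') :
      Tower Δ

section Towers

variable {α : Type u} {β : Type v} [LinearOrder α]

namespace Tower

/-- Two towers are related by a commutative ladder of isomorphisms starting with the given
isomorphism. As maps of graphs are epimorphisms, such a ladder is unique. -/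
inductive Ladder : ∀ {Δ Δ' : Grc α β}, (Δ ≅ Δ') → Tower Δ → Tower Δ' → Prop
  | last {Δ Δ' : Grc α β} (σ : Δ ≅ Δ') (h : Δ.HasEdge) (h' : Δ'.HasEdge) :
      Ladder σ (last Δ h) (last Δ' h')
  | step {Δ₀ Δ₁ Δ₀' Δ₁' : Grc α β} (σ₀ : Δ₀ ≅ Δ₀') (σ₁ : Δ₁ ≅ Δ₁')
      {τ : Δ₀ ⟶ Δ₁} {i : Δ₁.Vert} {h : Grc.IsElementaryAt τ i} {R : Tower Δ₁}
      {τ' : Δ₀' ⟶ Δ₁'} {i' : Δ₁'.Vert} {h' : Grc.IsElementaryAt τ' i'} {R' : Tower Δ₁'}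
      (comm : τ ≫ σ₁.hom = σ₀.hom ≫ τ') (ladder : Ladder σ₁ R R') :
      Ladder σ₀ (step τ i h R) (step τ' i' h' R')

theorem Ladder.trans {Δ Δ' Δ'' : Grc α β} {σ : Δ ≅ Δ'} {σ' : Δ' ≅ Δ''} {T : Tower Δ}
    {T' : Tower Δ'} {T'' : Tower Δ''} (h : Ladder σ T T') (h' : Ladder σ' T' T'') :
    Ladder (σ ≪≫ σ') T T'' := by
  induction h generalizing Δ'' with
  | last σ _ _ =>
    cases h' with
    | last σ' _ _ => exact Ladder.last _ _ _
  | step σ₀ σ₁ comm _ ih =>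
    cases h' with
    | step σ₀' σ₁' comm' l =>
      refine Ladder.step _ (σ₁ ≪≫ σ₁') ?_ (ih l)
      simp only [Iso.trans_hom]
      rw [← Category.assoc, comm, Category.assoc, comm', Category.assoc]

/-- Two towers differ by interchanging two adjacent elementary maps with disjoint fibres: in the
commutative square formed by `Δ ⟶ P ⟶ S` and `Δ ⟶ Q ⟶ S`, the nontrivial fibre of `Δ ⟶ P` lives over
`a`, that of `Q ⟶ S` over the image of `a`, the nontrivial fibre of `Δ ⟶ Q` lives over `b`, that of
`P ⟶ S` over the image of `b`, and these two images are distinct. -/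
inductive Swap : ∀ {Δ : Grc α β}, Tower Δ → Tower Δ → Prop
  | here {Δ P Q S : Grc α β} {τ₁ : Δ ⟶ P} {τ₂ : P ⟶ S} {ρ₁ : Δ ⟶ Q} {ρ₂ : Q ⟶ S}
      {a : P.Vert} {b : Q.Vert} {i j : S.Vert}
      (hτ₁ : Grc.IsElementaryAt τ₁ a) (hτ₂ : Grc.IsElementaryAt τ₂ j)
      (hρ₁ : Grc.IsElementaryAt ρ₁ b) (hρ₂ : Grc.IsElementaryAt ρ₂ i)
      (ha : τ₂.φ a = i) (hb : ρ₂.φ b = j) (hij : i ≠ j) (comm : τ₁ ≫ τ₂ = ρ₁ ≫ ρ₂) (R : Tower S) :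
      Swap (step τ₁ a hτ₁ (step τ₂ j hτ₂ R)) (step ρ₁ b hρ₁ (step ρ₂ i hρ₂ R))
  | there {Δ Δ' : Grc α β} (τ : Δ ⟶ Δ') (i : Δ'.Vert) (h : Grc.IsElementaryAt τ i)
      {R R' : Tower Δ'} (s : Swap R R') : Swap (step τ i h R) (step τ i h R')

theorem Swap.symm {Δ : Grc α β} {T T' : Tower Δ} (h : Swap T T') : Swap T' T := by
  induction h with
  | here hτ₁ hτ₂ hρ₁ hρ₂ ha hb hij comm R =>
    exact Swap.here hρ₁ hρ₂ hτ₁ hτ₂ hb ha hij.symm comm.symm R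
  | there τ i h _ ih => exact Swap.there τ i h ih

/-- The graph-tree `T` is presented by the tower `Γ ≅ Δ ⟶ Δ₁ ⟶ ⋯ ⟶ Δₖ₋₁`. A tower of height one
presents the corolla decorated by `Γ`. In general, replace the composite `Γ ≅ Δ ⟶ Δ₁` by an
isomorphic canonical contraction `π : Γ ⟶ Γ₁`; then `T` is obtained from a tree presented by
`Γ₁ ≅ Δ₁ ⟶ ⋯ ⟶ Δₖ₋₁` by grafting the corolla decorated by the nontrivial fibre of `π` onto the leaf
labelled by the vertex over which that fibre lives. -/
def Presents : ∀ {Δ : Grc α β}, Tower Δ → ∀ Γ : Grc α β, (Γ ≅ Δ) → GTree α β → Prop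
  | _, last _ _, Γ, _, T => T = GTree.corolla Γ.toRawGraph
  | _, step (Δ' := Δ₁) τ _ _ R, Γ, ℓ, T =>
      ∃ (Γ₁ : Grc α β) (π : Γ ⟶ Γ₁) (x : Γ₁.Vert) (σ : Γ₁ ≅ Δ₁) (T₁ : GTree α β),
        Grc.IsCanonicalContraction π x ∧ π ≫ σ.hom = ℓ.hom ≫ τ ∧
        R.Presents Γ₁ σ T₁ ∧ T = GTree.graft (x : α) (π.fiber x) T₁ x

end Tower

/-- Labelled towers `Γ ≅ Δ₀ ⟶ Δ₁ ⟶ ⋯ ⟶ Δₖ₋₁`. -/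
structure LabelledTower (Γ : Grc α β) where
  base : Grc α β
  ℓ : Γ ≅ base
  tower : Tower base

namespace LabelledTower

variable {Γ : Grc α β}

/-- Isomorphisms of labelled towers of the first type: commutative ladders of isomorphisms under
`Γ`. -/
structure FirstType (𝒯 𝒮 : LabelledTower Γ) where
  σ : 𝒯.base ≅ 𝒮.base
  comm : 𝒯.ℓ ≪≫ σ = 𝒮.ℓ
  ladder : Tower.Ladder σ 𝒯.tower 𝒮.tower

/-- Composition of isomorphisms of the first type. -/
def FirstType.comp {𝒯 𝒮 ℛ : LabelledTower Γ} (f : FirstType 𝒯 𝒮) (g : FirstType 𝒮 ℛ) :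
    FirstType 𝒯 ℛ where
  σ := f.σ ≪≫ g.σ
  comm := by rw [← Iso.trans_assoc, f.comm, g.comm]
  ladder := f.ladder.trans g.ladder

/-- Isomorphisms of labelled towers of the second type: interchanging two adjacent elementary maps
with disjoint fibres. -/
inductive SecondType : LabelledTower Γ → LabelledTower Γ → Prop
  | mk (Δ : Grc α β) (ℓ : Γ ≅ Δ) {R R' : Tower Δ} (h : Tower.Swap R R') :
      SecondType ⟨Δ, ℓ, R⟩ ⟨Δ, ℓ, R'⟩

theorem SecondType.symm {𝒯 𝒮 : LabelledTower Γ} (h : SecondType 𝒯 𝒮) : SecondType 𝒮 𝒯 := by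
  obtain ⟨Δ, ℓ, h⟩ := h
  exact ⟨Δ, ℓ, h.symm⟩

/-- The generating isomorphisms of labelled towers. -/
inductive Generator (𝒯 𝒮 : LabelledTower Γ) : Type (max u v)
  | first (f : FirstType 𝒯 𝒮) : Generator 𝒯 𝒮
  | second (h : SecondType 𝒯 𝒮) : Generator 𝒯 𝒮

instance : Quiver (LabelledTower Γ) where
  Hom := Generator

/-- A generator as a morphism of the free groupoid. -/
def Generator.toFree {𝒯 𝒮 : LabelledTower Γ} (g : Generator 𝒯 𝒮) :
    (Quiver.FreeGroupoid.of (LabelledTower Γ)).obj 𝒯 ⟶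
      (Quiver.FreeGroupoid.of (LabelledTower Γ)).obj 𝒮 :=
  (Quiver.FreeGroupoid.of (LabelledTower Γ)).map g

/-- Isomorphisms of the first type compose as ladders do, and interchanging the same two maps twice
is the identity. -/
inductive Rel : HomRel (Quiver.FreeGroupoid (LabelledTower Γ))
  | comp {𝒯 𝒮 ℛ : LabelledTower Γ} (f : FirstType 𝒯 𝒮) (g : FirstType 𝒮 ℛ) :
      Rel ((Generator.first f).toFree ≫ (Generator.first g).toFree)
        (Generator.first (f.comp g)).toFree
  | swap {𝒯 𝒮 : LabelledTower Γ} (h : SecondType 𝒯 𝒮) :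
      Rel ((Generator.second h).toFree ≫ (Generator.second h.symm).toFree) (𝟙 _)

end LabelledTower

/-- The groupoid of labelled towers: its objects are labelled towers, its morphisms are generated by
the isomorphisms of the first and of the second type. -/
abbrev LTw (Γ : Grc α β) : Type (max u v) :=
  CategoryTheory.Quotient (LabelledTower.Rel (Γ := Γ))

/-- A labelled tower as an object of the groupoid of labelled towers. -/
def LabelledTower.toLTw {Γ : Grc α β} (𝒯 : LabelledTower Γ) : LTw Γ :=
  ⟨(Quiver.FreeGroupoid.of (LabelledTower Γ)).obj 𝒯⟩

end Towers

/-! Up to isomorphism of its target, a map of graphs is determined by the vertices it identifies and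
the half-edges it drops. If only one fibre is nontrivial, exactly one map in this isomorphism class
is a canonical contraction: the new vertex gets the smallest name, and its half-edges get the
lexicographic order (`IsSimpleAt.exists_canonical`, `IsCanonicalContraction.eq_of_comp_iso`).
Applied step by step, this shows that a labelled tower is isomorphic, by a ladder, to a unique tower
of canonical contractions (`Models.exists_canonicalTower`, `Models.unique`), so isomorphisms of the
first type become invisible. Conversely, a canonical contraction need not be elementary, since
monotonicity on vertices and the local orders at trivial fibres may fail. Both are repaired by
relabelling its source, working from the end of the tower backwards (`exists_straightens`,
`Models.exists_labelledTower`).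

A tower of canonical contractions, read from its last graph back to `Γ`, builds a tree: start with
the corolla of the last graph and graft the successive contracted fibres. Grafting a corolla onto a
leaf corresponds to inserting its graph into a vertex (`GTree.grOn_graft`), which inverts a
contraction, so the result is a graph-tree of `Γ`. Every graph-tree arises in this way, because an
extremal vertex can be pruned and its removal is a canonical contraction
(`CanonicalTower.exists_tree_eq`).

Two canonical towers with the same tree are two orders of pruning the same tree. If the first pruned
vertices differ, both can be removed, in either order, leaving a common smaller tree; this diamond
and induction on length connect the towers by interchanges of contractions of disjoint subgraphs
(`CanonicalTower.eqvGen_of_tree_eq`). Such an interchange is realized by an isomorphism of the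
second type between suitable labelled towers (`Models.exists_swap`), and isomorphisms of the second
type preserve the tree because disjoint graftings commute (`Models.tree_eq_of_swap`). Hence the
components are exactly the classes of towers with the same tree. -/

namespace Grc

/-! ### Half-edges, fibres and factorization of maps of graphs. -/

variable {α : Type u} {β : Type v}

theorem ext_toRawGraph {G G' : Grc α β} (h : G.toRawGraph = G'.toRawGraph) : G = G' := by
  cases G; cases G'; cases h; rfl

theorem vert_eq {G : Grc α β} {f : β} {x y : G.Vert} (hx : f ∈ G.star x) (hy : f ∈ G.star y) :
    x = y :=
  Subtype.ext (G.isDirectedGraph.star_disjoint _ _ _ hx hy)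

theorem flag_exists_vert {G : Grc α β} {f : β} (hf : G.IsFlag f) : ∃ x : G.Vert, f ∈ G.star x := by
  obtain ⟨x, hx, h⟩ := hf
  exact ⟨⟨x, hx⟩, h⟩

theorem isFlag_of_mem {G : Grc α β} {f : β} {x : α} (h : f ∈ G.star x) : G.IsFlag f :=
  ⟨x, mem_V_of_mem_star G h, h⟩

theorem isFlag_right {G : Grc α β} {f f' : β} (h : G.link f f') : G.IsFlag f' :=
  G.isDirectedGraph.link_isFlag _ _ (G.isDirectedGraph.link_symm _ _ h)

/-- The half-edge `f` of the source is not contracted by `τ`. -/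
def Hom.Kept {G G' : Grc α β} (τ : G ⟶ G') (f : β) : Prop := ∃ a : G'.Flag, (τ.ψ a : β) = f

theorem flagMap_eq {G G' : Grc α β} (ψ : G'.Flag → G.Flag) {f : β} (hf : G'.IsFlag f) :
    flagMap ψ f = ψ ⟨f, hf⟩ :=
  flagMap_val ψ ⟨f, hf⟩

theorem Hom.kept_ψ {G G' : Grc α β} (τ : G ⟶ G') (a : G'.Flag) : Hom.Kept τ (τ.ψ a) := ⟨a, rfl⟩

theorem Hom.kept_of_mem_legs {G G' : Grc α β} (τ : G ⟶ G') {f : β} (h : f ∈ G.legs) :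
    Hom.Kept τ f := by
  rw [← τ.legs_map, List.mem_map] at h
  obtain ⟨a, ha, rfl⟩ := h
  exact ⟨⟨a, G'.isFlag_of_mem_legs ha⟩, (flagMap_val τ.ψ _).symm⟩

/-- Legs always survive, so a dropped half-edge must belong to an internal edge. -/
theorem Hom.exists_link_of_not_kept {G G' : Grc α β} (τ : G ⟶ G') {f : β} (hf : G.IsFlag f)
    (h : ¬ Hom.Kept τ f) : ∃ f', G.link f f' := by
  by_contra! hn
  exact h (Hom.kept_of_mem_legs τ ((G.isDirectedGraph.mem_legs f).2 ⟨hf, hn⟩))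

theorem Hom.kept_of_link {G G' : Grc α β} (τ : G ⟶ G') {f f' : β} (h : G.link f f')
    (hf : Hom.Kept τ f) : Hom.Kept τ f' := by
  obtain ⟨a, rfl⟩ := hf
  obtain ⟨b, hb, -⟩ := (τ.link_iff a f').1 h
  exact ⟨b, hb⟩

theorem Hom.link_ψ {G G' : Grc α β} (τ : G ⟶ G') (a b : G'.Flag) :
    G.link (τ.ψ a) (τ.ψ b) ↔ G'.link a b := by
  rw [τ.link_iff]
  constructor
  · rintro ⟨c, hc, h⟩
    rwa [← τ.ψ_injective (Subtype.ext hc)]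
  · exact fun h => ⟨b, rfl, h⟩

theorem Hom.φ_eq_of_link {G G' : Grc α β} (τ : G ⟶ G') {f f' : β} {x y : G.Vert}
    (h : ¬ Hom.Kept τ f) (hl : G.link f f') (hx : f ∈ G.star x) (hy : f' ∈ G.star y) :
    τ.φ x = τ.φ y :=
  τ.contracted ⟨f, isFlag_of_mem hx⟩ ⟨f', isFlag_of_mem hy⟩ x y
    (fun ⟨a, ha⟩ => h ⟨a, congrArg Subtype.val ha⟩) hl hx hy

theorem Hom.mem_star_iff {G G' : Grc α β} (τ : G ⟶ G') (a : G'.Flag) (i : G'.Vert) :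
    (a : β) ∈ G'.star i ↔ ∃ x, τ.φ x = i ∧ (τ.ψ a : β) ∈ G.star x := by
  constructor
  · intro h
    obtain ⟨x, hx, hi⟩ := exists_vert τ a h
    exact ⟨x, Subtype.ext hi, hx⟩
  · rintro ⟨x, rfl, h⟩
    exact τ.adj a x h

@[simp] theorem comp_φ {G₁ G₂ G₃ : Grc α β} (f : G₁ ⟶ G₂) (g : G₂ ⟶ G₃) (x : G₁.Vert) :
    (f ≫ g).φ x = g.φ (f.φ x) := rfl

@[simp] theorem comp_ψ {G₁ G₂ G₃ : Grc α β} (f : G₁ ⟶ G₂) (g : G₂ ⟶ G₃) (a : G₃.Flag) :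
    (f ≫ g).ψ a = f.ψ (g.ψ a) := rfl

@[simp] theorem id_φ (G : Grc α β) (x : G.Vert) : Hom.φ (𝟙 G) x = x := rfl

@[simp] theorem id_ψ (G : Grc α β) (a : G.Flag) : Hom.ψ (𝟙 G) a = a := rfl

theorem hom_ext {G G' : Grc α β} {f g : G ⟶ G'} (hφ : ∀ x, f.φ x = g.φ x)
    (hψ : ∀ a, f.ψ a = g.ψ a) : f = g :=
  Hom.ext (funext hφ) (funext hψ)

theorem fiber_mem_V {G G' : Grc α β} (τ : G ⟶ G') (i : G'.Vert) (x : α) :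
    x ∈ (τ.fiber i).V ↔ ∃ h : x ∈ G.V, τ.φ ⟨x, h⟩ = i :=
  fiberGraph_mem_V _ _ _ _

theorem fiber_mem_V' {G G' : Grc α β} (τ : G ⟶ G') (i : G'.Vert) (x : G.Vert) :
    (x : α) ∈ (τ.fiber i).V ↔ τ.φ x = i := by
  rw [fiber_mem_V]
  exact ⟨fun ⟨_, h⟩ => h, fun h => ⟨x.2, h⟩⟩

theorem fiber_star {G G' : Grc α β} (τ : G ⟶ G') (i : G'.Vert) (x : α)
    (h : x ∈ (τ.fiber i).V) : (τ.fiber i).star x = G.star x :=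
  if_pos ((fiber_mem_V _ _ _).1 h)

theorem fiber_star_eq_nil {G G' : Grc α β} (τ : G ⟶ G') (i : G'.Vert) (x : α)
    (h : x ∉ (τ.fiber i).V) : (τ.fiber i).star x = [] :=
  if_neg fun h' => h ((fiber_mem_V _ _ _).2 h')

theorem fiber_mem_star {G G' : Grc α β} (τ : G ⟶ G') (i : G'.Vert) (x : α) (f : β) :
    f ∈ (τ.fiber i).star x ↔ x ∈ (τ.fiber i).V ∧ f ∈ G.star x := by
  rw [fiber_mem_V]
  exact fiberGraph_mem_star _ _ _ _ _

theorem fiber_isFlag {G G' : Grc α β} (τ : G ⟶ G') (i : G'.Vert) (f : β) :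
    (τ.fiber i).IsFlag f ↔ ∃ x : G.Vert, τ.φ x = i ∧ f ∈ G.star x := by
  constructor
  · rintro ⟨x, hx, hf⟩
    obtain ⟨hxV, hi⟩ := (fiber_mem_V _ _ _).1 hx
    exact ⟨⟨x, hxV⟩, hi, ((fiber_mem_star _ _ _ _).1 hf).2⟩
  · rintro ⟨x, hx, hf⟩
    exact ⟨x, (fiber_mem_V' _ _ _).2 hx, (fiber_mem_star _ _ _ _).2 ⟨(fiber_mem_V' _ _ _).2 hx, hf⟩⟩

theorem fiber_link {G G' : Grc α β} (τ : G ⟶ G') (i : G'.Vert) (f f' : β) :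
    (τ.fiber i).link f f' ↔
      G.link f f' ∧ (∃ x : G.Vert, τ.φ x = i ∧ f ∈ G.star x) ∧ ¬ Hom.Kept τ f :=
  Iff.rfl

/-- The dropped half-edges are stable under the involution and both ends of a dropped edge lie in
the same fibre, so the involution restricts. The half-edges of the fibre left unmatched are the
surviving ones, which are the images of the half-edges of the target at `i`. -/
theorem fiber_isDirectedGraph {G G' : Grc α β} (τ : G ⟶ G') (i : G'.Vert) :
    (τ.fiber i).IsDirectedGraph where
  star_eq_nil := fiber_star_eq_nil τ i
  star_nodup x := by
    by_cases h : x ∈ (τ.fiber i).V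
    · rw [fiber_star _ _ _ h]
      exact G.isDirectedGraph.star_nodup x
    · rw [fiber_star_eq_nil _ _ _ h]
      exact List.nodup_nil
  star_disjoint x y f hx hy :=
    G.isDirectedGraph.star_disjoint x y f ((fiber_mem_star _ _ _ _).1 hx).2
      ((fiber_mem_star _ _ _ _).1 hy).2
  link_isFlag f f' h := (fiber_isFlag _ _ _).2 ((fiber_link _ _ _ _).1 h).2.1
  link_symm f f' h := by
    obtain ⟨hl, ⟨x, hx, hf⟩, hn⟩ := (fiber_link _ _ _ _).1 h
    have hl' := G.isDirectedGraph.link_symm _ _ hl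
    obtain ⟨y, hy⟩ := flag_exists_vert (isFlag_right hl)
    exact (fiber_link _ _ _ _).2 ⟨hl', ⟨y, by rw [← Hom.φ_eq_of_link τ hn hl hf hy, hx], hy⟩,
      fun hk => hn (Hom.kept_of_link τ hl' hk)⟩
  link_irrefl f h := G.isDirectedGraph.link_irrefl f h.1
  link_unique f a b ha hb := G.isDirectedGraph.link_unique f a b ha.1 hb.1
  legs_nodup := by
    refine List.Nodup.map_on ?_ (G'.isDirectedGraph.star_nodup i)
    intro a ha b hb hab
    rw [flagMap_eq _ (isFlag_of_mem ha), flagMap_eq _ (isFlag_of_mem hb)] at hab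
    exact congrArg Subtype.val (τ.ψ_injective (Subtype.ext hab))
  mem_legs f := by
    rw [fiber_isFlag]
    constructor
    · intro h
      obtain ⟨a, ha, rfl⟩ := List.mem_map.1 h
      obtain ⟨x, hx, hxa⟩ := (Hom.mem_star_iff τ ⟨a, isFlag_of_mem ha⟩ i).1 ha
      rw [flagMap_eq _ (isFlag_of_mem ha)]
      exact ⟨⟨x, hx, hxa⟩, fun f' hl => hl.2.2 (Hom.kept_ψ τ _)⟩
    · rintro ⟨⟨x, hx, hf⟩, hn⟩
      have hk : Hom.Kept τ f := by
        by_contra hk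
        obtain ⟨f', hl⟩ := Hom.exists_link_of_not_kept τ (isFlag_of_mem hf) hk
        exact hn f' ⟨hl, ⟨x, hx, hf⟩, hk⟩
      obtain ⟨a, rfl⟩ := hk
      refine List.mem_map.2 ⟨a, ?_, flagMap_val τ.ψ a⟩
      rw [← hx]
      exact τ.adj a x hf

/-- A map factors through another one if it contracts more vertices and more half-edges. -/
theorem exists_factor {G A B : Grc α β} (f : G ⟶ A) (g : G ⟶ B)
    (hφ : ∀ x y, f.φ x = f.φ y → g.φ x = g.φ y) (hψ : ∀ h, Hom.Kept g h → Hom.Kept f h) :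
    ∃ k : A ⟶ B, f ≫ k = g := by
  have hψ' : ∀ b : B.Flag, ∃ a : A.Flag, f.ψ a = g.ψ b := fun b => by
    obtain ⟨a, ha⟩ := hψ _ (Hom.kept_ψ g b)
    exact ⟨a, Subtype.ext ha⟩
  choose kψ hkψ using hψ'
  -- The factor on vertices is `g.φ` evaluated at any preimage under `f.φ`; `hφ` makes the choice of
  -- preimage irrelevant.
  obtain ⟨s, hs⟩ := f.φ_surjective.hasRightInverse
  set kφ : A.Vert → B.Vert := fun a => g.φ (s a) with hkφ
  have hk : ∀ x, kφ (f.φ x) = g.φ x := fun x => hφ _ _ (hs _)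
  have hkept : ∀ a : A.Flag, (∃ b, kψ b = a) ↔ Hom.Kept g (f.ψ a) := fun a => by
    constructor
    · rintro ⟨b, rfl⟩
      exact ⟨b, by rw [hkψ]⟩
    · rintro ⟨b, hb⟩
      exact ⟨b, f.ψ_injective (by rw [hkψ]; exact Subtype.ext hb)⟩
  have hinj : Function.Injective kψ := fun b b' h => g.ψ_injective (by rw [← hkψ, ← hkψ, h])
  refine ⟨⟨kφ, kψ, ?_, hinj, ?_, ?_, ?_, ?_, ?_⟩, ?_⟩
  · intro b
    obtain ⟨x, rfl⟩ := g.φ_surjective b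
    exact ⟨f.φ x, hk x⟩
  · intro b y hb
    obtain ⟨x, rfl, hx⟩ := (Hom.mem_star_iff f _ _).1 hb
    rw [hkψ] at hx
    rw [hk]
    exact g.adj b x hx
  · intro b h
    constructor
    · intro hl
      obtain ⟨a', rfl⟩ : ∃ a : A.Flag, (a : β) = h := ⟨⟨h, isFlag_right hl⟩, rfl⟩
      rw [← Hom.link_ψ f, hkψ, g.link_iff] at hl
      obtain ⟨b', hb', hl⟩ := hl
      refine ⟨b', ?_, hl⟩
      rw [f.ψ_injective ((hkψ b').trans (Subtype.ext hb'))]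
    · rintro ⟨b', rfl, hl⟩
      rwa [← Hom.link_ψ f, hkψ, hkψ, Hom.link_ψ]
  · intro a a' x y hn hl ha ha'
    obtain ⟨u, rfl, hu⟩ := (Hom.mem_star_iff f _ _).1 ha
    obtain ⟨w, rfl, hw⟩ := (Hom.mem_star_iff f _ _).1 ha'
    rw [hk, hk]
    rw [hkept] at hn
    exact Hom.φ_eq_of_link g hn ((Hom.link_ψ f a a').2 hl) hu hw
  -- Lists of half-edges of `A` are separated by the injection `f.ψ`, so the two orders of legs may
  -- be compared inside `G`.
  · have hf : ∀ l l' : List β, (∀ a ∈ l, A.IsFlag a) → (∀ a ∈ l', A.IsFlag a) →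
        l.map (flagMap f.ψ) = l'.map (flagMap f.ψ) → l = l' := by
      intro l l' hl hl' h
      induction l generalizing l' with
      | nil => simpa using h.symm
      | cons a l ih =>
        cases l' with
        | nil => simp at h
        | cons a' l' =>
          simp only [List.map_cons, List.cons.injEq] at h
          rw [ih l' (fun _ h => hl _ (List.mem_cons_of_mem _ h))
            (fun _ h => hl' _ (List.mem_cons_of_mem _ h)) h.2]
          have h1 := h.1
          rw [flagMap_eq _ (hl a List.mem_cons_self), flagMap_eq _ (hl' a' List.mem_cons_self)] at h1
          have h2 : a = a' := congrArg Subtype.val (f.ψ_injective (Subtype.ext h1))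
          rw [h2]
    apply hf
    · intro a ha
      obtain ⟨b, hb, rfl⟩ := List.mem_map.1 ha
      rw [flagMap_eq _ (B.isFlag_of_mem_legs hb)]
      exact (kψ _).2
    · exact fun a ha => A.isFlag_of_mem_legs ha
    · rw [f.legs_map, ← g.legs_map, List.map_map]
      refine List.map_congr_left fun b hb => ?_
      rw [Function.comp_apply, flagMap_eq _ (B.isFlag_of_mem_legs hb), flagMap_val,
        flagMap_eq _ (B.isFlag_of_mem_legs hb), hkψ]
  · intro i
    refine ⟨?_, ?_⟩
    · obtain ⟨x, hx⟩ := g.φ_surjective i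
      exact ⟨f.φ x, (fiberGraph_mem_V _ _ _ _).2 ⟨(f.φ x).2, by rw [← hx]; exact hk x⟩⟩
    · intro x hx y hy
      obtain ⟨hx, hxi⟩ := (fiberGraph_mem_V _ _ _ _).1 hx
      obtain ⟨hy, hyi⟩ := (fiberGraph_mem_V _ _ _ _).1 hy
      obtain ⟨u, hu⟩ := f.φ_surjective ⟨x, hx⟩
      obtain ⟨w, hw⟩ := f.φ_surjective ⟨y, hy⟩
      -- A path in the fibre of `g` is pushed forward along `f`: an edge surviving under `f` gives
      -- an edge of the fibre of the factor, and an edge contracted by `f` has its two ends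
      -- identified.
      have key : ∀ z, Relation.ReflTransGen (g.fiber i).Joined (u : α) z →
          ∃ hz : z ∈ G.V, Relation.ReflTransGen (fiberGraph kφ kψ i).Joined x (f.φ ⟨z, hz⟩) := by
        intro z hz
        induction hz with
        | refl => exact ⟨u.2, by rw [hu]⟩
        | @tail z z' _ hj ih =>
          obtain ⟨hz, ih⟩ := ih
          obtain ⟨h, h', hh, hh', hl, -, hn⟩ := hj
          obtain ⟨hzV, hh⟩ := (fiber_mem_star g _ _ _).1 hh
          obtain ⟨hzV', hh'⟩ := (fiber_mem_star g _ _ _).1 hh'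
          obtain ⟨_, hzi⟩ := (fiber_mem_V _ _ _).1 hzV
          obtain ⟨hz', hzi'⟩ := (fiber_mem_V _ _ _).1 hzV'
          refine ⟨hz', ?_⟩
          by_cases hk' : Hom.Kept f h
          · obtain ⟨a', rfl⟩ := Hom.kept_of_link f hl hk'
            obtain ⟨a, rfl⟩ := hk'
            refine ih.tail ⟨a, a', ?_, ?_, (Hom.link_ψ f a a').1 hl, ⟨f.φ ⟨z, hz⟩, ?_, ?_⟩, ?_⟩
            · exact (fiberGraph_mem_star _ _ _ _ _).2
                ⟨⟨(f.φ ⟨z, hz⟩).2, (hk _).trans hzi⟩, f.adj a ⟨z, hz⟩ hh⟩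
            · exact (fiberGraph_mem_star _ _ _ _ _).2
                ⟨⟨(f.φ ⟨z', hz'⟩).2, (hk _).trans hzi'⟩, f.adj a' ⟨z', hz'⟩ hh'⟩
            · exact (hk _).trans hzi
            · exact f.adj a ⟨z, hz⟩ hh
            · rintro ⟨b, hb⟩
              exact hn ((hkept a).1 ⟨b, Subtype.ext hb⟩)
          · rwa [← Hom.φ_eq_of_link f (x := ⟨z, hz⟩) (y := ⟨z', hz'⟩) hk' hl hh hh']
      obtain ⟨_, h⟩ := key w ((g.fiber_connected i).2 u
        ((fiber_mem_V' g i u).2 (by rw [← hk, hu, hxi])) w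
        ((fiber_mem_V' g i w).2 (by rw [← hk, hw, hyi])))
      rwa [show f.φ ⟨w, _⟩ = ⟨y, hy⟩ from hw] at h
  · exact hom_ext hk hkψ

/-- Maps are epimorphisms because `φ` is surjective and `ψ` injective. This makes the isomorphisms
in ladders unique. -/
theorem hom_epi {G A B : Grc α β} (f : G ⟶ A) {k k' : A ⟶ B} (h : f ≫ k = f ≫ k') : k = k' := by
  refine hom_ext (fun a => ?_) (fun b => ?_)
  · obtain ⟨x, rfl⟩ := f.φ_surjective a
    rw [← comp_φ, h, comp_φ]
  · refine f.ψ_injective ?_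
    rw [← comp_ψ, h, comp_ψ]

/-- Two maps contracting the same vertices and half-edges have isomorphic targets. -/
theorem exists_iso {G A B : Grc α β} (f : G ⟶ A) (g : G ⟶ B)
    (hφ : ∀ x y, f.φ x = f.φ y ↔ g.φ x = g.φ y) (hψ : ∀ h, Hom.Kept g h ↔ Hom.Kept f h) :
    ∃ σ : A ≅ B, f ≫ σ.hom = g := by
  obtain ⟨k, hk⟩ := exists_factor f g (fun x y => (hφ x y).1) fun h => (hψ h).1
  obtain ⟨l, hl⟩ := exists_factor g f (fun x y => (hφ x y).2) fun h => (hψ h).2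
  refine ⟨⟨k, l, hom_epi f ?_, hom_epi g ?_⟩, hk⟩
  · rw [← Category.assoc, hk, hl, Category.comp_id]
  · rw [← Category.assoc, hl, hk, Category.comp_id]

theorem iso_φ_injective {A B : Grc α β} (σ : A ≅ B) : Function.Injective σ.hom.φ := by
  intro x y h
  have h' := congrArg σ.inv.φ h
  rwa [← comp_φ, ← comp_φ, σ.hom_inv_id] at h'

theorem kept_iso {A B : Grc α β} (σ : A ≅ B) {h : β} (hh : A.IsFlag h) : Hom.Kept σ.hom h := by
  refine ⟨σ.inv.ψ ⟨h, hh⟩, ?_⟩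
  rw [← comp_ψ, σ.hom_inv_id]
  rfl

theorem kept_comp {A B C : Grc α β} (f : A ⟶ B) (g : B ⟶ C) (h : β) :
    Hom.Kept (f ≫ g) h ↔ ∃ a : B.Flag, (f.ψ a : β) = h ∧ Hom.Kept g a := by
  constructor
  · rintro ⟨c, rfl⟩
    exact ⟨g.ψ c, rfl, Hom.kept_ψ g c⟩
  · rintro ⟨a, rfl, c, hc⟩
    exact ⟨c, by rw [comp_ψ, Subtype.ext hc]⟩

theorem kept_comp_iso {A B C : Grc α β} (f : A ⟶ B) (σ : B ≅ C) (h : β) :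
    Hom.Kept (f ≫ σ.hom) h ↔ Hom.Kept f h := by
  rw [kept_comp]
  exact ⟨fun ⟨a, ha, _⟩ => ⟨a, ha⟩, fun ⟨a, ha⟩ => ⟨a, ha, kept_iso σ a.2⟩⟩

theorem isFlag_of_kept {A B : Grc α β} {f : A ⟶ B} {h : β} (hk : Hom.Kept f h) : A.IsFlag h := by
  obtain ⟨a, rfl⟩ := hk
  exact (f.ψ a).2

end Grc

/-- Used for leg orders: once legs are ordered lexicographically, their underlying set determines
their order. -/
theorem List.Sublist.eq_of_mem_iff {γ : Type*} {l l₁ l₂ : List γ} (hl : l.Nodup)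
    (h₁ : l₁.Sublist l) (h₂ : l₂.Sublist l) (h : ∀ a, a ∈ l₁ ↔ a ∈ l₂) : l₁ = l₂ := by
  classical
  have key : ∀ l' : List γ, l'.Sublist l → l' = l.filter (· ∈ l') := by
    intro l' hl'
    have hs : l'.Sublist (l.filter (· ∈ l')) := by
      have := hl'.filter (· ∈ l')
      rwa [List.filter_eq_self.2 (by simp)] at this
    refine hs.eq_of_length (List.Perm.length_eq ?_)
    refine (List.perm_ext_iff_of_nodup (hl.sublist hl') (hl.filter _)).2 fun a => ?_
    simpa using fun ha => hl'.subset ha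
  rw [key l₁ h₁, key l₂ h₂]
  simp only [h]

/-! ### Contraction of a subgraph and insertion into a vertex, without axioms. -/

namespace RawGraph

variable {α : Type u} {β : Type v}

theorem ext_of_eq {G H : RawGraph α β} (hV : G.V = H.V) (hstar : G.star = H.star)
    (hlink : G.link = H.link) (hlegs : G.legs = H.legs) : G = H := by
  cases G; cases H
  simp_all

variable [LinearOrder α]

theorem mem_flagList (G : RawGraph α β) (f : β) : f ∈ G.flagList ↔ G.IsFlag f := by
  simp [flagList, IsFlag]

theorem IsDirectedGraph.nodup_flagList {G : RawGraph α β} (h : G.IsDirectedGraph) :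
    G.flagList.Nodup := by
  refine List.nodup_flatMap.2 ⟨fun x _ => h.star_nodup x, ?_⟩
  refine (Finset.sort_nodup G.V (· ≤ ·)).imp fun {x y} hxy => ?_
  exact fun f hx hy => hxy (h.star_disjoint x y f hx hy)

/-- The graph `F` may decorate a vertex of a graph-tree other than the root, the output edge of
that vertex being labelled by `x`. -/
structure IsDecoration (F : RawGraph α β) (x : α) : Prop where
  directed : F.IsDirectedGraph
  connected : F.IsConnected
  hasEdge : F.HasEdge
  isLeast : IsLeast (F.V : Set α) x
  sublist : F.legs.Sublist F.flagList

theorem IsDecoration.mem_V {F : RawGraph α β} {x : α} (h : F.IsDecoration x) : x ∈ F.V :=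
  h.isLeast.1

theorem IsDecoration.isFlag_of_mem_legs {F : RawGraph α β} {x : α} (h : F.IsDecoration x) {f : β}
    (hf : f ∈ F.legs) : F.IsFlag f := ((h.directed.mem_legs f).1 hf).1

theorem IsDecoration.not_link_of_mem_legs {F : RawGraph α β} {x : α} (h : F.IsDecoration x)
    {f f' : β} (hf : f ∈ F.legs) : ¬ F.link f f' := ((h.directed.mem_legs f).1 hf).2 f'

/-- The result of contracting the subgraph `F` of `G` to the vertex `x`. -/
def contract (G F : RawGraph α β) (x : α) : RawGraph α β where
  V := insert x (G.V \ F.V)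
  star z := if z = x then F.legs else if z ∈ F.V then [] else G.star z
  link f f' := G.link f f' ∧ ¬ F.link f f'
  legs := G.legs

theorem contract_star_self (G F : RawGraph α β) (x : α) : (G.contract F x).star x = F.legs :=
  if_pos rfl

theorem contract_star_of_notMem (G F : RawGraph α β) {x z : α} (hx : z ≠ x) (hz : z ∉ F.V) :
    (G.contract F x).star z = G.star z := by
  simp [contract, hx, hz]

theorem mem_contract_star {G F : RawGraph α β} {x z : α} {f : β}
    (h : f ∈ (G.contract F x).star z) :
    z = x ∧ f ∈ F.legs ∨ z ≠ x ∧ z ∉ F.V ∧ f ∈ G.star z := by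
  unfold contract at h
  dsimp only at h
  split_ifs at h with h1 h2
  · exact Or.inl ⟨h1, h⟩
  · simp at h
  · exact Or.inr ⟨h1, h2, h⟩

theorem mem_contract_V {G F : RawGraph α β} {x z : α} :
    z ∈ (G.contract F x).V ↔ z = x ∨ z ∈ G.V ∧ z ∉ F.V := by
  simp [contract]

/-- The result of inserting the graph `F` into the vertex `x` of `G`. -/
def insertAt (x : α) (F G : RawGraph α β) : RawGraph α β where
  V := G.V.erase x ∪ F.V
  star z := if z ∈ F.V then F.star z else G.star z
  link f f' := G.link f f' ∨ F.link f f'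
  legs := G.legs

end RawGraph

/-! ### Simple maps: the order-free part of elementary maps and canonical contractions. -/

namespace Grc

variable {α : Type u} {β : Type v}

/-- `F` is a subgraph of `Γ` which can be contracted to the vertex `x`. -/
structure IsContractible [LinearOrder α] (Γ : Grc α β) (F : RawGraph α β) (x : α) : Prop
    extends F.IsDecoration x where
  V_subset : F.V ⊆ Γ.V
  star_eq : ∀ z ∈ F.V, F.star z = Γ.star z
  link_le : ∀ f f', F.link f f' → Γ.link f f'

/-- Exactly one fibre of `τ`, namely that over `i`, has internal edges, and the other ones have
one vertex. -/
structure IsSimpleAt {G G' : Grc α β} (τ : G ⟶ G') (i : G'.Vert) : Prop where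
  not_kept : ∃ f, G.IsFlag f ∧ ¬ Hom.Kept τ f
  eq_or_eq : ∀ x y, τ.φ x = τ.φ y → x = y ∨ τ.φ x = i
  φ_eq : ∀ (f : β) (x : G.Vert), f ∈ G.star x → ¬ Hom.Kept τ f → τ.φ x = i

theorem IsSimpleAt.unique {G G' : Grc α β} {τ : G ⟶ G'} {i i' : G'.Vert} (h : IsSimpleAt τ i)
    (h' : IsSimpleAt τ i') : i = i' := by
  obtain ⟨f, hf, hn⟩ := h.not_kept
  obtain ⟨x, hx⟩ := flag_exists_vert hf
  rw [← h.φ_eq f x hx hn, ← h'.φ_eq f x hx hn]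

theorem IsSimpleAt.hasEdge {G G' : Grc α β} {τ : G ⟶ G'} {i : G'.Vert} (h : IsSimpleAt τ i) :
    (τ.fiber i).HasEdge := by
  obtain ⟨f, hf, hn⟩ := h.not_kept
  obtain ⟨x, hx⟩ := flag_exists_vert hf
  obtain ⟨f', hl⟩ := Hom.exists_link_of_not_kept τ hf hn
  exact ⟨f, f', hl, ⟨x, h.φ_eq f x hx hn, hx⟩, hn⟩

theorem not_kept_of_hasEdge {G G' : Grc α β} {τ : G ⟶ G'} {i : G'.Vert}
    (h : (τ.fiber i).HasEdge) : ∃ f, G.IsFlag f ∧ ¬ Hom.Kept τ f := by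
  obtain ⟨f, f', hl, ⟨x, _, hx⟩, hn⟩ := h
  exact ⟨f, isFlag_of_mem hx, hn⟩

/-- The set of dropped half-edges can be read off from the single nontrivial fibre. -/
theorem not_kept_iff_of_isSimpleAt {G G' : Grc α β} {τ : G ⟶ G'} {i : G'.Vert}
    (h : IsSimpleAt τ i) {f : β} (hf : G.IsFlag f) :
    ¬ Hom.Kept τ f ↔ ∃ f', (τ.fiber i).link f f' := by
  constructor
  · intro hn
    obtain ⟨x, hx⟩ := flag_exists_vert hf
    obtain ⟨f', hl⟩ := Hom.exists_link_of_not_kept τ hf hn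
    exact ⟨f', hl, ⟨x, h.φ_eq f x hx hn, hx⟩, hn⟩
  · rintro ⟨f', h⟩
    exact h.2.2

theorem IsSimpleAt.comp_iso {G G' G'' : Grc α β} {τ : G ⟶ G'} {i : G'.Vert} (h : IsSimpleAt τ i)
    (σ : G' ≅ G'') : IsSimpleAt (τ ≫ σ.hom) (σ.hom.φ i) where
  not_kept := by
    obtain ⟨f, hf, hn⟩ := h.not_kept
    exact ⟨f, hf, by rwa [kept_comp_iso]⟩
  eq_or_eq x y hxy := (h.eq_or_eq x y (iso_φ_injective σ hxy)).imp_right fun h => by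
    rw [comp_φ, h]
  φ_eq f x hf hn := by
    rw [kept_comp_iso] at hn
    rw [comp_φ, h.φ_eq f x hf hn]

theorem IsSimpleAt.iso_comp {G₀ G G' : Grc α β} {τ : G ⟶ G'} {i : G'.Vert} (h : IsSimpleAt τ i)
    (σ : G₀ ≅ G) : IsSimpleAt (σ.hom ≫ τ) i where
  not_kept := by
    obtain ⟨f, hf, hn⟩ := h.not_kept
    refine ⟨σ.hom.ψ ⟨f, hf⟩, (σ.hom.ψ _).2, ?_⟩
    rw [kept_comp]
    rintro ⟨a, ha, hk⟩
    rw [σ.hom.ψ_injective (Subtype.ext ha)] at hk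
    exact hn hk
  eq_or_eq _ _ hxy := (h.eq_or_eq _ _ hxy).imp_left fun h => iso_φ_injective σ h
  φ_eq f x hf hn := by
    obtain ⟨a, rfl⟩ := kept_iso σ (isFlag_of_mem hf)
    exact h.φ_eq a _ (σ.hom.adj a x hf) fun hk => hn ((kept_comp _ _ _).2 ⟨a, rfl, hk⟩)

section LinearOrder

variable [LinearOrder α]

/-- A trivial fibre has one vertex and no internal edges; monotonicity and the local orders are
forgotten. What remains is stable under isomorphisms on both sides, unlike elementarity. -/
theorem IsElementaryAt.isSimpleAt {G G' : Grc α β} {τ : G ⟶ G'} {i : G'.Vert}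
    (h : IsElementaryAt τ i) : IsSimpleAt τ i where
  not_kept := not_kept_of_hasEdge h.hasEdge
  eq_or_eq x y hxy := by
    by_contra! hc
    obtain ⟨-, z, hz, -⟩ := h.isTrivial _ hc.2
    have hx := (fiber_mem_V' τ (τ.φ x) x).2 rfl
    have hy := (fiber_mem_V' τ (τ.φ x) y).2 hxy.symm
    rw [hz, Finset.mem_singleton] at hx hy
    exact hc.1 (Subtype.ext (hx.trans hy.symm))
  φ_eq f x hf hn := by
    by_contra hc
    obtain ⟨f', hl⟩ := Hom.exists_link_of_not_kept τ (isFlag_of_mem hf) hn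
    exact (h.isTrivial _ hc).1 ⟨f, f', hl, ⟨x, rfl, hf⟩, hn⟩

/-! ### The canonical contraction of a given subgraph. -/

section Contract

variable {Γ : Grc α β} {F : RawGraph α β} {x : α}

theorem IsContractible.isFlag_iff (h : IsContractible Γ F x) {f : β} {z : α}
    (hf : f ∈ Γ.star z) : F.IsFlag f ↔ z ∈ F.V := by
  constructor
  · rintro ⟨w, hw, hfw⟩
    rw [h.star_eq w hw] at hfw
    rwa [Γ.isDirectedGraph.star_disjoint _ _ _ hf hfw]
  · exact fun hz => ⟨z, hz, by rwa [h.star_eq z hz]⟩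

theorem IsContractible.isFlag (h : IsContractible Γ F x) {f : β} (hf : F.IsFlag f) :
    Γ.IsFlag f := by
  obtain ⟨z, hz, hfz⟩ := hf
  exact ⟨z, h.V_subset hz, by rwa [← h.star_eq z hz]⟩

/-- The half-edges of `F` without a partner in `F` are its legs, and these reappear at the new
vertex; so only the internal edges of `F` disappear. -/
theorem IsContractible.contract_isFlag_iff (h : IsContractible Γ F x) {f : β} :
    (Γ.contract F x).IsFlag f ↔ Γ.IsFlag f ∧ ∀ f', ¬ F.link f f' := by
  constructor
  · rintro ⟨z, -, hz⟩
    rcases RawGraph.mem_contract_star hz with ⟨-, hf⟩ | ⟨-, hzF, hf⟩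
    · exact ⟨h.isFlag (h.isFlag_of_mem_legs hf), fun f' => h.not_link_of_mem_legs hf⟩
    · exact ⟨isFlag_of_mem hf, fun f' hl =>
        hzF ((h.isFlag_iff hf).1 (h.directed.link_isFlag _ _ hl))⟩
  · rintro ⟨⟨z, hz, hf⟩, hl⟩
    by_cases hzF : z ∈ F.V
    · refine ⟨x, RawGraph.mem_contract_V.2 (Or.inl rfl), ?_⟩
      rw [RawGraph.contract_star_self, h.directed.mem_legs]
      exact ⟨(h.isFlag_iff hf).2 hzF, hl⟩
    · refine ⟨z, RawGraph.mem_contract_V.2 (Or.inr ⟨hz, hzF⟩), ?_⟩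
      rwa [RawGraph.contract_star_of_notMem _ _ _ hzF]
      rintro rfl
      exact hzF h.mem_V

/-- A half-edge has only one partner in `Γ`, so being dropped is a property of a half-edge and not
of a pair. -/
theorem IsContractible.link_of_link (h : IsContractible Γ F x) {f f' f'' : β}
    (hl : Γ.link f f') (hF : F.link f f'') : F.link f f' := by
  rwa [Γ.isDirectedGraph.link_unique _ _ _ hl (h.link_le _ _ hF)]

/-- The vertex of the contracted graph to which a vertex of `Γ` is sent. -/
def contractMap (F : RawGraph α β) (x z : α) : α := if z ∈ F.V then x else z

theorem contractMap_mem (F : RawGraph α β) (x : α) {z : α} (hz : z ∈ Γ.V) :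
    contractMap F x z ∈ (Γ.contract F x).V := by
  unfold contractMap
  rw [RawGraph.mem_contract_V]
  split
  · exact Or.inl rfl
  · exact Or.inr ⟨hz, by assumption⟩

theorem IsContractible.contract_V_subset (h : IsContractible Γ F x) {z : α}
    (hz : z ∈ (Γ.contract F x).V) : z ∈ Γ.V ∧ contractMap F x z = z := by
  rcases RawGraph.mem_contract_V.1 hz with rfl | ⟨hz, hzF⟩
  · exact ⟨h.V_subset h.mem_V, if_pos h.mem_V⟩
  · exact ⟨hz, if_neg hzF⟩

theorem IsContractible.contract_adj (h : IsContractible Γ F x) {f : β} {z : α}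
    (hf : (Γ.contract F x).IsFlag f) (hz : f ∈ Γ.star z) :
    f ∈ (Γ.contract F x).star (contractMap F x z) := by
  have hf := (h.contract_isFlag_iff.1 hf).2
  unfold contractMap
  split_ifs with hzF
  · rw [RawGraph.contract_star_self, h.directed.mem_legs]
    exact ⟨(h.isFlag_iff hz).2 hzF, hf⟩
  · rwa [RawGraph.contract_star_of_notMem _ _ _ hzF]
    rintro rfl
    exact hzF h.mem_V

theorem IsContractible.contract_isDirectedGraph (h : IsContractible Γ F x) :
    (Γ.contract F x).IsDirectedGraph where
  star_eq_nil z hz := by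
    rw [RawGraph.mem_contract_V] at hz
    push Not at hz
    by_cases hzF : z ∈ F.V
    · simp [RawGraph.contract, hz.1, hzF]
    · rw [RawGraph.contract_star_of_notMem _ _ hz.1 hzF]
      exact Γ.isDirectedGraph.star_eq_nil z fun h => hzF (hz.2 h)
  star_nodup z := by
    unfold RawGraph.contract
    dsimp only
    split_ifs
    · exact h.directed.legs_nodup
    · exact List.nodup_nil
    · exact Γ.isDirectedGraph.star_nodup z
  star_disjoint z w f hz hw := by
    rcases RawGraph.mem_contract_star hz with ⟨rfl, hf⟩ | ⟨hz, hzF, hf⟩ <;>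
    rcases RawGraph.mem_contract_star hw with ⟨rfl, hf'⟩ | ⟨hw, hwF, hf'⟩
    · rfl
    · exact absurd ((h.isFlag_iff hf').1 (h.isFlag_of_mem_legs hf)) hwF
    · exact absurd ((h.isFlag_iff hf).1 (h.isFlag_of_mem_legs hf')) hzF
    · exact Γ.isDirectedGraph.star_disjoint _ _ _ hf hf'
  link_isFlag f f' hl := h.contract_isFlag_iff.2
    ⟨Γ.isDirectedGraph.link_isFlag _ _ hl.1, fun _ hF => hl.2 (h.link_of_link hl.1 hF)⟩
  link_symm f f' hl := ⟨Γ.isDirectedGraph.link_symm _ _ hl.1,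
    fun hF => hl.2 (h.directed.link_symm _ _ hF)⟩
  link_irrefl f hl := Γ.isDirectedGraph.link_irrefl f hl.1
  link_unique f a b ha hb := Γ.isDirectedGraph.link_unique f a b ha.1 hb.1
  legs_nodup := Γ.isDirectedGraph.legs_nodup
  mem_legs f := by
    rw [h.contract_isFlag_iff, show (Γ.contract F x).legs = Γ.legs from rfl,
      Γ.isDirectedGraph.mem_legs]
    constructor
    · exact fun ⟨hf, hl⟩ => ⟨⟨hf, fun f' hF => hl f' (h.link_le _ _ hF)⟩, fun f' hl' => hl f' hl'.1⟩
    · exact fun ⟨⟨hf, hF⟩, hl⟩ => ⟨hf, fun f' hl' => hl f' ⟨hl', hF f'⟩⟩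

/-- The image of a path in `Γ` is a path: edges of `F` collapse to the point `x`, all other edges
survive. -/
theorem IsContractible.contract_isConnected (h : IsContractible Γ F x) :
    (Γ.contract F x).IsConnected := by
  refine ⟨⟨x, RawGraph.mem_contract_V.2 (Or.inl rfl)⟩, fun z hz w hw => ?_⟩
  obtain ⟨hz, hz'⟩ := h.contract_V_subset hz
  obtain ⟨hw, hw'⟩ := h.contract_V_subset hw
  rw [← hz', ← hw']
  refine Relation.ReflTransGen.lift' (contractMap F x) ?_ _ _ (Γ.isConnected.2 z hz w hw)
  rintro a b ⟨f, f', hf, hf', hl⟩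
  by_cases hF : F.link f f'
  · have ha := (h.isFlag_iff hf).1 (h.directed.link_isFlag _ _ hF)
    have hb := (h.isFlag_iff hf').1 (h.directed.link_isFlag _ _ (h.directed.link_symm _ _ hF))
    dsimp only [Function.onFun, contractMap]
    rw [if_pos ha, if_pos hb]
  · refine Relation.ReflTransGen.single ⟨f, f', h.contract_adj ?_ hf, h.contract_adj ?_ hf', hl, hF⟩
    · exact h.contract_isDirectedGraph.link_isFlag _ _ ⟨hl, hF⟩
    · exact h.contract_isDirectedGraph.link_isFlag _ f
        (h.contract_isDirectedGraph.link_symm _ _ ⟨hl, hF⟩)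

/-- The contraction of `F` as an object. -/
def IsContractible.target (h : IsContractible Γ F x) : Grc α β :=
  ⟨Γ.contract F x, h.contract_isDirectedGraph, h.contract_isConnected⟩

/-- The vertex to which `F` is contracted. -/
def IsContractible.point (h : IsContractible Γ F x) : h.target.Vert :=
  ⟨x, RawGraph.mem_contract_V.2 (Or.inl rfl)⟩

/-- The contraction of `F` on vertices. -/
def IsContractible.mapφ (h : IsContractible Γ F x) (z : Γ.Vert) : h.target.Vert :=
  ⟨contractMap F x z, contractMap_mem F x z.2⟩

/-- The contraction of `F` on half-edges. -/
def IsContractible.mapψ (h : IsContractible Γ F x) (f : h.target.Flag) : Γ.Flag :=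
  ⟨f, (h.contract_isFlag_iff.1 f.2).1⟩

theorem IsContractible.mapφ_eq_point (h : IsContractible Γ F x) (z : Γ.Vert) :
    h.mapφ z = h.point ↔ (z : α) ∈ F.V := by
  rw [Subtype.ext_iff]
  change (if (z : α) ∈ F.V then x else (z : α)) = x ↔ _
  split_ifs with hz
  · simp [hz]
  · simp only [hz, iff_false]
    rintro rfl
    exact hz h.mem_V

theorem IsContractible.not_mem_range (h : IsContractible Γ F x) {f f' : β} :
    F.link f f' ↔ Γ.link f f' ∧ (∃ z : Γ.Vert, h.mapφ z = h.point ∧ f ∈ Γ.star z) ∧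
      ¬ ∃ a : h.target.Flag, (h.mapψ a : β) = f := by
  have hk : (∃ a : h.target.Flag, (h.mapψ a : β) = f) ↔ (Γ.contract F x).IsFlag f :=
    ⟨fun ⟨a, ha⟩ => ha ▸ a.2, fun hf => ⟨⟨f, hf⟩, rfl⟩⟩
  rw [hk, h.contract_isFlag_iff]
  constructor
  · intro hl
    have hl' := h.link_le _ _ hl
    obtain ⟨z, hz⟩ := flag_exists_vert (Γ.isDirectedGraph.link_isFlag _ _ hl')
    refine ⟨hl', ⟨z, (h.mapφ_eq_point z).2 ?_, hz⟩, fun hn => hn.2 _ hl⟩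
    exact (h.isFlag_iff hz).1 (h.directed.link_isFlag _ _ hl)
  · rintro ⟨hl, -, hn⟩
    have : ∃ f'', F.link f f'' := by
      by_contra! hc
      exact hn ⟨Γ.isDirectedGraph.link_isFlag _ _ hl, hc⟩
    obtain ⟨f'', hF⟩ := this
    exact h.link_of_link hl hF

/-- Proved for the bare maps, before the contraction is known to be a map of graphs, because
connectedness of this fibre is one of the axioms to be checked. -/
theorem IsContractible.fiberGraph_eq (h : IsContractible Γ F x) :
    fiberGraph h.mapφ h.mapψ h.point = F := by
  have hV : (fiberGraph h.mapφ h.mapψ h.point).V = F.V := by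
    ext z
    rw [fiberGraph_mem_V]
    simp only [h.mapφ_eq_point]
    exact ⟨fun ⟨_, hz⟩ => hz, fun hz => ⟨h.V_subset hz, hz⟩⟩
  have hstar : (fiberGraph h.mapφ h.mapψ h.point).star = F.star := by
    funext z
    by_cases hz : z ∈ F.V
    · rw [h.star_eq z hz]
      exact if_pos ⟨h.V_subset hz, (h.mapφ_eq_point ⟨z, _⟩).2 hz⟩
    · rw [h.directed.star_eq_nil z hz]
      exact if_neg fun ⟨hz', hzF⟩ => hz ((h.mapφ_eq_point ⟨z, hz'⟩).1 hzF)
  have hlink : (fiberGraph h.mapφ h.mapψ h.point).link = F.link := by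
    funext f f'
    exact propext h.not_mem_range.symm
  have hlegs : (fiberGraph h.mapφ h.mapψ h.point).legs = F.legs := by
    change (((Γ.contract F x).star x).map (flagMap h.mapψ)) = F.legs
    rw [RawGraph.contract_star_self]
    conv_rhs => rw [← List.map_id F.legs]
    refine List.map_congr_left fun f hf => ?_
    rw [flagMap_eq]
    · rfl
    · exact isFlag_of_mem (x := x) (by
        change f ∈ (Γ.contract F x).star x
        rwa [RawGraph.contract_star_self])
  exact RawGraph.ext_of_eq hV hstar hlink hlegs

/-- The canonical contraction of the subgraph `F`. -/
def IsContractible.map (h : IsContractible Γ F x) : Γ ⟶ h.target where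
  φ := h.mapφ
  ψ := h.mapψ
  φ_surjective z := ⟨⟨z, (h.contract_V_subset z.2).1⟩, Subtype.ext (h.contract_V_subset z.2).2⟩
  ψ_injective f f' hf := Subtype.ext (congrArg (fun a : Γ.Flag => (a : β)) hf)
  adj f z hf := h.contract_adj f.2 hf
  link_iff f f' := by
    have hn := (h.contract_isFlag_iff.1 f.2).2
    constructor
    · intro hl
      have hl' : (Γ.contract F x).link f f' := ⟨hl, hn _⟩
      exact ⟨⟨f', h.contract_isDirectedGraph.link_isFlag _ f
        (h.contract_isDirectedGraph.link_symm _ _ hl')⟩, rfl, hl'⟩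
    · rintro ⟨f', rfl, hl⟩
      exact hl.1
  contracted f f' z w hn hl hz hw := by
    have hF : F.link f f' := by
      by_contra hF
      exact hn ⟨⟨f, h.contract_isDirectedGraph.link_isFlag _ _ ⟨hl, hF⟩⟩, rfl⟩
    rw [(h.mapφ_eq_point z).2 ((h.isFlag_iff hz).1 (h.directed.link_isFlag _ _ hF)),
      (h.mapφ_eq_point w).2
        ((h.isFlag_iff hw).1 (h.directed.link_isFlag _ _ (h.directed.link_symm _ _ hF)))]
  legs_map := by
    change Γ.legs.map _ = Γ.legs
    conv_rhs => rw [← List.map_id Γ.legs]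
    refine List.map_congr_left fun f hf => ?_
    rw [flagMap_eq]
    · rfl
    · exact isFlag_of_mem_legs h.target hf
  fiber_connected i := by
    by_cases hi : i = h.point
    · rw [hi, h.fiberGraph_eq]
      exact h.connected
    · have key : ∀ z, z ∈ (fiberGraph h.mapφ h.mapψ i).V → z = i := by
        intro z hz
        obtain ⟨hz, rfl⟩ := (fiberGraph_mem_V _ _ _ _).1 hz
        rw [h.mapφ_eq_point] at hi
        exact (if_neg hi).symm
      refine ⟨⟨i, (fiberGraph_mem_V _ _ _ _).2 ⟨(h.contract_V_subset i.2).1,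
        Subtype.ext (h.contract_V_subset i.2).2⟩⟩, fun z hz w hw => ?_⟩
      rw [key z hz, key w hw]

theorem IsContractible.fiber_map (h : IsContractible Γ F x) : h.map.fiber h.point = F :=
  h.fiberGraph_eq

theorem IsContractible.isCanonicalContraction (h : IsContractible Γ F x) :
    IsCanonicalContraction h.map h.point where
  φ_eq z hz := if_neg fun hzF => hz ((h.mapφ_eq_point z).2 hzF)
  isLeast := by
    rw [h.fiber_map]
    exact h.isLeast
  ψ_eq f := rfl
  star_eq z hz hzx := by
    rcases RawGraph.mem_contract_V.1 hz with rfl | ⟨_, hzF⟩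
    · exact absurd rfl hzx
    · exact RawGraph.contract_star_of_notMem _ _ hzx hzF
  star_sublist := by
    rw [h.fiber_map]
    change ((Γ.contract F x).star x).Sublist F.flagList
    rw [RawGraph.contract_star_self]
    exact h.sublist
  hasEdge := by
    rw [h.fiber_map]
    exact h.hasEdge

/-- Insertion undoes contraction: vertices, local orders and edges inside `F` are restored by `F`,
those outside were never changed. -/
theorem IsContractible.insertAt_contract (hc : IsContractible Γ F x) :
    RawGraph.insertAt x F (Γ.contract F x) = Γ.toRawGraph := by
  have hV : (RawGraph.insertAt x F (Γ.contract F x)).V = Γ.V := by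
    ext z
    simp only [RawGraph.insertAt, Finset.mem_union, Finset.mem_erase, RawGraph.mem_contract_V]
    have h1 := @hc.V_subset z
    have h2 := hc.mem_V
    by_cases hz : z = x
    · subst hz
      tauto
    · tauto
  have hstar : (RawGraph.insertAt x F (Γ.contract F x)).star = Γ.star := by
    funext z
    simp only [RawGraph.insertAt]
    split_ifs with hz
    · exact hc.star_eq z hz
    · refine RawGraph.contract_star_of_notMem _ _ ?_ hz
      rintro rfl
      exact hz hc.mem_V
  have hlink : (RawGraph.insertAt x F (Γ.contract F x)).link = Γ.link := by
    funext f f'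
    refine propext ⟨?_, fun hl => ?_⟩
    · rintro (hl | hl)
      exacts [hl.1, hc.link_le _ _ hl]
    · by_cases hF : F.link f f'
      exacts [Or.inr hF, Or.inl ⟨hl, hF⟩]
  have hlegs : (RawGraph.insertAt x F (Γ.contract F x)).legs = Γ.legs := rfl
  exact RawGraph.ext_of_eq hV hstar hlink hlegs

end Contract

/-! ### A canonical contraction is determined by its nontrivial fibre. -/

section Canonical

variable {Γ Γ₁ : Grc α β} {π : Γ ⟶ Γ₁} {x : Γ₁.Vert}

theorem IsCanonicalContraction.isFlag (h : IsCanonicalContraction π x) {f : β}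
    (hf : Γ₁.IsFlag f) : Γ.IsFlag f := by
  have h1 := (π.ψ ⟨f, hf⟩).2
  rwa [h.ψ_eq] at h1

theorem IsCanonicalContraction.kept_iff (h : IsCanonicalContraction π x) {f : β} :
    Hom.Kept π f ↔ Γ₁.IsFlag f := by
  constructor
  · rintro ⟨a, rfl⟩
    rw [h.ψ_eq]
    exact a.2
  · exact fun hf => ⟨⟨f, hf⟩, h.ψ_eq _⟩

/-- Vertices outside the fibre keep their names, so they are not identified, and they keep their
local orders, so no half-edge is dropped there. -/
theorem IsCanonicalContraction.isSimpleAt (h : IsCanonicalContraction π x) : IsSimpleAt π x where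
  not_kept := not_kept_of_hasEdge h.hasEdge
  eq_or_eq u w huw := by
    by_cases hu : π.φ u = x
    · exact Or.inr hu
    · left
      apply Subtype.ext
      rw [← h.φ_eq u hu, ← h.φ_eq w (huw ▸ hu), huw]
  φ_eq f u hf hn := by
    by_contra hu
    refine hn (h.kept_iff.2 (isFlag_of_mem (x := π.φ u) ?_))
    rw [h.star_eq _ (π.φ u).2 fun hc => hu (Subtype.ext hc), h.φ_eq u hu]
    exact hf

theorem IsCanonicalContraction.fiber_legs (h : IsCanonicalContraction π x) :
    (π.fiber x).legs = Γ₁.star x := by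
  change (Γ₁.star x).map (flagMap π.ψ) = _
  conv_rhs => rw [← List.map_id (Γ₁.star x)]
  refine List.map_congr_left fun f hf => ?_
  rw [flagMap_eq _ (isFlag_of_mem hf), h.ψ_eq]
  rfl

theorem IsCanonicalContraction.isContractible (h : IsCanonicalContraction π x) :
    IsContractible Γ (π.fiber x) x where
  directed := fiber_isDirectedGraph π x
  connected := π.fiber_connected x
  hasEdge := h.hasEdge
  isLeast := h.isLeast
  sublist := by
    rw [h.fiber_legs]
    exact h.star_sublist
  V_subset z hz := ((fiber_mem_V _ _ _).1 hz).1
  star_eq := fiber_star π x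
  link_le f f' hl := hl.1

theorem IsCanonicalContraction.mem_V_iff (h : IsCanonicalContraction π x) (z : α) :
    z ∈ Γ₁.V ↔ z = x ∨ z ∈ Γ.V ∧ z ∉ (π.fiber x).V := by
  constructor
  · intro hz
    by_cases hzx : z = x
    · exact Or.inl hzx
    · right
      obtain ⟨u, hu⟩ := π.φ_surjective ⟨z, hz⟩
      have hux : π.φ u ≠ x := by
        rw [hu]
        exact fun h => hzx (congrArg Subtype.val h)
      have huz : (u : α) = z := by rw [← h.φ_eq u hux, hu]
      rw [← huz]
      exact ⟨u.2, fun hc => hux ((fiber_mem_V' _ _ _).1 hc)⟩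
  · rintro (rfl | ⟨hz, hzF⟩)
    · exact x.2
    · have hux : π.φ ⟨z, hz⟩ ≠ x := fun hc => hzF ((fiber_mem_V' π x ⟨z, hz⟩).2 hc)
      rw [← show ((⟨z, hz⟩ : Γ.Vert) : α) = z from rfl, ← h.φ_eq _ hux]
      exact (π.φ _).2

theorem IsCanonicalContraction.link_iff (h : IsCanonicalContraction π x) (f f' : β) :
    Γ₁.link f f' ↔ Γ.link f f' ∧ ¬ (π.fiber x).link f f' := by
  constructor
  · intro hl
    have hf := Γ₁.isDirectedGraph.link_isFlag _ _ hl
    have h1 := (Hom.link_ψ π ⟨f, hf⟩ ⟨f', isFlag_right hl⟩).2 hl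
    rw [h.ψ_eq, h.ψ_eq] at h1
    exact ⟨h1, fun hF => hF.2.2 (h.kept_iff.2 hf)⟩
  · rintro ⟨hl, hF⟩
    have hf : Hom.Kept π f := by
      by_contra hn
      obtain ⟨f'', hF'⟩ := (not_kept_iff_of_isSimpleAt h.isSimpleAt
        (Γ.isDirectedGraph.link_isFlag _ _ hl)).1 hn
      exact hF (h.isContractible.link_of_link hl hF')
    have hf' := h.kept_iff.1 (Hom.kept_of_link π hl hf)
    have hf := h.kept_iff.1 hf
    rw [← Hom.link_ψ π ⟨f, hf⟩ ⟨f', hf'⟩, h.ψ_eq, h.ψ_eq]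
    exact hl

theorem IsCanonicalContraction.legs_eq (h : IsCanonicalContraction π x) : Γ₁.legs = Γ.legs := by
  rw [← π.legs_map]
  conv_lhs => rw [← List.map_id Γ₁.legs]
  refine List.map_congr_left fun f hf => ?_
  rw [flagMap_eq _ (isFlag_of_mem_legs Γ₁ hf), h.ψ_eq]
  rfl

/-- The axioms of a canonical contraction prescribe every piece of its target in terms of the source
and the fibre, so there is no freedom left. -/
theorem IsCanonicalContraction.toRawGraph_eq (h : IsCanonicalContraction π x) :
    Γ₁.toRawGraph = Γ.contract (π.fiber x) x := by
  have hV : Γ₁.V = (Γ.contract (π.fiber x) x).V := by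
    ext z
    rw [RawGraph.mem_contract_V, h.mem_V_iff]
  have hstar : Γ₁.star = (Γ.contract (π.fiber x) x).star := by
    funext z
    by_cases hzx : z = x
    · rw [hzx, RawGraph.contract_star_self, h.fiber_legs]
    · by_cases hzF : z ∈ (π.fiber x).V
      · rw [Γ₁.isDirectedGraph.star_eq_nil, h.isContractible.contract_isDirectedGraph.star_eq_nil]
        · rw [RawGraph.mem_contract_V]
          tauto
        · rw [h.mem_V_iff]
          tauto
      · rw [RawGraph.contract_star_of_notMem _ _ hzx hzF]
        by_cases hz : z ∈ Γ.V
        · exact h.star_eq z ((h.mem_V_iff z).2 (Or.inr ⟨hz, hzF⟩)) hzx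
        · rw [Γ.isDirectedGraph.star_eq_nil z hz, Γ₁.isDirectedGraph.star_eq_nil]
          rw [h.mem_V_iff]
          tauto
  have hlink : Γ₁.link = (Γ.contract (π.fiber x) x).link := by
    funext f f'
    exact propext (h.link_iff f f')
  have hlegs : Γ₁.legs = (Γ.contract (π.fiber x) x).legs := h.legs_eq
  exact RawGraph.ext_of_eq hV hstar hlink hlegs

theorem IsCanonicalContraction.insertAt_eq (h : IsCanonicalContraction π x) :
    RawGraph.insertAt (x : α) (π.fiber x) Γ₁.toRawGraph = Γ.toRawGraph :=
  (congrArg (RawGraph.insertAt (x : α) (π.fiber x)) h.toRawGraph_eq).trans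
    h.isContractible.insertAt_contract

/-- The vertex is the least vertex of the fibre, and source and fibre determine the target and the
map. The equality is one of dependent triples so that case analysis on it identifies target, map and
vertex simultaneously. -/
theorem IsCanonicalContraction.ext_of_fiber_eq {Γ₂ : Grc α β} {π' : Γ ⟶ Γ₂} {y : Γ₂.Vert}
    (h : IsCanonicalContraction π x) (h' : IsCanonicalContraction π' y)
    (hF : π.fiber x = π'.fiber y) :
    (⟨Γ₁, π, x⟩ : Σ G : Grc α β, (Γ ⟶ G) × G.Vert) = ⟨Γ₂, π', y⟩ := by
  have hxy : (x : α) = y := h.isLeast.unique (hF ▸ h'.isLeast)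
  obtain rfl : Γ₁ = Γ₂ := ext_toRawGraph (by rw [h.toRawGraph_eq, h'.toRawGraph_eq, hF, hxy])
  obtain rfl : x = y := Subtype.ext hxy
  obtain rfl : π = π' := by
    refine hom_ext (fun z => ?_) (fun f => Subtype.ext (by rw [h.ψ_eq, h'.ψ_eq]))
    by_cases hz : π.φ z = x
    · rw [hz, (fiber_mem_V' π' x z).1]
      rw [← hF]
      exact (fiber_mem_V' π x z).2 hz
    · have hz' : π'.φ z ≠ x := fun hc => hz ((fiber_mem_V' π x z).1 (hF ▸ (fiber_mem_V' π' x z).2 hc))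
      exact Subtype.ext (by rw [h.φ_eq z hz, h'.φ_eq z hz'])
  rfl

theorem IsCanonicalContraction.φ_eq_iff (h : IsCanonicalContraction π x) (u w : Γ.Vert) :
    π.φ u = π.φ w ↔ u = w ∨ π.φ u = x ∧ π.φ w = x := by
  constructor
  · intro huw
    exact (h.isSimpleAt.eq_or_eq u w huw).imp_right fun hu => ⟨hu, huw ▸ hu⟩
  · rintro (rfl | ⟨hu, hw⟩)
    exacts [rfl, hu.trans hw.symm]

end Canonical

end LinearOrder

end Grc

/-! ### Canonical representatives of simple maps, and their commutation. -/

namespace Grc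

variable {α : Type u} {β : Type v} [LinearOrder α]

-- The canonical representative contracts the same vertices and edges as `f`, so its target is
-- isomorphic to `D`.
open Classical in
theorem IsSimpleAt.exists_canonical {Γ D : Grc α β} {f : Γ ⟶ D} {i : D.Vert}
    (h : IsSimpleAt f i) : ∃ (Γ₁ : Grc α β) (π : Γ ⟶ Γ₁) (x : Γ₁.Vert) (σ : Γ₁ ≅ D),
      IsCanonicalContraction π x ∧ π ≫ σ.hom = f := by
  obtain ⟨x, hx⟩ : ∃ x, IsLeast ((f.fiber i).V : Set α) x :=
    ⟨_, Finset.isLeast_min' _ (f.fiber_connected i).1⟩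
  have hd := fiber_isDirectedGraph f i
  -- The legs of the fibre carry the order coming from `D`; a canonical contraction requires the
  -- lexicographic one, so the legs are listed anew by filtering `flagList`.
  set F : RawGraph α β := { f.fiber i with
    legs := (f.fiber i).flagList.filter fun a => ∀ a', ¬ (f.fiber i).link a a' } with hF
  have hc : IsContractible Γ F x :=
    { directed :=
        { star_eq_nil := hd.star_eq_nil
          star_nodup := hd.star_nodup
          star_disjoint := hd.star_disjoint
          link_isFlag := hd.link_isFlag
          link_symm := hd.link_symm
          link_irrefl := hd.link_irrefl
          link_unique := hd.link_unique
          legs_nodup := hd.nodup_flagList.filter _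
          mem_legs := fun a => by
            change a ∈ List.filter _ _ ↔ _
            rw [List.mem_filter, RawGraph.mem_flagList, decide_eq_true_iff]
            exact Iff.rfl }
      connected := f.fiber_connected i
      hasEdge := h.hasEdge
      isLeast := hx
      sublist := List.filter_sublist
      V_subset := fun z hz => ((fiber_mem_V _ _ _).1 hz).1
      star_eq := fiber_star f i
      link_le := fun _ _ hl => hl.1 }
  have hcan := hc.isCanonicalContraction
  obtain ⟨σ, hσ⟩ := exists_iso hc.map f (fun u w => by
    rw [hcan.φ_eq_iff]
    have hV : ∀ u, hc.map.φ u = hc.point ↔ f.φ u = i := fun u =>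
      (hc.mapφ_eq_point u).trans (fiber_mem_V' f i u)
    rw [hV, hV]
    constructor
    · rintro (rfl | ⟨hu, hw⟩)
      exacts [rfl, hu.trans hw.symm]
    · exact fun huw => (h.eq_or_eq u w huw).imp_right fun hu => ⟨hu, huw ▸ hu⟩) fun a => by
    rw [hcan.kept_iff]
    refine Iff.trans ?_ hc.contract_isFlag_iff.symm
    constructor
    · exact fun hk => ⟨isFlag_of_kept hk, fun a' hl => hl.2.2 hk⟩
    · rintro ⟨ha, hn⟩
      by_contra hk
      obtain ⟨a', hl⟩ := (not_kept_iff_of_isSimpleAt h ha).1 hk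
      exact hn a' hl
  exact ⟨hc.target, hc.map, hc.point, σ, hcan, hσ⟩

/-- The vertices, local orders and edges of the fibre depend only on what is contracted, which an
isomorphism of the target does not change. The legs are then the unmatched half-edges in
lexicographic order, so the fibres agree and with them the contractions. -/
theorem IsCanonicalContraction.eq_of_comp_iso {Γ Γ₁ Γ₂ D : Grc α β} {π : Γ ⟶ Γ₁} {x : Γ₁.Vert}
    {π' : Γ ⟶ Γ₂} {y : Γ₂.Vert} (h : IsCanonicalContraction π x)
    (h' : IsCanonicalContraction π' y) (σ : Γ₁ ≅ D) (σ' : Γ₂ ≅ D)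
    (hσ : π ≫ σ.hom = π' ≫ σ'.hom) :
    (⟨Γ₁, π, x⟩ : Σ G : Grc α β, (Γ ⟶ G) × G.Vert) = ⟨Γ₂, π', y⟩ := by
  have hxy : σ.hom.φ x = σ'.hom.φ y :=
    (h.isSimpleAt.comp_iso σ).unique (hσ ▸ h'.isSimpleAt.comp_iso σ')
  have hk : ∀ a, Hom.Kept π a ↔ Hom.Kept π' a := fun a => by
    rw [← kept_comp_iso π σ, hσ, kept_comp_iso]
  have hφ : ∀ u, π.φ u = x ↔ π'.φ u = y := fun u => by
    rw [← (iso_φ_injective σ).eq_iff, ← comp_φ, hσ, comp_φ, hxy, (iso_φ_injective σ').eq_iff]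
  have hV : (π.fiber x).V = (π'.fiber y).V := by
    ext z
    simp only [fiber_mem_V, hφ]
  have hstar : (π.fiber x).star = (π'.fiber y).star := by
    funext z
    by_cases hz : z ∈ (π.fiber x).V
    · rw [fiber_star _ _ _ hz, fiber_star _ _ _ (hV ▸ hz)]
    · rw [fiber_star_eq_nil _ _ _ hz, fiber_star_eq_nil _ _ _ (hV ▸ hz)]
  have hlink : (π.fiber x).link = (π'.fiber y).link := by
    funext a b
    refine propext ?_
    rw [fiber_link, fiber_link]
    simp only [hφ, hk]
  have hlist : (π.fiber x).flagList = (π'.fiber y).flagList := by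
    unfold RawGraph.flagList
    rw [hV, hstar]
  have hc := h.isContractible
  have hc' := h'.isContractible
  refine h.ext_of_fiber_eq h' (RawGraph.ext_of_eq hV hstar hlink ?_)
  refine List.Sublist.eq_of_mem_iff hc.directed.nodup_flagList hc.sublist
    (hlist ▸ hc'.sublist) fun a => ?_
  rw [hc.directed.mem_legs, hc'.directed.mem_legs]
  unfold RawGraph.IsFlag
  rw [hV, hstar, hlink]

/-- Canonical contractions of disjoint subgraphs commute. -/
theorem IsCanonicalContraction.exists_swap {Γ P S : Grc α β} {π₁ : Γ ⟶ P} {a : P.Vert}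
    {π₂ : P ⟶ S} {j : S.Vert} (h₁ : IsCanonicalContraction π₁ a)
    (h₂ : IsCanonicalContraction π₂ j) (hne : π₂.φ a ≠ j) :
    ∃ (Q : Grc α β) (κ₁ : Γ ⟶ Q) (κ₂ : Q ⟶ S) (b : Q.Vert),
      IsCanonicalContraction κ₁ b ∧ IsCanonicalContraction κ₂ (π₂.φ a) ∧ κ₂.φ b = j ∧
      π₁ ≫ π₂ = κ₁ ≫ κ₂ ∧ κ₁.fiber b = π₂.fiber j ∧ κ₂.fiber (π₂.φ a) = π₁.fiber a := by
  set F := π₂.fiber j with hF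
  have hFP := h₂.isContractible
  have hia : (π₂.φ a : α) = a := h₂.φ_eq a hne
  have hFa : ∀ z ∈ F.V, z ≠ a := by
    rintro z hz rfl
    exact hne ((fiber_mem_V' _ _ _).1 hz)
  -- The second fibre avoids the vertex created by the first contraction, so it is already a
  -- subgraph of `Γ`, disjoint from the first fibre, and can be contracted first.
  have hFΓ : ∀ z ∈ F.V, z ∈ Γ.V ∧ z ∉ (π₁.fiber a).V := fun z hz =>
    ((h₁.mem_V_iff z).1 (hFP.V_subset hz)).resolve_left (hFa z hz)
  have hc : IsContractible Γ F j :=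
    { hFP.toIsDecoration with
      V_subset := fun z hz => (hFΓ z hz).1
      star_eq := fun z hz => by
        rw [hFP.star_eq z hz, h₁.star_eq z (hFP.V_subset hz) (hFa z hz)]
      link_le := fun f f' hl => ((h₁.link_iff f f').1 (hFP.link_le _ _ hl)).1 }
  have hA : ∀ u : Γ.Vert, π₂.φ (π₁.φ u) = j ↔ (u : α) ∈ F.V := by
    intro u
    constructor
    · intro hu
      have hua : π₁.φ u ≠ a := by
        rintro hua
        exact hne (hua ▸ hu)
      rw [← h₁.φ_eq u hua]
      exact (fiber_mem_V' _ _ _).2 hu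
    · intro hu
      have hua : π₁.φ u ≠ a := fun hua => (hFΓ u hu).2 ((fiber_mem_V' _ _ _).2 hua)
      rw [← h₁.φ_eq u hua] at hu
      exact (fiber_mem_V' _ _ _).1 hu
  have hcan := hc.isCanonicalContraction
  -- The other contraction is the factorization of the composite through the contraction of `F`; it
  -- remains to see that it is canonical and has the same fibre as `π₁`.
  obtain ⟨κ₂, hκ⟩ := exists_factor hc.map (π₁ ≫ π₂) (fun u w huw => by
      rcases (hcan.φ_eq_iff u w).1 huw with rfl | ⟨hu, hw⟩
      · rfl
      · rw [comp_φ, comp_φ, (hA u).2 ((hc.mapφ_eq_point u).1 hu),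
          (hA w).2 ((hc.mapφ_eq_point w).1 hw)]) fun f hf => by
      rw [hcan.kept_iff]
      refine hc.contract_isFlag_iff.2 ⟨isFlag_of_kept hf, fun f' hl => ?_⟩
      obtain ⟨c, rfl, hk⟩ := (kept_comp _ _ _).1 hf
      rw [h₁.ψ_eq] at hl
      exact hl.2.2 hk
  have hκφ : ∀ u, κ₂.φ (hc.map.φ u) = π₂.φ (π₁.φ u) := fun u => by
    rw [← comp_φ, hκ, comp_φ]
  have hψ : ∀ c, (κ₂.ψ c : β) = c := fun c => by
    rw [← hcan.ψ_eq, ← comp_ψ, hκ, comp_ψ, h₁.ψ_eq, h₂.ψ_eq]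
  have hkept : ∀ f, Hom.Kept κ₂ f ↔ S.IsFlag f := fun f =>
    ⟨fun ⟨c, hc⟩ => by rw [← hc, hψ]; exact c.2, fun hf => ⟨⟨f, hf⟩, hψ _⟩⟩
  have hfix : ∀ z : hc.target.Vert, ∃ u : Γ.Vert, (u : α) = z ∧ hc.map.φ u = z := fun z =>
    ⟨⟨z, (hc.contract_V_subset z.2).1⟩, rfl, Subtype.ext (hc.contract_V_subset z.2).2⟩
  have hpt : κ₂.φ hc.point = j := by
    obtain ⟨u, hu, hu'⟩ := hfix hc.point
    rw [← hu', hκφ, hA, hu]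
    exact hc.mem_V
  have hji : (j : α) ≠ π₂.φ a := fun h => hne (Subtype.ext h.symm)
  have hSa : S.star (π₂.φ a) = P.star a := by
    rw [h₂.star_eq _ (π₂.φ a).2 hji.symm, hia]
  have hmem : ∀ u : Γ.Vert, π₁.φ u = a → (u : α) ∉ F.V := fun u hu hFu =>
    (hFΓ u hFu).2 ((fiber_mem_V' _ _ _).2 hu)
  have hmapφ : ∀ u : Γ.Vert, (u : α) ∉ F.V → (hc.map.φ u : α) = u := fun u hu => if_neg hu
  have htarget : ∀ z, z ≠ (j : α) → z ∉ F.V → hc.target.star z = Γ.star z := fun z h h' =>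
    RawGraph.contract_star_of_notMem _ _ h h'
  have hfV : ∀ z, z ∈ (κ₂.fiber (π₂.φ a)).V ↔ z ∈ (π₁.fiber a).V := by
    intro z
    rw [fiber_mem_V, fiber_mem_V]
    constructor
    · rintro ⟨hz, hzi⟩
      obtain ⟨u, hu, hu'⟩ := hfix ⟨z, hz⟩
      refine ⟨(hc.contract_V_subset hz).1, ?_⟩
      rw [← hu', hκφ] at hzi
      rw [show (⟨z, _⟩ : Γ.Vert) = u from Subtype.ext hu.symm]
      rcases h₂.isSimpleAt.eq_or_eq _ _ hzi with h | h
      · exact h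
      · exact absurd (hzi.symm.trans h) hne
    · rintro ⟨hz, hza⟩
      have h1 := hmapφ ⟨z, hz⟩ (hmem _ hza)
      have h2 := hκφ ⟨z, hz⟩
      rw [hza] at h2
      have h3 : z ∈ hc.target.V := by
        have := (hc.map.φ ⟨z, hz⟩).2
        rwa [h1] at this
      exact ⟨h3, by rw [← h2]; exact congrArg κ₂.φ (Subtype.ext h1.symm)⟩
  have hfib : κ₂.fiber (π₂.φ a) = π₁.fiber a := by
    have hzF : ∀ z, z ∈ (π₁.fiber a).V → z ∉ F.V := fun z hz hz' => (hFΓ z hz').2 hz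
    have hzj : ∀ z, z ∈ (π₁.fiber a).V → z ≠ j := fun z hz h => hzF z hz (h ▸ hc.mem_V)
    refine RawGraph.ext_of_eq (Finset.ext hfV) (funext fun z => ?_)
      (funext fun f => funext fun f' => propext ?_) ?_
    · by_cases hz : z ∈ (π₁.fiber a).V
      · rw [fiber_star _ _ _ hz, fiber_star _ _ _ ((hfV z).2 hz), htarget z (hzj z hz) (hzF z hz)]
      · rw [fiber_star_eq_nil _ _ _ hz, fiber_star_eq_nil _ _ _ fun h => hz ((hfV z).1 h)]
    · rw [fiber_link, fiber_link, hkept, h₁.kept_iff]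
      -- At the vertices of the first fibre the second contraction drops nothing: a half-edge it
      -- drops would be adjacent to a vertex over `j`, but these are adjacent to `a`.
      have hflag : ∀ u : Γ.Vert, π₁.φ u = a → f ∈ Γ.star u → (S.IsFlag f ↔ P.IsFlag f) := by
        intro u hu hf
        refine ⟨h₂.isFlag, fun hP => ?_⟩
        by_contra hn
        rw [← h₂.kept_iff] at hn
        refine hne (h₂.isSimpleAt.φ_eq f a ?_ hn)
        have := π₁.adj ⟨f, hP⟩ u (by rwa [h₁.ψ_eq])
        rwa [hu] at this
      constructor
      · rintro ⟨hl, ⟨z, hz, hfz⟩, hn⟩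
        have hzV := (hfV z).1 ((fiber_mem_V' _ _ _).2 hz)
        rw [htarget z (hzj z hzV) (hzF z hzV)] at hfz
        obtain ⟨hzΓ, hza⟩ := (fiber_mem_V _ _ _).1 hzV
        exact ⟨hl.1, ⟨⟨z, hzΓ⟩, hza, hfz⟩, by rwa [← hflag _ hza hfz]⟩
      · rintro ⟨hl, ⟨z, hz, hfz⟩, hn⟩
        have hzV := (fiber_mem_V' _ _ _).2 hz
        refine ⟨⟨hl, fun hFl => hzF z hzV ((hc.isFlag_iff hfz).1
          (hc.directed.link_isFlag _ _ hFl))⟩, ?_, by rwa [hflag z hz hfz]⟩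
        obtain ⟨hzQ, hzi⟩ := (fiber_mem_V _ _ _).1 ((hfV z).2 hzV)
        refine ⟨⟨z, hzQ⟩, hzi, ?_⟩
        rwa [htarget z (hzj z hzV) (hzF z hzV)]
    · rw [h₁.fiber_legs, ← hSa]
      change (S.star _).map (flagMap κ₂.ψ) = _
      conv_rhs => rw [← List.map_id (S.star _)]
      refine List.map_congr_left fun f hf => ?_
      rw [flagMap_eq _ (isFlag_of_mem hf), hψ]
      rfl
  refine ⟨hc.target, hc.map, κ₂, hc.point, hcan, ?_, hpt, hκ.symm, hc.fiber_map, hfib⟩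
  exact
    { φ_eq := fun z hz => by
        by_cases hzF : (z : α) ∈ F.V
        · obtain ⟨u, hu, hu'⟩ := hfix z
          have hzp : hc.map.φ u = hc.point := (hc.mapφ_eq_point u).2 (hu ▸ hzF)
          rw [← hu', hzp, hpt]
          rfl
        · obtain ⟨u, hu, hu'⟩ := hfix z
          rw [← hu] at hzF ⊢
          have hj : π₂.φ (π₁.φ u) ≠ j := fun h => hzF ((hA u).1 h)
          rw [← hu', hκφ] at hz ⊢
          rw [h₂.φ_eq _ hj, h₁.φ_eq _ fun h => hz (by rw [h])]
      isLeast := by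
        rw [hfib, hia]
        exact h₁.isLeast
      ψ_eq := hψ
      star_eq := fun w hw hwi => by
        by_cases hwj : w = j
        · rw [hwj, ← h₂.fiber_legs]
          exact (RawGraph.contract_star_self _ _ _).symm
        · obtain ⟨hwP, hwF⟩ := ((h₂.mem_V_iff w).1 hw).resolve_left hwj
          rw [h₂.star_eq w hw hwj, h₁.star_eq w hwP (hia ▸ hwi), htarget w hwj hwF]
      star_sublist := by
        rw [hfib, hSa]
        exact h₁.star_sublist
      hasEdge := by
        rw [hfib]
        exact h₁.hasEdge }

end Grc

theorem List.flatMap_eq_of_forall_ne {γ δ : Type*} {l : List γ} (hl : l.Nodup) {f : γ → List δ}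
    {a : γ} (ha : a ∈ l) (h : ∀ b ∈ l, b ≠ a → f b = []) : l.flatMap f = f a := by
  induction l with
  | nil => simp at ha
  | cons c l ih =>
    rw [List.nodup_cons] at hl
    rw [List.flatMap_cons]
    by_cases hc : c = a
    · subst hc
      rw [List.flatMap_eq_nil_iff.2, List.append_nil]
      exact fun b hb => h b (List.mem_cons_of_mem _ hb) fun hbc => hl.1 (hbc ▸ hb)
    · rw [h c List.mem_cons_self hc, List.nil_append]
      exact ih hl.2 ((List.mem_cons.1 ha).resolve_left fun h => hc h.symm)
        fun b hb => h b (List.mem_cons_of_mem _ hb)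

theorem RawGraph.IsDirectedGraph.insertion_corolla {α : Type u} {β : Type v} [LinearOrder α]
    {G : RawGraph α β} (h : G.IsDirectedGraph) :
    (G.insertion fun x => RawGraph.corolla x (G.star x)) = G := by
  refine RawGraph.ext_of_eq ?_ (funext fun z => ?_) (funext fun f => funext fun f' => ?_) rfl
  · ext z
    simp [insertion, corolla]
  · by_cases hz : z ∈ G.V
    · refine (List.flatMap_eq_of_forall_ne (Finset.sort_nodup _ _) ((Finset.mem_sort _).2 hz)
        fun b _ hb => if_neg hb.symm).trans (if_pos rfl)
    · rw [h.star_eq_nil z hz]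
      refine List.flatMap_eq_nil_iff.2 fun b hb => if_neg ?_
      rintro rfl
      exact hz ((Finset.mem_sort _).1 hb)
  · simp [insertion, corolla]

/-! ### Grafting corollas onto graph-trees, and pruning them. -/

namespace GTree

variable {α : Type u} {β : Type v} [LinearOrder α]

/-- No tree is grafted onto labels which are not vertices of the decoration. -/
def IsNormal : GTree α β → Prop
  | leaf => True
  | node G sub => (∀ x, x ∉ G.V → sub x = leaf) ∧ ∀ x ∈ G.V, (sub x).IsNormal

theorem IsGood.isNormal {T : GTree α β} (h : T.IsGood) : T.IsNormal := by
  induction T with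
  | leaf => trivial
  | node G sub ih =>
    obtain ⟨-, -, -, hsub, -, -, -, hgood⟩ := h
    exact ⟨hsub, fun x hx => ih x (hgood x hx)⟩

theorem isGood_node {G : RawGraph α β} {sub : α → GTree α β} : (node G sub).IsGood ↔
    G.IsDirectedGraph ∧ G.IsConnected ∧ G.HasEdge ∧ (∀ x, x ∉ G.V → sub x = leaf) ∧
      (∀ x ∈ G.V, ∀ y ∈ G.V, x ≠ y → Disjoint ((sub x).leafLabels x) ((sub y).leafLabels y)) ∧
      (∀ x ∈ G.V, IsLeast ((sub x).leafLabels x : Set α) x) ∧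
      (∀ x ∈ G.V, (sub x).Compatible (G.star x)) ∧ ∀ x ∈ G.V, (sub x).IsGood := Iff.rfl

theorem mem_leafLabels_node {G : RawGraph α β} {sub : α → GTree α β} {y w : α} :
    w ∈ (node G sub).leafLabels y ↔ ∃ z ∈ G.V, w ∈ (sub z).leafLabels z := by
  simp [leafLabels]

theorem mem_leafLabels_leaf {y w : α} : w ∈ (leaf : GTree α β).leafLabels y ↔ w = y := by
  simp [leafLabels]

/-- The branches of a tree after grafting. -/
def graftSub (x : α) (F G : RawGraph α β) (sub : α → GTree α β) (z : α) : GTree α β :=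
  if z ∈ G.V then graft x F (sub z) z else leaf

theorem graftSub_of_mem {x : α} {F G : RawGraph α β} {sub : α → GTree α β} {z : α}
    (hz : z ∈ G.V) : graftSub x F G sub z = graft x F (sub z) z := if_pos hz

theorem graftSub_of_notMem {x : α} {F G : RawGraph α β} {sub : α → GTree α β} {z : α}
    (hz : z ∉ G.V) : graftSub x F G sub z = leaf := if_neg hz

theorem graft_node (x : α) (F G : RawGraph α β) (sub : α → GTree α β) (y : α) :
    graft x F (node G sub) y = node G (graftSub x F G sub) := rfl

theorem graft_leaf (x : α) (F : RawGraph α β) : graft x F leaf x = corolla F := if_pos rfl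

theorem mem_leafLabels_graft {x : α} {F : RawGraph α β} {T : GTree α β} {y w : α} :
    w ∈ (graft x F T y).leafLabels y ↔
      (w ∈ T.leafLabels y ∧ w ≠ x) ∨ (x ∈ T.leafLabels y ∧ w ∈ F.V) := by
  induction T generalizing y with
  | leaf =>
    rw [mem_leafLabels_leaf, mem_leafLabels_leaf]
    by_cases hy : y = x
    · subst hy
      rw [graft_leaf, corolla, mem_leafLabels_node]
      simp only [mem_leafLabels_leaf]
      constructor
      · rintro ⟨z, hz, rfl⟩
        exact Or.inr ⟨trivial, hz⟩
      · rintro (⟨h, h'⟩ | ⟨-, h⟩)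
        exacts [absurd h h', ⟨w, h, rfl⟩]
    · rw [graft, if_neg hy, mem_leafLabels_leaf]
      constructor
      · rintro rfl
        exact Or.inl ⟨rfl, hy⟩
      · rintro (⟨h, -⟩ | ⟨h, -⟩)
        exacts [h, absurd h.symm hy]
  | node G sub ih =>
    rw [graft_node, mem_leafLabels_node, mem_leafLabels_node, mem_leafLabels_node]
    constructor
    · rintro ⟨z, hz, hw⟩
      rw [graftSub_of_mem hz, ih] at hw
      rcases hw with ⟨h, h'⟩ | ⟨h, h'⟩
      exacts [Or.inl ⟨⟨z, hz, h⟩, h'⟩, Or.inr ⟨⟨z, hz, h⟩, h'⟩]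
    · rintro (⟨⟨z, hz, h⟩, h'⟩ | ⟨⟨z, hz, h⟩, h'⟩)
      · exact ⟨z, hz, by rw [graftSub_of_mem hz, ih]; exact Or.inl ⟨h, h'⟩⟩
      · exact ⟨z, hz, by rw [graftSub_of_mem hz, ih]; exact Or.inr ⟨h, h'⟩⟩

theorem leafLabels_subset_graft {x : α} {F : RawGraph α β} {T : GTree α β} {y w : α}
    (hx : x ∈ F.V) (hw : w ∈ T.leafLabels y) : w ∈ (graft x F T y).leafLabels y := by
  rw [mem_leafLabels_graft]
  by_cases h : w = x
  · subst h
    exact Or.inr ⟨hw, hx⟩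
  · exact Or.inl ⟨hw, h⟩

/-- Normality is needed because `graft` resets to `leaf` all branches at labels which are not
vertices of the decoration. -/
theorem graft_of_notMem {x : α} {F : RawGraph α β} {T : GTree α β} {y : α} (hT : T.IsNormal)
    (hx : x ∉ T.leafLabels y) : graft x F T y = T := by
  induction T generalizing y with
  | leaf =>
    rw [mem_leafLabels_leaf] at hx
    exact if_neg fun h => hx h.symm
  | node G sub ih =>
    rw [mem_leafLabels_node] at hx
    push Not at hx
    rw [graft_node]
    congr 1
    funext z
    unfold graftSub
    split_ifs with hz
    · exact ih z (hT.2 z hz) (hx z hz)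
    · exact (hT.1 z hz).symm

theorem graft_ne_leaf {x : α} {F : RawGraph α β} {T : GTree α β} {y : α}
    (hx : x ∈ T.leafLabels y) : graft x F T y ≠ leaf := by
  cases T with
  | leaf =>
    rw [mem_leafLabels_leaf] at hx
    subst hx
    rw [graft_leaf]
    exact nofun
  | node G sub => exact nofun

theorem graft_ne_corolla {x : α} {F G : RawGraph α β} {T : GTree α β} {y : α} (hT : T ≠ leaf)
    (hx : x ∈ T.leafLabels y) : graft x F T y ≠ corolla G := by
  cases T with
  | leaf => exact absurd rfl hT
  | node H sub =>
    intro h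
    rw [graft_node, corolla] at h
    injection h with _ h2
    obtain ⟨z, hz, hxz⟩ := mem_leafLabels_node.1 hx
    have h3 := congrFun h2 z
    rw [graftSub_of_mem hz] at h3
    exact graft_ne_leaf hxz h3

/-- The label of the output edge is consulted only at a bare leaf; for other trees it is a dummy
argument. -/
theorem graft_congr (x : α) (F : RawGraph α β) {T : GTree α β} (hT : T ≠ leaf) (y y' : α) :
    graft x F T y = graft x F T y' := by
  cases T with
  | leaf => exact absurd rfl hT
  | node H sub => rfl

/-- Neither grafting creates a leaf onto which the other one could act, so the two modify different
leaves. At a single leaf at most one of them acts. -/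
theorem graft_comm {x x' : α} {F F' : RawGraph α β} {T : GTree α β} {y : α} (hx : x ≠ x')
    (hF : x' ∉ F.V) (hF' : x ∉ F'.V) :
    graft x F (graft x' F' T y) y = graft x' F' (graft x F T y) y := by
  have key : ∀ {x x' : α} {F F' : RawGraph α β}, x ≠ x' → x' ∉ F.V →
      graft x F (graft x' F' leaf x) x = graft x' F' (graft x F leaf x) x := by
    intro x x' F F' hx hF
    rw [graft_leaf, graft, if_neg hx, graft_leaf, corolla, graft_node]
    congr 1
    funext z
    unfold graftSub
    split_ifs with hz
    · rw [graft, if_neg]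
      rintro rfl
      exact hF hz
    · rfl
  induction T generalizing y with
  | leaf =>
    by_cases hy : y = x
    · subst hy
      exact key hx hF
    · by_cases hy' : y = x'
      · subst hy'
        exact (key hx.symm hF').symm
      · simp [graft, hy, hy']
  | node G sub ih =>
    simp only [graft_node]
    congr 1
    funext z
    unfold graftSub
    split_ifs with hz
    · exact ih z
    · rfl

theorem grOn_V {T : GTree α β} {y : α} {s : List β} :
    (T.grOn (RawGraph.corolla y s)).V = T.leafLabels y := by
  induction T generalizing y s with
  | leaf => rfl
  | node G sub ih => exact Finset.biUnion_congr rfl fun z _ => ih z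

theorem mem_grOn_star_node {G : RawGraph α β} {sub : α → GTree α β} {C : RawGraph α β} {w : α}
    {f : β} : f ∈ ((node G sub).grOn C).star w ↔
      ∃ z ∈ G.V, f ∈ ((sub z).grOn (RawGraph.corolla z (G.star z))).star w := by
  simp [grOn, RawGraph.insertion]

theorem grOn_star_eq_nil {T : GTree α β} {y w : α} {s : List β} (hw : w ∉ T.leafLabels y) :
    (T.grOn (RawGraph.corolla y s)).star w = [] := by
  induction T generalizing y s with
  | leaf =>
    rw [mem_leafLabels_leaf] at hw
    exact if_neg hw
  | node G sub ih =>
    rw [mem_leafLabels_node] at hw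
    push Not at hw
    refine List.flatMap_eq_nil_iff.2 fun z hz => ?_
    exact ih z (hw z ((Finset.mem_sort _).1 hz))

/-- The concatenation over branches defining the local order at `w` has one nonempty term, because
only one branch has a leaf labelled by `w`. -/
theorem grOn_star_node {G : RawGraph α β} {sub : α → GTree α β} {C : RawGraph α β} {z w : α}
    (h : ∀ x ∈ G.V, ∀ y ∈ G.V, x ≠ y → Disjoint ((sub x).leafLabels x) ((sub y).leafLabels y))
    (hz : z ∈ G.V) (hw : w ∈ (sub z).leafLabels z) :
    ((node G sub).grOn C).star w =
      ((sub z).grOn (RawGraph.corolla z (G.star z))).star w := by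
  refine List.flatMap_eq_of_forall_ne (f := fun z =>
    ((sub z).grOn (RawGraph.corolla z (G.star z))).star w) (Finset.sort_nodup _ _)
    ((Finset.mem_sort _).2 hz) fun b hb hbz => grOn_star_eq_nil fun hwb => ?_
  exact Finset.disjoint_left.1 (h b ((Finset.mem_sort _).1 hb) z hz hbz) hwb hw

theorem gr_eq_grOn {T : GTree α β} (hT : T ≠ leaf) (C : RawGraph α β) : T.gr = T.grOn C := by
  cases T with
  | leaf => exact absurd rfl hT
  | node G sub => rfl

/-- Grafting the corolla decorated by `F` onto the leaf labelled by `x` of the tree `T` hanging on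
an edge labelled by `y`, whose terminal vertex has the half-edges `s` there, is allowed. -/
structure Graftable (x : α) (F : RawGraph α β) (T : GTree α β) (y : α) (s : List β) : Prop
    extends F.IsDecoration x where
  mem : x ∈ T.leafLabels y
  eq_of_mem : ∀ w ∈ F.V, w ∈ T.leafLabels y → w = x
  legs_eq : F.legs = (T.grOn (RawGraph.corolla y s)).star x

theorem compatible_graft_iff {x : α} {F : RawGraph α β} {T : GTree α β} {y : α} {s : List β}
    (hT : T ≠ leaf) : (graft x F T y).Compatible s ↔ T.Compatible s := by
  cases T with
  | leaf => exact absurd rfl hT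
  | node G sub => exact Iff.rfl

theorem Graftable.compatible {x : α} {F : RawGraph α β} {T : GTree α β} {y : α} {s : List β}
    (h : Graftable x F T y s) (hc : T.Compatible s) : (graft x F T y).Compatible s := by
  cases T with
  | leaf =>
    obtain rfl := mem_leafLabels_leaf.1 h.mem
    rw [graft_leaf]
    exact ⟨h.legs_eq.trans (if_pos rfl), h.sublist⟩
  | node G sub => exact hc

theorem Graftable.isLeast_iff {x : α} {F : RawGraph α β} {T : GTree α β} {y : α} {s : List β}
    (h : Graftable x F T y s) :
    IsLeast ((graft x F T y).leafLabels y : Set α) y ↔ IsLeast (T.leafLabels y : Set α) y := by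
  have hmem : ∀ w, w ∈ (graft x F T y).leafLabels y ↔ w ∈ T.leafLabels y ∨ w ∈ F.V := fun w => by
    rw [mem_leafLabels_graft]
    have h1 := h.mem
    have h2 := h.mem_V
    by_cases hw : w = x
    · subst hw
      tauto
    · tauto
  constructor
  · rintro ⟨h1, h2⟩
    refine ⟨?_, fun w hw => h2 ((hmem w).2 (Or.inl hw))⟩
    rcases (hmem y).1 h1 with h3 | h3
    · exact h3
    -- If `y` is a vertex of `F`, then `x ≤ y` because `x` is least in `F`, and `y ≤ x` because `y`
    -- is least among all labels, so `y` is the label `x`.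
    · have hyx := le_antisymm (h2 ((hmem x).2 (Or.inl h.mem))) (h.isLeast.2 h3)
      have := h.mem
      rwa [← hyx] at this
  · rintro ⟨h1, h2⟩
    refine ⟨(hmem y).2 (Or.inl h1), fun w hw => ?_⟩
    rcases (hmem w).1 hw with h3 | h3
    · exact h2 h3
    · exact (h2 h.mem).trans (h.isLeast.2 h3)

theorem isGood_corolla {G : RawGraph α β} (hd : G.IsDirectedGraph) (hc : G.IsConnected)
    (he : G.HasEdge) : (corolla G).IsGood := by
  refine ⟨hd, hc, he, fun _ _ => rfl, fun x _ y _ hxy => ?_, fun x _ => ?_, fun _ _ => trivial,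
    fun _ _ => trivial⟩
  · simpa [leafLabels] using hxy
  · simp [leafLabels]

theorem gr_corolla {G : RawGraph α β} (hd : G.IsDirectedGraph) : (corolla G).gr = G :=
  hd.insertion_corolla

section Node

variable {G : RawGraph α β} {sub : α → GTree α β} {x : α} {F : RawGraph α β} {y : α} {s : List β}

theorem eq_of_mem_leafLabels {z w a : α} (hT : (node G sub).IsGood) (hz : z ∈ G.V) (hw : w ∈ G.V)
    (haz : a ∈ (sub z).leafLabels z) (haw : a ∈ (sub w).leafLabels w) : z = w := by
  obtain ⟨-, -, -, -, hdis, -⟩ := hT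
  by_contra hne
  exact Finset.disjoint_left.1 (hdis z hz w hw hne) haz haw

theorem Graftable.branch (h : Graftable x F (node G sub) y s) (hT : (node G sub).IsGood) {z : α}
    (hz : z ∈ G.V) (hx : x ∈ (sub z).leafLabels z) : Graftable x F (sub z) z (G.star z) where
  toIsDecoration := h.toIsDecoration
  mem := hx
  eq_of_mem w hw hwz := h.eq_of_mem w hw (mem_leafLabels_node.2 ⟨z, hz, hwz⟩)
  legs_eq := by
    obtain ⟨-, -, -, -, hdis, -⟩ := hT
    rw [h.legs_eq, grOn_star_node hdis hz hx]

theorem graft_branch (hT : (node G sub).IsGood) {z w : α} (hz : z ∈ G.V)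
    (hx : x ∈ (sub z).leafLabels z) (hw : w ∈ G.V) (hne : w ≠ z) :
    graft x F (sub w) w = sub w :=
  graft_of_notMem (hT.isNormal.2 w hw) fun h => hne (eq_of_mem_leafLabels hT hw hz h hx)

end Node

/-- Only the branch carrying the leaf `x` changes. There the minimum is preserved, because `x` is
the least vertex of `F`; disjointness survives because all other labels brought in by `F` are new.
-/
theorem IsGood.graft {x : α} {F : RawGraph α β} {T : GTree α β} {y : α} {s : List β}
    (hT : T.IsGood) (h : Graftable x F T y s) : (graft x F T y).IsGood := by
  induction T generalizing y s with
  | leaf =>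
    obtain rfl := mem_leafLabels_leaf.1 h.mem
    rw [graft_leaf]
    exact isGood_corolla h.directed h.connected h.hasEdge
  | node G sub ih =>
    obtain ⟨z₀, hz₀, hx₀⟩ := mem_leafLabels_node.1 h.mem
    have hb := h.branch hT hz₀ hx₀
    have hT' := hT
    obtain ⟨hd, hc, he, hsub, hdis, hleast, hcomp, hgood⟩ := hT
    rw [graft_node, isGood_node]
    refine ⟨hd, hc, he, fun z hz => graftSub_of_notMem hz, fun z hz w hw hzw => ?_, fun z hz => ?_,
      fun z hz => ?_, fun z hz => ?_⟩
    · rw [graftSub_of_mem hz, graftSub_of_mem hw, Finset.disjoint_left]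
      intro a haz haw
      rw [mem_leafLabels_graft] at haz haw
      have hd := Finset.disjoint_left.1 (hdis z hz w hw hzw)
      rcases haz with ⟨haz, hax⟩ | ⟨hxz, haF⟩ <;> rcases haw with ⟨haw, hax'⟩ | ⟨hxw, haF'⟩
      · exact hd haz haw
      · exact hax (h.eq_of_mem a haF' (mem_leafLabels_node.2 ⟨z, hz, haz⟩))
      · exact hax' (h.eq_of_mem a haF (mem_leafLabels_node.2 ⟨w, hw, haw⟩))
      · exact hd hxz hxw
    · rw [graftSub_of_mem hz]
      by_cases hzz : z = z₀
      · rw [hzz]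
        exact hb.isLeast_iff.2 (hleast z₀ hz₀)
      · rw [graft_branch hT' hz₀ hx₀ hz hzz]
        exact hleast z hz
    · rw [graftSub_of_mem hz]
      by_cases hzz : z = z₀
      · rw [hzz]
        exact hb.compatible (hcomp z₀ hz₀)
      · rw [graft_branch hT' hz₀ hx₀ hz hzz]
        exact hcomp z hz
    · rw [graftSub_of_mem hz]
      by_cases hzz : z = z₀
      · rw [hzz]
        exact ih z₀ (hgood z₀ hz₀) hb
      · rw [graft_branch hT' hz₀ hx₀ hz hzz]
        exact hgood z hz

/-- Insertion into a vertex is local: by induction it happens inside the one branch carrying `x`,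
and all other branches contribute the same vertices, local orders and edges as before. -/
theorem grOn_graft {x : α} {F : RawGraph α β} {T : GTree α β} {y : α} {s : List β}
    (hT : T.IsGood) (h : Graftable x F T y s) :
    (graft x F T y).grOn (RawGraph.corolla y s) =
      RawGraph.insertAt x F (T.grOn (RawGraph.corolla y s)) := by
  induction T generalizing y s with
  | leaf =>
    obtain rfl := mem_leafLabels_leaf.1 h.mem
    rw [graft_leaf]
    refine h.directed.insertion_corolla.trans ?_
    have hs : F.legs = s := h.legs_eq.trans (if_pos rfl)
    refine RawGraph.ext_of_eq ?_ (funext fun z => ?_) (funext fun f => funext fun f' => ?_) hs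
    · simp [grOn, RawGraph.insertAt, RawGraph.corolla]
    · simp only [grOn, RawGraph.insertAt, RawGraph.corolla]
      split_ifs with h1 h2
      · rfl
      · rw [h2] at h1
        exact absurd h.mem_V h1
      · exact h.directed.star_eq_nil z h1
    · simp [grOn, RawGraph.insertAt, RawGraph.corolla]
  | node G sub ih =>
    obtain ⟨z₀, hz₀, hx₀⟩ := mem_leafLabels_node.1 h.mem
    have hb := h.branch hT hz₀ hx₀
    have hT' := hT
    have hgT := hT.graft h
    obtain ⟨hd, hc, he, hsub, hdis, hleast, hcomp, hgood⟩ := hT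
    have ih₀ := ih z₀ (hgood z₀ hz₀) hb
    have hother : ∀ w ∈ G.V, w ≠ z₀ → graft x F (sub w) w = sub w := fun w hw hne =>
      graft_branch hT' hz₀ hx₀ hw hne
    rw [graft_node] at hgT ⊢
    obtain ⟨-, -, -, -, hdis', -⟩ := hgT
    refine RawGraph.ext_of_eq ?_ (funext fun w => ?_)
      (funext fun f => funext fun f' => propext ?_) rfl
    · ext w
      rw [grOn_V, ← graft_node x F G sub y, mem_leafLabels_graft, RawGraph.insertAt,
        Finset.mem_union, Finset.mem_erase, grOn_V]
      have := h.mem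
      tauto
    · by_cases hwF : w ∈ F.V
      · rw [grOn_star_node hdis' hz₀, graftSub_of_mem hz₀, ih₀]
        · exact (if_pos hwF).trans (if_pos hwF).symm
        · rw [graftSub_of_mem hz₀, mem_leafLabels_graft]
          exact Or.inr ⟨hx₀, hwF⟩
      · refine Eq.trans ?_ (if_neg hwF).symm
        have hwx : w ≠ x := by
          rintro rfl
          exact hwF h.mem_V
        by_cases hw : w ∈ (node G sub).leafLabels y
        · obtain ⟨z, hz, hwz⟩ := mem_leafLabels_node.1 hw
          rw [grOn_star_node hdis hz hwz, grOn_star_node hdis' hz, graftSub_of_mem hz]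
          · by_cases hzz : z = z₀
            · rw [hzz, ih₀]
              exact if_neg hwF
            · rw [hother z hz hzz]
          · rw [graftSub_of_mem hz, mem_leafLabels_graft]
            exact Or.inl ⟨hwz, hwx⟩
        · rw [grOn_star_eq_nil hw, grOn_star_eq_nil]
          rw [← graft_node x F G sub y, mem_leafLabels_graft]
          tauto
    · change (G.link f f' ∨ ∃ z ∈ G.V, _) ↔ ((G.link f f' ∨ ∃ z ∈ G.V, _) ∨ F.link f f')
      rw [or_assoc]
      refine or_congr Iff.rfl ?_
      constructor
      · rintro ⟨z, hz, hl⟩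
        dsimp only at hl
        rw [graftSub_of_mem hz] at hl
        by_cases hzz : z = z₀
        · rw [hzz, ih₀] at hl
          exact hl.imp_left fun hl => ⟨z₀, hz₀, hl⟩
        · rw [hother z hz hzz] at hl
          exact Or.inl ⟨z, hz, hl⟩
      · rintro (⟨z, hz, hl⟩ | hl)
        · refine ⟨z, hz, ?_⟩
          dsimp only at hl ⊢
          rw [graftSub_of_mem hz]
          by_cases hzz : z = z₀
          · rw [hzz] at hl ⊢
            rw [ih₀]
            exact Or.inl hl
          · rwa [hother z hz hzz]
        · refine ⟨z₀, hz₀, ?_⟩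
          dsimp only
          rw [graftSub_of_mem hz₀, ih₀]
          exact Or.inr hl

/-- A half-edge at the output edge is, by compatibility, a leg of the root decoration, hence sits at
one of its vertices and so at the output edge of a branch; it is followed in this way down to a
leaf. -/
theorem isFlag_grOn_of_mem {T : GTree α β} {y : α} {s : List β} {f : β} (hT : T.IsGood)
    (hc : T.Compatible s) (hf : f ∈ s) : (T.grOn (RawGraph.corolla y s)).IsFlag f := by
  induction T generalizing y s with
  | leaf => exact ⟨y, Finset.mem_singleton_self y, by
      have h : (RawGraph.corolla y s).star y = s := if_pos rfl
      rwa [grOn, h]⟩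
  | node G sub ih =>
    obtain ⟨hd, -, -, -, -, -, hcomp, hgood⟩ := hT
    obtain ⟨rfl, -⟩ := hc
    obtain ⟨z, hz, hfz⟩ := ((hd.mem_legs f).1 hf).1
    obtain ⟨w, hw, hfw⟩ := ih z (y := z) (hgood z hz) (hcomp z hz) hfz
    rw [grOn_V] at hw
    refine ⟨w, ?_, mem_grOn_star_node.2 ⟨z, hz, hfw⟩⟩
    rw [grOn_V]
    exact mem_leafLabels_node.2 ⟨z, hz, hw⟩

theorem isFlag_grOn_of_link {T : GTree α β} {y : α} {s : List β} {f f' : β} (hT : T.IsGood)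
    (hl : (T.grOn (RawGraph.corolla y s)).link f f') :
    (T.grOn (RawGraph.corolla y s)).IsFlag f := by
  induction T generalizing y s with
  | leaf => exact absurd hl id
  | node G sub ih =>
    obtain ⟨hd, -, -, -, -, -, hcomp, hgood⟩ := hT
    have key : ∃ z ∈ G.V, ((sub z).grOn (RawGraph.corolla z (G.star z))).IsFlag f := by
      rcases hl with hl | ⟨z, hz, hl⟩
      · obtain ⟨z, hz, hfz⟩ := hd.link_isFlag _ _ hl
        exact ⟨z, hz, isFlag_grOn_of_mem (hgood z hz) (hcomp z hz) hfz⟩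
      · exact ⟨z, hz, ih z (hgood z hz) hl⟩
    obtain ⟨z, hz, w, hw, hfw⟩ := key
    rw [grOn_V] at hw
    refine ⟨w, ?_, mem_grOn_star_node.2 ⟨z, hz, hfw⟩⟩
    rw [grOn_V]
    exact mem_leafLabels_node.2 ⟨z, hz, hw⟩

/-- The converse of `IsGood.graft`: pruning a corolla preserves goodness. The conditions on the
output edge are recorded in the vertex below it, so when `T` is a bare leaf they have to be supplied
as the extra hypothesis `hleaf`. -/
theorem IsGood.of_graft {x : α} {F : RawGraph α β} {T : GTree α β} {y : α} {s : List β}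
    (hT : T.IsNormal) (hx : x ∈ T.leafLabels y) (h : (GTree.graft x F T y).IsGood)
    (hleaf : T = leaf → (GTree.graft x F T y).Compatible s ∧
      IsLeast ((GTree.graft x F T y).leafLabels y : Set α) y) :
    T.IsGood ∧ Graftable x F T y s := by
  induction T generalizing y s with
  | leaf =>
    obtain rfl := mem_leafLabels_leaf.1 hx
    obtain ⟨hc, hl⟩ := hleaf rfl
    rw [graft_leaf] at h hc hl
    obtain ⟨hd, hcon, he, -⟩ := h
    refine ⟨trivial, ⟨hd, hcon, he, ?_, hc.2⟩, hx, fun w _ hw => mem_leafLabels_leaf.1 hw, ?_⟩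
    · convert hl
      ext w
      rw [corolla, mem_leafLabels_node]
      simp [mem_leafLabels_leaf]
    · exact hc.1.trans (if_pos rfl).symm
  | node G sub ih =>
    clear hleaf
    obtain ⟨z₀, hz₀, hx₀⟩ := mem_leafLabels_node.1 hx
    rw [graft_node] at h
    have h' := h
    obtain ⟨hd, hc, he, -, hdis, hleast, hcomp, hgood⟩ := h
    have hg₀ := hgood z₀ hz₀
    have hc₀ := hcomp z₀ hz₀
    have hl₀ := hleast z₀ hz₀
    rw [graftSub_of_mem hz₀] at hg₀ hc₀ hl₀
    -- The edge conditions required by the induction hypothesis if the branch is a bare leaf are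
    -- those imposed by `G` on its input edge `z₀`.
    obtain ⟨ihg, ihG⟩ := ih z₀ (hT.2 z₀ hz₀) hx₀ hg₀ fun _ => ⟨hc₀, hl₀⟩
    have hmem : ∀ z ∈ G.V, ∀ w ∈ (sub z).leafLabels z,
        w ∈ (graftSub x F G sub z).leafLabels z := by
      intro z hz w hw
      rw [graftSub_of_mem hz]
      exact leafLabels_subset_graft ihG.mem_V hw
    have hdisj : ∀ z ∈ G.V, ∀ w ∈ G.V, z ≠ w →
        Disjoint ((sub z).leafLabels z) ((sub w).leafLabels w) := fun z hz w hw hzw =>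
      (hdis z hz w hw hzw).mono (hmem z hz) (hmem w hw)
    have hF₀ : ∀ w ∈ F.V,
        w ∈ (graftSub x F G sub z₀).leafLabels z₀ := by
      intro w hw
      rw [graftSub_of_mem hz₀, mem_leafLabels_graft]
      exact Or.inr ⟨hx₀, hw⟩
    have hother : ∀ z ∈ G.V, z ≠ z₀ → GTree.graft x F (sub z) z = sub z := by
      intro z hz hzz
      refine graft_of_notMem (hT.2 z hz) fun hxz => ?_
      exact Finset.disjoint_left.1 (hdisj z hz z₀ hz₀ hzz) hxz hx₀
    have hnode : (node G sub).IsGood := by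
      refine ⟨hd, hc, he, hT.1, hdisj, fun z hz => ?_, fun z hz => ?_, fun z hz => ?_⟩
      · by_cases hzz : z = z₀
        · rw [hzz]
          exact ihG.isLeast_iff.1 hl₀
        · have := hleast z hz
          rwa [graftSub_of_mem hz, hother z hz hzz] at this
      · by_cases hzz : z = z₀
        · rw [hzz]
          by_cases hlf : sub z₀ = leaf
          · rw [hlf]
            trivial
          · exact (compatible_graft_iff hlf).1 hc₀
        · have := hcomp z hz
          rwa [graftSub_of_mem hz, hother z hz hzz] at this
      · by_cases hzz : z = z₀
        · rw [hzz]
          exact ihg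
        · have := hgood z hz
          rwa [graftSub_of_mem hz, hother z hz hzz] at this
    refine ⟨hnode, ihG.toIsDecoration, hx, fun w hw hwT => ?_, ?_⟩
    · obtain ⟨z, hz, hwz⟩ := mem_leafLabels_node.1 hwT
      obtain rfl : z = z₀ := eq_of_mem_leafLabels h' hz hz₀ (hmem z hz w hwz) (hF₀ w hw)
      exact ihG.eq_of_mem w hw hwz
    · rw [grOn_star_node hdisj hz₀ hx₀]
      exact ihG.legs_eq

/-- The number of vertices of a tree. -/
def size : GTree α β → ℕ
  | leaf => 0
  | node G sub => 1 + ∑ x ∈ G.V, (sub x).size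

/-- Following nonempty branches upwards from the root ends at a vertex all of whose inputs are
leaves; this vertex is pruned. Minimality of `y` guarantees that the label of its output edge is a
vertex of its decoration, and size decreases, which drives the induction over trees. -/
theorem IsGood.exists_graft {T : GTree α β} {y : α} (hT : T.IsGood) (hne : T ≠ leaf)
    (hy : IsLeast (T.leafLabels y : Set α) y) :
    ∃ (x : α) (F : RawGraph α β) (T₁ : GTree α β), T₁.IsNormal ∧ x ∈ T₁.leafLabels y ∧ x ∈ F.V ∧
      T = GTree.graft x F T₁ y ∧ T₁.size < T.size ∧ (T₁ = leaf → T = corolla F) := by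
  induction T generalizing y with
  | leaf => exact absurd rfl hne
  | node G sub ih =>
    have hnormal := hT.isNormal
    have hT' := hT
    obtain ⟨hd, hc, he, hsub, hdis, hleast, hcomp, hgood⟩ := hT
    by_cases hall : ∀ z ∈ G.V, sub z = leaf
    · have hsub' : sub = fun _ => leaf := by
        funext z
        by_cases hz : z ∈ G.V
        exacts [hall z hz, hsub z hz]
      subst hsub'
      refine ⟨y, G, leaf, trivial, mem_leafLabels_leaf.2 rfl, ?_, (graft_leaf y G).symm, ?_,
        fun _ => rfl⟩
      · obtain ⟨z, hz, hyz⟩ := mem_leafLabels_node.1 (Finset.mem_coe.1 hy.1)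
        rwa [mem_leafLabels_leaf.1 hyz]
      · simp [size]
    · push Not at hall
      obtain ⟨z₀, hz₀, hlf⟩ := hall
      obtain ⟨x, F, T₁, hn₁, hx, hxF, heq, hlt, -⟩ := ih z₀ (hgood z₀ hz₀) hlf (hleast z₀ hz₀)
      have hx₀ : x ∈ (sub z₀).leafLabels z₀ := by
        rw [heq]
        exact leafLabels_subset_graft hxF hx
      -- Only the branch at `z₀` is replaced by its pruned version; its corolla cannot be grafted
      -- anywhere else, since the label `x` occurs in no other branch.
      refine ⟨x, F, node G (Function.update sub z₀ T₁), ⟨fun z hz => ?_, fun z hz => ?_⟩,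
        mem_leafLabels_node.2 ⟨z₀, hz₀, by rwa [Function.update_self]⟩, hxF, ?_, ?_,
        nofun⟩
      · rw [Function.update_of_ne]
        · exact hsub z hz
        · rintro rfl
          exact hz hz₀
      · by_cases hzz : z = z₀
        · rw [hzz, Function.update_self]
          exact hn₁
        · rw [Function.update_of_ne hzz]
          exact hnormal.2 z hz
      · rw [graft_node]
        congr 1
        funext z
        unfold graftSub
        split_ifs with hz
        · by_cases hzz : z = z₀
          · rw [hzz, Function.update_self, heq]
          · rw [Function.update_of_ne hzz, graft_branch hT' hz₀ hx₀ hz hzz]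
        · exact hsub z hz
      · refine Nat.add_lt_add_left (Finset.sum_lt_sum (fun z hz => ?_) ⟨z₀, hz₀, ?_⟩) 1
        · by_cases hzz : z = z₀
          · rw [hzz, Function.update_self]
            exact hlt.le
          · rw [Function.update_of_ne hzz]
        · rwa [Function.update_self]

/-- The diamond property of pruning. Two corollas grafted last onto the same tree are either the
same extremal vertex or two different ones; in the second case removing both leaves a common tree,
from which each of `A` and `B` arises by one grafting. -/
theorem eq_or_exists_of_graft_eq {x x' : α} {F F' : RawGraph α β} {A B : GTree α β} {y : α}
    (hA : A.IsGood) (hB : B.IsGood) (hxA : x ∈ A.leafLabels y) (hxB : x' ∈ B.leafLabels y)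
    (hxF : x ∈ F.V) (hxF' : x' ∈ F'.V) (h : graft x F A y = graft x' F' B y) :
    (x = x' ∧ F = F' ∧ A = B) ∨ (x ≠ x' ∧ ∃ T : GTree α β, T.IsNormal ∧ x ∈ T.leafLabels y ∧
      x' ∈ T.leafLabels y ∧ A = graft x' F' T y ∧ B = graft x F T y) := by
  induction A generalizing B y with
  | leaf =>
    obtain rfl := mem_leafLabels_leaf.1 hxA
    cases B with
    | leaf =>
      obtain rfl := mem_leafLabels_leaf.1 hxB
      rw [graft_leaf, graft_leaf, corolla, corolla] at h
      injection h with h1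
      exact Or.inl ⟨rfl, h1, rfl⟩
    | node H b =>
      rw [graft_leaf] at h
      exact absurd h.symm (graft_ne_corolla nofun hxB)
  | node H a ih =>
    cases B with
    | leaf =>
      obtain rfl := mem_leafLabels_leaf.1 hxB
      rw [graft_leaf] at h
      exact absurd h (graft_ne_corolla nofun hxA)
    | node H' b =>
      rw [graft_node, graft_node] at h
      injection h with h1 h2
      subst h1
      have ht : ∀ z ∈ H.V, graft x F (a z) z = graft x' F' (b z) z := fun z hz => by
        have h3 := congrFun h2 z
        rwa [graftSub_of_mem hz, graftSub_of_mem hz] at h3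
      obtain ⟨z₁, hz₁, hx₁⟩ := mem_leafLabels_node.1 hxA
      obtain ⟨z₂, hz₂, hx₂⟩ := mem_leafLabels_node.1 hxB
      have hAn := hA.isNormal
      have hBn := hB.isNormal
      have hta : ∀ z ∈ H.V, z ≠ z₁ → graft x F (a z) z = a z := fun z hz hzz =>
        graft_branch hA hz₁ hx₁ hz hzz
      have htb : ∀ z ∈ H.V, z ≠ z₂ → graft x' F' (b z) z = b z := fun z hz hzz =>
        graft_branch hB hz₂ hx₂ hz hzz
      have hga : ∀ z ∈ H.V, (a z).IsGood := hA.2.2.2.2.2.2.2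
      have hgb : ∀ z ∈ H.V, (b z).IsGood := hB.2.2.2.2.2.2.2
      by_cases hzz : z₁ = z₂
      · subst hzz
        have hab : ∀ z ∈ H.V, z ≠ z₁ → a z = b z := fun z hz hzz => by
          rw [← hta z hz hzz, ht z hz, htb z hz hzz]
        rcases ih z₁ (hga z₁ hz₁) (hgb z₁ hz₁) hx₁ hx₂ (ht z₁ hz₁) with
          ⟨h3, h4, h5⟩ | ⟨h3, T, hTn, hxT, hxT', h4, h5⟩
        · refine Or.inl ⟨h3, h4, ?_⟩
          congr 1
          funext z
          by_cases hz : z ∈ H.V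
          · by_cases hzz : z = z₁
            · rw [hzz, h5]
            · exact hab z hz hzz
          · rw [hAn.1 z hz, hBn.1 z hz]
        -- Both prunings take place in the same branch, so the common tree is obtained by replacing
        -- that branch by the one from the induction hypothesis.
        · refine Or.inr ⟨h3, node H (Function.update a z₁ T), ⟨fun z hz => ?_, fun z hz => ?_⟩,
            mem_leafLabels_node.2 ⟨z₁, hz₁, by rwa [Function.update_self]⟩,
            mem_leafLabels_node.2 ⟨z₁, hz₁, by rwa [Function.update_self]⟩, ?_, ?_⟩
          · rw [Function.update_of_ne]
            · exact hAn.1 z hz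
            · rintro rfl
              exact hz hz₁
          · by_cases hzz : z = z₁
            · rw [hzz, Function.update_self]
              exact hTn
            · rw [Function.update_of_ne hzz]
              exact hAn.2 z hz
          · rw [graft_node]
            congr 1
            funext z
            unfold graftSub
            split_ifs with hz
            · by_cases hzz : z = z₁
              · rw [hzz, Function.update_self, h4]
              · rw [Function.update_of_ne hzz, hab z hz hzz, htb z hz hzz]
            · exact hAn.1 z hz
          · rw [graft_node]
            congr 1
            funext z
            unfold graftSub
            split_ifs with hz
            · by_cases hzz : z = z₁
              · rw [hzz, Function.update_self, h5]
              · rw [Function.update_of_ne hzz, hta z hz hzz, hab z hz hzz]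
            · exact hBn.1 z hz
      · have hb₁ : b z₁ = graft x F (a z₁) z₁ := by rw [ht z₁ hz₁, htb z₁ hz₁ hzz]
        have ha₂ : a z₂ = graft x' F' (b z₂) z₂ := by
          rw [← ht z₂ hz₂, hta z₂ hz₂ fun h => hzz h.symm]
        have hxb₁ : x ∈ (b z₁).leafLabels z₁ := by
          rw [hb₁]
          exact leafLabels_subset_graft hxF hx₁
        -- The prunings take place in different branches: `a` is already pruned at `z₁` and `b` at
        -- `z₂`, so the common tree takes the branch at `z₂` from `b` and all others from `a`.
        refine Or.inr ⟨?_, node H (Function.update a z₂ (b z₂)), ⟨fun z hz => ?_, fun z hz => ?_⟩,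
          mem_leafLabels_node.2 ⟨z₁, hz₁, by rwa [Function.update_of_ne hzz]⟩,
          mem_leafLabels_node.2 ⟨z₂, hz₂, by rwa [Function.update_self]⟩, ?_, ?_⟩
        · rintro rfl
          exact hzz (eq_of_mem_leafLabels hB hz₁ hz₂ hxb₁ hx₂)
        · rw [Function.update_of_ne]
          · exact hAn.1 z hz
          · rintro rfl
            exact hz hz₂
        · by_cases hzz : z = z₂
          · rw [hzz, Function.update_self]
            exact hBn.2 z₂ hz₂
          · rw [Function.update_of_ne hzz]
            exact hAn.2 z hz
        · rw [graft_node]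
          congr 1
          funext z
          unfold graftSub
          split_ifs with hz
          · by_cases hzz' : z = z₂
            · rw [hzz', Function.update_self, ha₂]
            · rw [Function.update_of_ne hzz', graft_of_notMem (hAn.2 z hz)]
              intro hxz
              refine hzz' (eq_of_mem_leafLabels hB hz hz₂ ?_ hx₂)
              rw [← htb z hz hzz', ← ht z hz]
              exact leafLabels_subset_graft hxF hxz
          · exact hAn.1 z hz
        · rw [graft_node]
          congr 1
          funext z
          unfold graftSub
          split_ifs with hz
          · by_cases hzz' : z = z₂
            · rw [hzz', Function.update_self, graft_of_notMem (hBn.2 z₂ hz₂)]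
              exact fun hxz => hzz (eq_of_mem_leafLabels hB hz₁ hz₂ hxb₁ hxz)
            · rw [Function.update_of_ne hzz', ht z hz, htb z hz hzz']
          · exact hBn.1 z hz

end GTree

/-! ### Towers of canonical contractions and their trees. -/

section CanonicalTowers

variable {α : Type u} {β : Type v} [LinearOrder α]

namespace GTree

theorem leafLabels_eq_of_gr_eq {T : GTree α β} (hT : T ≠ leaf) {G : RawGraph α β} (h : T.gr = G)
    (y : α) : T.leafLabels y = G.V := by
  rw [← h, gr_eq_grOn hT (RawGraph.corolla y []), grOn_V]

theorem gr_graft {x : α} {F : RawGraph α β} {T : GTree α β} {y : α} {s : List β}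
    (hT : T.IsGood) (hne : T ≠ leaf) (h : Graftable x F T y s) :
    (graft x F T y).gr = RawGraph.insertAt x F T.gr := by
  rw [gr_eq_grOn (graft_ne_leaf h.mem) (RawGraph.corolla y s),
    gr_eq_grOn hne (RawGraph.corolla y s), grOn_graft hT h]

/-- The corolla grafted last onto a graph-tree defines a canonical contraction. -/
theorem Graftable.exists_canonical {x : α} {F : RawGraph α β} {T : GTree α β} {y : α} {s : List β}
    {Γ : Grc α β} (hT : T.IsGood) (hne : T ≠ leaf) (h : Graftable x F T y s)
    (hgr : (graft x F T y).gr = Γ.toRawGraph) :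
    ∃ (Γ₁ : Grc α β) (π : Γ ⟶ Γ₁) (z : Γ₁.Vert), Grc.IsCanonicalContraction π z ∧
      (z : α) = x ∧ π.fiber z = F ∧ T.gr = Γ₁.toRawGraph := by
  rw [gr_graft hT hne h] at hgr
  have hV : ∀ z, z ∈ T.gr.V ↔ z ∈ T.leafLabels y := fun z => by
    rw [leafLabels_eq_of_gr_eq hne rfl]
  have hlegs : F.legs = T.gr.star x := by
    rw [h.legs_eq, gr_eq_grOn hne]
  have hstar : ∀ z, z ∉ T.gr.V → T.gr.star z = [] := fun z hz => by
    rw [hV] at hz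
    rw [gr_eq_grOn hne (RawGraph.corolla y s), grOn_star_eq_nil hz]
  have hflag : ∀ f f', T.gr.link f f' → T.gr.IsFlag f := fun f f' hl => by
    rw [gr_eq_grOn hne (RawGraph.corolla y s)] at hl ⊢
    exact isFlag_grOn_of_link hT hl
  have hΓV : ∀ z, z ∈ Γ.V ↔ z ∈ T.gr.V ∧ z ≠ x ∨ z ∈ F.V := fun z => by
    rw [← hgr, RawGraph.insertAt, Finset.mem_union, Finset.mem_erase, and_comm]
  have hΓF : ∀ z ∈ F.V, F.star z = Γ.star z := fun z hz => by
    rw [← hgr]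
    exact (if_pos hz).symm
  have hΓT : ∀ z, z ∉ F.V → Γ.star z = T.gr.star z := fun z hz => by
    rw [← hgr]
    exact if_neg hz
  have hΓl : ∀ f f', Γ.link f f' ↔ T.gr.link f f' ∨ F.link f f' := fun f f' => by
    rw [← hgr]
    rfl
  have hc : Grc.IsContractible Γ F x :=
    { h.toIsDecoration with
      V_subset := fun z hz => (hΓV z).2 (Or.inr hz)
      star_eq := hΓF
      link_le := fun f f' hl => (hΓl f f').2 (Or.inr hl) }
  refine ⟨hc.target, hc.map, hc.point, hc.isCanonicalContraction, rfl, hc.fiber_map, ?_⟩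
  change _ = Γ.contract F x
  refine RawGraph.ext_of_eq ?_ (funext fun z => ?_) (funext fun f => funext fun f' => propext ?_) ?_
  · ext z
    rw [RawGraph.mem_contract_V, hΓV]
    have h1 := h.mem
    have h2 := h.eq_of_mem z
    rw [← hV] at h1 h2
    by_cases hz : z = x
    · subst hz
      tauto
    · tauto
  · by_cases hzx : z = x
    · rw [hzx, RawGraph.contract_star_self, hlegs]
    · by_cases hz : z ∈ F.V
      · rw [hstar z fun hzT => hzx (h.eq_of_mem z hz ((hV z).1 hzT))]
        exact ((if_neg hzx).trans (if_pos hz)).symm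
      · rw [RawGraph.contract_star_of_notMem _ _ hzx hz, hΓT z hz]
  · constructor
    -- Edges of the pruned graph are not edges of `F`: a half-edge at `x` is a leg of `F`, hence
    -- unmatched in `F`, and a half-edge at any other vertex of the pruned graph does not belong to
    -- `F`.
    · intro hl
      refine ⟨(hΓl f f').2 (Or.inl hl), fun hF => ?_⟩
      obtain ⟨z, hz, hfz⟩ := hflag f f' hl
      have hfF := h.directed.link_isFlag _ _ hF
      by_cases hzF : z ∈ F.V
      · obtain rfl := h.eq_of_mem z hzF ((hV z).1 hz)
        rw [← hlegs] at hfz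
        exact h.not_link_of_mem_legs hfz hF
      · rw [← hΓT z hzF] at hfz
        exact hzF ((hc.isFlag_iff hfz).1 hfF)
    · rintro ⟨hl, hF⟩
      exact ((hΓl f f').1 hl).resolve_right hF
  · change _ = Γ.legs
    rw [← hgr]
    rfl

end GTree

/-- Towers of canonical contractions. -/
inductive CanonicalTower : Grc α β → Type (max u v)
  | last (Γ : Grc α β) (h : Γ.HasEdge) : CanonicalTower Γ
  | step {Γ Γ₁ : Grc α β} (π : Γ ⟶ Γ₁) (x : Γ₁.Vert) (h : Grc.IsCanonicalContraction π x)
      (C : CanonicalTower Γ₁) : CanonicalTower Γ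

namespace CanonicalTower

/-- The graph-tree of a tower of canonical contractions. -/
noncomputable def tree : ∀ {Γ : Grc α β}, CanonicalTower Γ → GTree α β
  | Γ, last _ _ => GTree.corolla Γ.toRawGraph
  | _, step π x _ C => GTree.graft (x : α) (π.fiber x) C.tree x

/-- The number of contractions. -/
def length : ∀ {Γ : Grc α β}, CanonicalTower Γ → ℕ
  | _, last _ _ => 0
  | _, step _ _ _ C => C.length + 1

theorem graftable {Γ Γ₁ : Grc α β} {π : Γ ⟶ Γ₁} {x : Γ₁.Vert} (h : Grc.IsCanonicalContraction π x)
    {T : GTree α β} (hne : T ≠ GTree.leaf) (hgr : T.gr = Γ₁.toRawGraph) (y : α) (s : List β) :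
    GTree.Graftable (x : α) (π.fiber x) T y s where
  toIsDecoration := h.isContractible.toIsDecoration
  mem := by
    rw [GTree.leafLabels_eq_of_gr_eq hne hgr]
    exact x.2
  eq_of_mem w hw hwT := by
    rw [GTree.leafLabels_eq_of_gr_eq hne hgr, h.mem_V_iff] at hwT
    exact hwT.resolve_right fun h => h.2 hw
  legs_eq := by
    rw [← GTree.gr_eq_grOn hne, hgr, h.fiber_legs]

/-- Each step grafts the contracted fibre onto the tree, that is, inserts it back into the
contracted graph, so the graph of the tree is restored step by step to `Γ`. -/
theorem tree_spec {Γ : Grc α β} (C : CanonicalTower Γ) :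
    C.tree ≠ GTree.leaf ∧ C.tree.IsGood ∧ C.tree.gr = Γ.toRawGraph := by
  induction C with
  | last Γ h =>
    exact ⟨nofun, GTree.isGood_corolla Γ.isDirectedGraph Γ.isConnected h,
      GTree.gr_corolla Γ.isDirectedGraph⟩
  | @step Γ Γ₁ π x h C ih =>
    obtain ⟨hne, hgood, hgr⟩ := ih
    have hg := graftable h hne hgr x []
    refine ⟨GTree.graft_ne_leaf hg.mem, hgood.graft hg, ?_⟩
    rw [tree, GTree.gr_graft hgood hne hg, hgr, h.insertAt_eq]

/-- Prune an extremal vertex; by `GTree.Graftable.exists_canonical` this is a canonical contraction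
of `Γ`, and the smaller tree belongs to its target. -/
theorem exists_tree_eq {Γ : Grc α β} {T : GTree α β} (hT : T.IsGood) (hne : T ≠ GTree.leaf)
    (hgr : T.gr = Γ.toRawGraph) : ∃ C : CanonicalTower Γ, C.tree = T := by
  induction hn : T.size using Nat.strong_induction_on generalizing T Γ with
  | _ n ih =>
    subst hn
    obtain ⟨y, hy⟩ : ∃ y, IsLeast (Γ.V : Set α) y := ⟨_, Finset.isLeast_min' _ Γ.isConnected.1⟩
    rw [← GTree.leafLabels_eq_of_gr_eq hne hgr y] at hy
    obtain ⟨x, F, T₁, hn₁, hx, -, rfl, hlt, hleaf⟩ := hT.exists_graft hne hy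
    by_cases h₁ : T₁ = GTree.leaf
    · rw [hleaf h₁] at hgr hT ⊢
      rw [GTree.gr_corolla hT.1] at hgr
      refine ⟨last Γ ?_, by rw [tree, ← hgr]⟩
      rw [← hgr]
      exact hT.2.2.1
    -- The list `s` of half-edges at the output edge matters only for a bare leaf, so any value
    -- serves.
    · obtain ⟨hg₁, hG⟩ := GTree.IsGood.of_graft (s := []) hn₁ hx hT fun h => absurd h h₁
      obtain ⟨Γ₁, π, z, hcan, rfl, rfl, hgr₁⟩ := hG.exists_canonical hg₁ h₁ hgr
      obtain ⟨C, rfl⟩ := ih _ hlt hg₁ h₁ hgr₁ rfl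
      exact ⟨step π z hcan C, GTree.graft_congr _ _ h₁ _ _⟩

/-- Two towers of canonical contractions differ by interchanging two adjacent contractions of
disjoint subgraphs. -/
inductive Swap : ∀ {Γ : Grc α β}, CanonicalTower Γ → CanonicalTower Γ → Prop
  | here {Γ P Q S : Grc α β} {π₁ : Γ ⟶ P} {π₂ : P ⟶ S} {κ₁ : Γ ⟶ Q} {κ₂ : Q ⟶ S}
      {a : P.Vert} {b : Q.Vert} {i j : S.Vert}
      (hπ₁ : Grc.IsCanonicalContraction π₁ a) (hπ₂ : Grc.IsCanonicalContraction π₂ j)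
      (hκ₁ : Grc.IsCanonicalContraction κ₁ b) (hκ₂ : Grc.IsCanonicalContraction κ₂ i)
      (ha : π₂.φ a = i) (hb : κ₂.φ b = j) (hij : i ≠ j) (comm : π₁ ≫ π₂ = κ₁ ≫ κ₂)
      (C : CanonicalTower S) :
      Swap (step π₁ a hπ₁ (step π₂ j hπ₂ C)) (step κ₁ b hκ₁ (step κ₂ i hκ₂ C))
  | there {Γ Γ₁ : Grc α β} (π : Γ ⟶ Γ₁) (x : Γ₁.Vert) (h : Grc.IsCanonicalContraction π x)
      {C C' : CanonicalTower Γ₁} (s : Swap C C') : Swap (step π x h C) (step π x h C')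

theorem Swap.length_eq {Γ : Grc α β} {C C' : CanonicalTower Γ} (h : Swap C C') :
    C.length = C'.length := by
  induction h with
  | here => rfl
  | there π x h s ih => rw [length, length, ih]

theorem length_eq_of_eqvGen {Γ : Grc α β} {C C' : CanonicalTower Γ}
    (h : Relation.EqvGen Swap C C') : C.length = C'.length := by
  induction h with
  | rel _ _ h => exact h.length_eq
  | refl => rfl
  | symm _ _ _ ih => exact ih.symm
  | trans _ _ _ _ _ ih₁ ih₂ => exact ih₁.trans ih₂

theorem eqvGen_step {Γ Γ₁ : Grc α β} (π : Γ ⟶ Γ₁) (x : Γ₁.Vert)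
    (hπ : Grc.IsCanonicalContraction π x) {C C' : CanonicalTower Γ₁}
    (h : Relation.EqvGen Swap C C') :
    Relation.EqvGen Swap (step π x hπ C) (step π x hπ C') := by
  induction h with
  | rel _ _ h => exact .rel _ _ (.there π x hπ h)
  | refl => exact .refl _
  | symm _ _ _ ih => exact .symm _ _ ih
  | trans _ _ _ _ _ ih₁ ih₂ => exact .trans _ _ _ ih₁ ih₂

/-- If the first contractions have the same fibre, they coincide and induction applies. Otherwise
the diamond provides a common pruned tree; a canonical tower of it extends in two ways, differing by
an interchange, and each extension is connected by induction to one of the given towers. -/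
theorem eqvGen_of_tree_eq {Γ : Grc α β} (C C' : CanonicalTower Γ) (h : C.tree = C'.tree) :
    Relation.EqvGen Swap C C' := by
  induction hn : C.length using Nat.strong_induction_on generalizing Γ with
  | _ n ih =>
    subst hn
    cases C with
    | last _ hΓ =>
      cases C' with
      | last => exact .refl _
      | step π' x' h' C' =>
        obtain ⟨hne, -, hgr⟩ := C'.tree_spec
        exact absurd h.symm (GTree.graft_ne_corolla hne (graftable h' hne hgr x' []).mem)
    | step π x hπ C =>
      obtain ⟨hneA, hgA, hgrA⟩ := C.tree_spec
      have hGA := graftable hπ hneA hgrA x []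
      cases C' with
      | last => exact absurd h (GTree.graft_ne_corolla hneA hGA.mem)
      | step π' x' hπ' C' =>
        obtain ⟨hneB, hgB, hgrB⟩ := C'.tree_spec
        have hGB := graftable hπ' hneB hgrB x []
        rw [tree, tree, GTree.graft_congr (x' : α) _ hneB x' x] at h
        rcases GTree.eq_or_exists_of_graft_eq hgA hgB hGA.mem hGB.mem hGA.mem_V hGB.mem_V h with
          ⟨-, hF, hAB⟩ | ⟨hxx, T, hTn, hxT, hxT', hA, hB⟩
        · have hs := hπ.ext_of_fiber_eq hπ' hF
          cases hs
          exact eqvGen_step _ _ _ (ih _ (Nat.lt_succ_self _) _ _ hAB rfl)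
        · have hTne : T ≠ GTree.leaf := by
            rintro rfl
            exact hxx ((GTree.mem_leafLabels_leaf.1 hxT).trans
              (GTree.mem_leafLabels_leaf.1 hxT').symm)
          rw [hA] at hgA hgrA
          obtain ⟨hgT, hGT⟩ := GTree.IsGood.of_graft (s := []) hTn hxT' hgA fun h => absurd h hTne
          obtain ⟨S, π₂, j, hπ₂, hj, hF', hgrT⟩ := hGT.exists_canonical hgT hTne hgrA
          obtain ⟨C'', hC''⟩ := exists_tree_eq hgT hTne hgrT
          have hne : π₂.φ x ≠ j := by
            intro hxj
            refine hxx (hGT.eq_of_mem x ?_ hxT)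
            rw [← hF']
            exact (Grc.fiber_mem_V' _ _ _).2 hxj
          obtain ⟨Q, κ₁, κ₂, b, hκ₁, hκ₂, hb, hcomm, hfib₁, hfib₂⟩ := hπ.exists_swap hπ₂ hne
          have hs := hκ₁.ext_of_fiber_eq hπ' (hfib₁.trans hF')
          cases hs
          have h₁ : Relation.EqvGen Swap C (step π₂ j hπ₂ C'') := by
            refine ih _ (Nat.lt_succ_self _) _ _ ?_ rfl
            rw [tree, hA, hC'', hF', hj, GTree.graft_congr _ _ hTne]
          have h₂ : Relation.EqvGen Swap (step κ₂ _ hκ₂ C'') C' := by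
            -- This tower is not a piece of the given one, so its length has to be controlled:
            -- interchanges preserve length, whence it is as long as `C`.
            refine ih _ ?_ _ _ ?_ rfl
            · rw [length, length, Nat.lt_succ_iff, length_eq_of_eqvGen h₁, length]
            · rw [tree, hB, hC'', hfib₂, hπ₂.φ_eq x hne]
          exact .trans _ _ _ (eqvGen_step π x hπ h₁) (.trans _ _ _
            (.rel _ _ (.here hπ hπ₂ hκ₁ hκ₂ rfl hb hne hcomm C'')) (eqvGen_step _ _ hκ₁ h₂))

end CanonicalTower

end CanonicalTowers

theorem Finset.exists_equiv_le_iff {α L : Type*} [LinearOrder α] [LinearOrder L] (V : Finset α)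
    (k : {x // x ∈ V} → L) (hk : Function.Injective k) :
    ∃ p : {x // x ∈ V} ≃ {x // x ∈ V}, ∀ u w, p u ≤ p w ↔ k u ≤ k w := by
  set e := V.orderIsoOfFin rfl
  have hs : StrictMono ((k ∘ e) ∘ Tuple.sort (k ∘ e)) :=
    (Tuple.monotone_sort (k ∘ e)).strictMono_of_injective
      ((hk.comp e.injective).comp (Tuple.sort (k ∘ e)).injective)
  -- Sorting yields a permutation of positions, transported to `V` itself: the relabelled graph
  -- reuses the old vertex names, so no fresh names in `α` are needed.
  refine ⟨(e.symm.toEquiv.trans (Tuple.sort (k ∘ e)).symm).trans e.toEquiv, fun u w => ?_⟩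
  change e _ ≤ e _ ↔ _
  rw [e.le_iff_le, ← hs.le_iff_le]
  simp

/-! ### Straightening: relabelling a source so that a simple map becomes elementary. -/

namespace Grc

variable {α : Type u} {β : Type v}

theorem hasEdge_of_iso {Γ Δ : Grc α β} (ℓ : Γ ≅ Δ) (h : Δ.HasEdge) : Γ.HasEdge := by
  obtain ⟨f, f', hl⟩ := h
  exact ⟨_, _, (Grc.Hom.link_ψ ℓ.hom ⟨f, Δ.isDirectedGraph.link_isFlag _ _ hl⟩
    ⟨f', Grc.isFlag_right hl⟩).2 hl⟩

section Relabel

variable [LinearOrder α] (X : Grc α β) (p : X.Vert ≃ X.Vert) (st : α → List β)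

/-- Renaming the vertices and changing the local orders of a graph. -/
def relabelRaw : RawGraph α β where
  V := X.V
  star w := if h : w ∈ X.V then st (p.symm ⟨w, h⟩) else []
  link := X.link
  legs := X.legs

theorem relabelRaw_star (u : X.Vert) : (relabelRaw X p st).star (p u) = st u := by
  refine (dif_pos (p u).2).trans ?_
  rw [show (⟨p u, (p u).2⟩ : X.Vert) = p u from rfl, p.symm_apply_apply]

theorem mem_relabelRaw_star {w : α} {f : β} (h : f ∈ (relabelRaw X p st).star w) :
    ∃ u : X.Vert, (p u : α) = w ∧ f ∈ st u := by
  by_cases hw : w ∈ X.V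
  · refine ⟨p.symm ⟨w, hw⟩, by rw [p.apply_symm_apply], ?_⟩
    rwa [show (relabelRaw X p st).star w = st (p.symm ⟨w, hw⟩) from dif_pos hw] at h
  · rw [show (relabelRaw X p st).star w = [] from dif_neg hw] at h
    simp at h

theorem relabelRaw_isFlag (hst : ∀ z, (st z).Perm (X.star z)) (f : β) :
    (relabelRaw X p st).IsFlag f ↔ X.IsFlag f := by
  constructor
  · rintro ⟨w, _, hf⟩
    obtain ⟨u, _, hu⟩ := mem_relabelRaw_star X p st hf
    exact ⟨u, u.2, (hst u).mem_iff.1 hu⟩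
  · rintro ⟨u, hu, hf⟩
    refine ⟨p ⟨u, hu⟩, (p ⟨u, hu⟩).2, ?_⟩
    rw [relabelRaw_star]
    exact (hst u).mem_iff.2 hf

theorem relabelRaw_isDirectedGraph (hst : ∀ z, (st z).Perm (X.star z)) :
    (relabelRaw X p st).IsDirectedGraph where
  star_eq_nil w hw := dif_neg hw
  star_nodup w := by
    by_cases hw : w ∈ X.V
    · rw [show (relabelRaw X p st).star w = st (p.symm ⟨w, hw⟩) from dif_pos hw]
      exact (hst _).nodup_iff.2 (X.isDirectedGraph.star_nodup _)
    · rw [show (relabelRaw X p st).star w = [] from dif_neg hw]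
      exact List.nodup_nil
  star_disjoint w w' f hf hf' := by
    obtain ⟨u, rfl, hu⟩ := mem_relabelRaw_star X p st hf
    obtain ⟨u', rfl, hu'⟩ := mem_relabelRaw_star X p st hf'
    rw [vert_eq ((hst _).mem_iff.1 hu) ((hst _).mem_iff.1 hu')]
  link_isFlag f f' hl := (relabelRaw_isFlag X p st hst f).2 (X.isDirectedGraph.link_isFlag _ _ hl)
  link_symm := X.isDirectedGraph.link_symm
  link_irrefl := X.isDirectedGraph.link_irrefl
  link_unique := X.isDirectedGraph.link_unique
  legs_nodup := X.isDirectedGraph.legs_nodup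
  mem_legs f := by
    rw [relabelRaw_isFlag X p st hst]
    exact X.isDirectedGraph.mem_legs f

theorem relabelRaw_isConnected (hst : ∀ z, (st z).Perm (X.star z)) :
    (relabelRaw X p st).IsConnected := by
  refine ⟨X.isConnected.1, fun w hw w' hw' => ?_⟩
  have key : ∀ u : X.Vert, ∀ z, Relation.ReflTransGen X.Joined u z →
      ∃ hz : z ∈ X.V, Relation.ReflTransGen (relabelRaw X p st).Joined (p u) (p ⟨z, hz⟩) := by
    intro u z hz
    induction hz with
    | refl => exact ⟨u.2, .refl⟩
    | @tail z z' _ hj ih =>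
      obtain ⟨hz, ih⟩ := ih
      obtain ⟨f, f', hf, hf', hl⟩ := hj
      refine ⟨mem_V_of_mem_star X hf', ih.tail ⟨f, f', ?_, ?_, hl⟩⟩
      · rw [relabelRaw_star]
        exact (hst z).mem_iff.2 hf
      · rw [relabelRaw_star]
        exact (hst z').mem_iff.2 hf'
  obtain ⟨_, h⟩ := key (p.symm ⟨w, hw⟩) _
    (X.isConnected.2 _ (p.symm ⟨w, hw⟩).2 _ (p.symm ⟨w', hw'⟩).2)
  rwa [p.apply_symm_apply, show (⟨p.symm ⟨w', hw'⟩, _⟩ : X.Vert) = p.symm ⟨w', hw'⟩ from rfl,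
    p.apply_symm_apply] at h

/-- Any graph is isomorphic to the one obtained by renaming its vertices and changing its local
orders. -/
theorem exists_relabel (hst : ∀ z, (st z).Perm (X.star z)) :
    ∃ (X' : Grc α β) (ℓ : X ≅ X'),
    (∀ u, (ℓ.hom.φ u : α) = p u) ∧ (∀ a, (ℓ.hom.ψ a : β) = a) ∧
      ∀ u : X.Vert, X'.star (p u) = st u := by
  set X' : Grc α β := ⟨relabelRaw X p st, relabelRaw_isDirectedGraph X p st hst,
    relabelRaw_isConnected X p st hst⟩ with hX'
  let m : X ⟶ X' :=
    { φ := p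
      ψ := fun a => ⟨a, (relabelRaw_isFlag X p st hst a).1 a.2⟩
      φ_surjective := p.surjective
      ψ_injective := fun a b hab => Subtype.ext (congrArg (fun c : X.Flag => (c : β)) hab)
      adj := fun a u hu => by
        change (a : β) ∈ (relabelRaw X p st).star (p u)
        rw [relabelRaw_star]
        exact (hst u).mem_iff.2 hu
      link_iff := fun a f => by
        constructor
        · exact fun hl => ⟨⟨f, (relabelRaw_isFlag X p st hst f).2 (isFlag_right hl)⟩, rfl, hl⟩
        · rintro ⟨b, rfl, hl⟩
          exact hl
      contracted := fun h h' x y hn =>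
        absurd ⟨⟨h, (relabelRaw_isFlag X p st hst h).2 h.2⟩, rfl⟩ hn
      legs_map := by
        change X.legs.map _ = X.legs
        conv_rhs => rw [← List.map_id X.legs]
        refine List.map_congr_left fun f hf => ?_
        rw [flagMap_eq]
        · rfl
        · exact (relabelRaw_isFlag X p st hst f).2 (isFlag_of_mem_legs X hf)
      fiber_connected := fun i => by
        refine ⟨⟨p.symm i, (fiberGraph_mem_V _ _ _ _).2
          ⟨(p.symm i).2, p.apply_symm_apply i⟩⟩, fun x hx y hy => ?_⟩
        obtain ⟨hx, hxi⟩ := (fiberGraph_mem_V _ _ _ _).1 hx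
        obtain ⟨hy, hyi⟩ := (fiberGraph_mem_V _ _ _ _).1 hy
        obtain rfl : x = y := congrArg Subtype.val (p.injective (hxi.trans hyi.symm))
        exact .refl }
  -- The map `m` identifies no vertices and drops no half-edges, as does the identity, so it is
  -- invertible.
  obtain ⟨σ, hσ⟩ := exists_iso m (𝟙 X) (fun x y => p.injective.eq_iff) fun h => by
    refine ⟨fun hk => ?_, fun hk => ⟨⟨h, isFlag_of_kept hk⟩, rfl⟩⟩
    exact ⟨⟨h, (relabelRaw_isFlag X p st hst h).2 (isFlag_of_kept hk)⟩, rfl⟩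
  have hm : σ.symm.hom = m := ((Iso.comp_hom_eq_id σ).1 hσ).symm
  refine ⟨X', σ.symm, ?_, ?_, relabelRaw_star X p st⟩
  · rw [hm]
    exact fun _ => rfl
  · rw [hm]
    exact fun _ => rfl

end Relabel

/-- The fibre of `f` through the vertex `u` consists of `u` and has no internal edges. -/
def IsTrivialAt {X D : Grc α β} (f : X ⟶ D) (u : X.Vert) : Prop :=
  (∀ w, f.φ w = f.φ u → w = u) ∧ ∀ h ∈ X.star u, Hom.Kept f h

/-- The isomorphism `ℓ` replaces the order of vertices by one for which `f` is monotone, and the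
local orders at trivial fibres by those of the target of `f`. -/
structure Straightens [LinearOrder α] {X X' D : Grc α β} (f : X ⟶ D) (ℓ : X ≅ X') : Prop where
  le_iff : ∀ u w, ℓ.hom.φ u ≤ ℓ.hom.φ w ↔ f.φ u < f.φ w ∨ f.φ u = f.φ w ∧ u ≤ w
  ψ_eq : ∀ a, (ℓ.hom.ψ a : β) = a
  star_of_isTrivialAt : ∀ u, IsTrivialAt f u →
    X'.star (ℓ.hom.φ u) = (D.star (f.φ u)).map (flagMap f.ψ)
  star_of_not_isTrivialAt : ∀ u, ¬ IsTrivialAt f u → X'.star (ℓ.hom.φ u) = X.star u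

theorem IsTrivialAt.perm {X D : Grc α β} {f : X ⟶ D} {u : X.Vert} (h : IsTrivialAt f u) :
    ((D.star (f.φ u)).map (flagMap f.ψ)).Perm (X.star u) := by
  refine (List.perm_ext_iff_of_nodup ((fiber_isDirectedGraph f (f.φ u)).legs_nodup)
    (X.isDirectedGraph.star_nodup u)).2 fun a => ?_
  refine ((fiber_isDirectedGraph f (f.φ u)).mem_legs a).trans ?_
  rw [fiber_isFlag]
  constructor
  · rintro ⟨⟨w, hw, ha⟩, -⟩
    rwa [h.1 w hw] at ha
  · exact fun ha => ⟨⟨u, rfl, ha⟩, fun b hl => hl.2.2 (h.2 a ha)⟩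

open Classical in
theorem exists_straightens [LinearOrder α] {X D : Grc α β} (f : X ⟶ D) :
    ∃ (X' : Grc α β) (ℓ : X ≅ X'), Straightens f ℓ := by
  -- Sorting by the image under `f` makes `f` monotone; ties are broken by the old order, which
  -- keeps the order inside each fibre.
  obtain ⟨p, hp⟩ := X.V.exists_equiv_le_iff (fun u => toLex (f.φ u, u)) fun u w h =>
    congrArg (fun a => (ofLex a).2) h
  obtain ⟨X', ℓ, hφ, hψ, hstar⟩ := exists_relabel X p
    (fun z => if h : ∃ hz : z ∈ X.V, IsTrivialAt f ⟨z, hz⟩ then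
      (D.star (f.φ ⟨z, h.1⟩)).map (flagMap f.ψ) else X.star z) fun z => by
    split_ifs with h
    · exact h.2.perm
    · exact .refl _
  refine ⟨X', ℓ, fun u w => ?_, hψ, fun u hu => ?_, fun u hu => ?_⟩
  · rw [← Subtype.coe_le_coe, hφ, hφ, Subtype.coe_le_coe, hp, Prod.Lex.le_iff]
    rfl
  · rw [hφ, hstar]
    exact dif_pos ⟨u.2, hu⟩
  · rw [hφ, hstar]
    exact dif_neg fun ⟨_, h⟩ => hu h

theorem IsSimpleAt.isTrivialAt {X D : Grc α β} {f : X ⟶ D} {i : D.Vert} (h : IsSimpleAt f i)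
    {u : X.Vert} (hu : f.φ u ≠ i) : IsTrivialAt f u := by
  refine ⟨fun w hw => ?_, fun a ha => ?_⟩
  · exact ((h.eq_or_eq u w hw.symm).resolve_right hu).symm
  · by_contra hk
    exact hu (h.φ_eq a u ha hk)

theorem IsSimpleAt.isElementaryAt [LinearOrder α] {X D : Grc α β} {f : X ⟶ D} {i : D.Vert}
    (h : IsSimpleAt f i) (hf : Monotone f.φ)
    (hstar : ∀ u, f.φ u ≠ i → X.star u = (D.star (f.φ u)).map (flagMap f.ψ)) :
    IsElementaryAt f i where
  monotone := hf
  hasEdge := h.hasEdge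
  isTrivial j hj := by
    obtain ⟨u, rfl⟩ := f.φ_surjective j
    have hu := h.isTrivialAt hj
    refine ⟨?_, u, ?_, ?_⟩
    · rintro ⟨a, b, hl, ⟨w, hw, ha⟩, hn⟩
      rw [hu.1 w hw] at ha
      exact hn (hu.2 a ha)
    · ext z
      rw [fiber_mem_V, Finset.mem_singleton]
      constructor
      · rintro ⟨hz, hzu⟩
        exact congrArg Subtype.val (hu.1 _ hzu)
      · rintro rfl
        exact ⟨u.2, rfl⟩
    · rw [fiber_star _ _ _ ((fiber_mem_V' f _ u).2 rfl), hstar u hj]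
      rfl

theorem inv_hom_φ {X X' : Grc α β} (ℓ : X ≅ X') (u : X.Vert) : ℓ.inv.φ (ℓ.hom.φ u) = u := by
  rw [← comp_φ, ℓ.hom_inv_id, id_φ]

section Straighten

variable [LinearOrder α] {X X' Y Y' D : Grc α β}

theorem Straightens.inv_ψ_eq {f : X ⟶ D} {ℓ : X ≅ X'} (h : Straightens f ℓ) (a : X.Flag) :
    (ℓ.inv.ψ a : β) = a := by
  rw [← h.ψ_eq, ← comp_ψ, ℓ.hom_inv_id, id_ψ]

theorem Straightens.isElementaryAt {f : X ⟶ D} {ℓ : X ≅ X'} (h : Straightens f ℓ) {i : D.Vert}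
    (hf : IsSimpleAt f i) : IsElementaryAt (ℓ.inv ≫ f) i := by
  refine IsSimpleAt.isElementaryAt (hf.iso_comp ℓ.symm) ?_ ?_
  · intro a b hab
    obtain ⟨u, rfl⟩ := ℓ.hom.φ_surjective a
    obtain ⟨w, rfl⟩ := ℓ.hom.φ_surjective b
    rw [comp_φ, comp_φ, inv_hom_φ, inv_hom_φ]
    rcases (h.le_iff u w).1 hab with h | h
    exacts [h.le, h.1.le]
  · intro a ha
    obtain ⟨u, rfl⟩ := ℓ.hom.φ_surjective a
    rw [comp_φ, inv_hom_φ] at ha ⊢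
    rw [h.star_of_isTrivialAt u (hf.isTrivialAt ha)]
    refine List.map_congr_left fun c hc => ?_
    rw [flagMap_eq _ (isFlag_of_mem hc), flagMap_eq _ (isFlag_of_mem hc), comp_ψ, h.inv_ψ_eq]

/-- One straightening of the source, adapted to the composite, serves the first map as well, which
lets both sides of an interchange start from the same graph. Vertices with distinct images under the
composite are already in the right order. Those with equal images are either all sent to `x`, by
`hx`, or fixed by `π`, so their order survives. Local orders at vertices not sent to `x` are either
pulled back from `D` on both sides or left unchanged on both. -/
theorem Straightens.isElementaryAt_of_isCanonicalContraction {π : X ⟶ Y} {x : Y.Vert} {f : Y ⟶ D}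
    {ℓ : X ≅ X'} {ℓ' : Y ≅ Y'} (h : Straightens (π ≫ f) ℓ) (h' : Straightens f ℓ')
    (hπ : IsCanonicalContraction π x) (hx : ∀ y, f.φ y = f.φ x → y = x) :
    IsElementaryAt (ℓ.inv ≫ π ≫ ℓ'.hom) (ℓ'.hom.φ x) := by
  refine IsSimpleAt.isElementaryAt ((hπ.isSimpleAt.comp_iso ℓ').iso_comp ℓ.symm) ?_ ?_
  · intro a b hab
    obtain ⟨u, rfl⟩ := ℓ.hom.φ_surjective a
    obtain ⟨w, rfl⟩ := ℓ.hom.φ_surjective b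
    rw [comp_φ, comp_φ, comp_φ, comp_φ, inv_hom_φ, inv_hom_φ, h'.le_iff]
    rcases (h.le_iff u w).1 hab with h | ⟨h, huw⟩
    · exact Or.inl h
    · refine Or.inr ⟨h, ?_⟩
      rw [comp_φ, comp_φ] at h
      by_cases hu : π.φ u = x
      · rw [hu, hx (π.φ w) (by rw [← h, hu])]
      · have hw : π.φ w ≠ x := fun hw => hu (hx _ (by rw [h, hw]))
        rw [← Subtype.coe_le_coe, hπ.φ_eq u hu, hπ.φ_eq w hw]
        exact huw
  · intro a ha
    obtain ⟨u, rfl⟩ := ℓ.hom.φ_surjective a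
    rw [comp_φ, comp_φ, inv_hom_φ] at ha ⊢
    have hu : π.φ u ≠ x := fun hu => ha (by rw [hu])
    have hπu := hπ.isSimpleAt.isTrivialAt hu
    have htriv : IsTrivialAt (π ≫ f) u ↔ IsTrivialAt f (π.φ u) := by
      constructor
      · rintro ⟨h1, h2⟩
        refine ⟨fun y hy => ?_, fun c hc => ?_⟩
        · obtain ⟨w, rfl⟩ := π.φ_surjective y
          rw [h1 w hy]
        · obtain ⟨w, hw, hcw⟩ := (Hom.mem_star_iff π ⟨c, isFlag_of_mem hc⟩ _).1 hc
          rw [hπu.1 w hw] at hcw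
          obtain ⟨d, hd, hk⟩ := (kept_comp _ _ _).1 (h2 _ hcw)
          rwa [π.ψ_injective (Subtype.ext hd)] at hk
      · rintro ⟨h1, h2⟩
        refine ⟨fun w hw => hπu.1 w (h1 _ hw), fun c hc => ?_⟩
        obtain ⟨d, rfl⟩ := hπu.2 c hc
        exact (kept_comp _ _ _).2 ⟨d, rfl, h2 d (π.adj d u hc)⟩
    have hid : ∀ c ∈ Y'.star (ℓ'.hom.φ (π.φ u)), flagMap (ℓ.inv ≫ π ≫ ℓ'.hom).ψ c = c := by
      intro c hc
      rw [flagMap_eq _ (isFlag_of_mem hc), comp_ψ, comp_ψ, h.inv_ψ_eq, hπ.ψ_eq, h'.ψ_eq]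
    rw [List.map_congr_left hid, List.map_id']
    by_cases ht : IsTrivialAt f (π.φ u)
    · rw [h.star_of_isTrivialAt u (htriv.2 ht), h'.star_of_isTrivialAt _ ht]
      refine List.map_congr_left fun c hc => ?_
      rw [flagMap_eq _ (isFlag_of_mem hc), flagMap_eq _ (isFlag_of_mem hc), comp_ψ, hπ.ψ_eq]
    · rw [h.star_of_not_isTrivialAt u fun h => ht (htriv.1 h), h'.star_of_not_isTrivialAt _ ht,
        hπ.star_eq _ (π.φ u).2 fun h => hu (Subtype.ext h), hπ.φ_eq u hu]

end Straighten

/-- If two factorizations of a map contract the same subgraph first, then their middle terms are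
isomorphic. -/
theorem exists_iso_of_comp_eq {G A B S : Grc α β} {k₁ : G ⟶ A} {k₂ : A ⟶ S} {l₁ : G ⟶ B}
    {l₂ : B ⟶ S} {a : A.Vert} {b : B.Vert} {i i' : S.Vert} (hk₁ : IsSimpleAt k₁ a)
    (hk₂ : IsSimpleAt k₂ i) (hl₁ : IsSimpleAt l₁ b) (hl₂ : IsSimpleAt l₂ i')
    (ha : k₂.φ a ≠ i) (hb : l₂.φ b ≠ i') (hab : k₂.φ a = l₂.φ b) (h : k₁ ≫ k₂ = l₁ ≫ l₂) :
    ∃ σ : A ≅ B, k₁ ≫ σ.hom = l₁ := by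
  -- The second map has a trivial fibre over the image of `a`. So what the first map identifies, and
  -- below what it drops, is recovered from the composite and that vertex alone, data shared by both
  -- factorizations.
  have hφ : ∀ {A : Grc α β} {k₁ : G ⟶ A} {k₂ : A ⟶ S} {a : A.Vert} {i : S.Vert},
      IsSimpleAt k₁ a → IsSimpleAt k₂ i → k₂.φ a ≠ i → ∀ u w, k₁.φ u = k₁.φ w ↔
        u = w ∨ (k₁ ≫ k₂).φ u = k₂.φ a ∧ (k₁ ≫ k₂).φ w = k₂.φ a := by
    intro A k₁ k₂ a i h₁ h₂ ha u w
    constructor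
    · intro huw
      exact (h₁.eq_or_eq u w huw).imp_right fun hu => by rw [comp_φ, comp_φ, ← huw, hu]; simp
    · rintro (rfl | ⟨hu, hw⟩)
      · rfl
      · have h3 := (h₂.isTrivialAt ha).1
        rw [h3 _ hu, h3 _ hw]
  have hψ : ∀ {A : Grc α β} {k₁ : G ⟶ A} {k₂ : A ⟶ S} {a : A.Vert} {i : S.Vert},
      IsSimpleAt k₁ a → IsSimpleAt k₂ i → k₂.φ a ≠ i → ∀ f, Hom.Kept k₁ f ↔
        G.IsFlag f ∧ (Hom.Kept (k₁ ≫ k₂) f ∨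
          ∀ x : G.Vert, f ∈ G.star x → (k₁ ≫ k₂).φ x ≠ k₂.φ a) := by
    intro A k₁ k₂ a i h₁ h₂ ha f
    constructor
    · rintro ⟨c, rfl⟩
      refine ⟨(k₁.ψ c).2, ?_⟩
      by_cases hc : Hom.Kept k₂ c
      · exact Or.inl ((kept_comp _ _ _).2 ⟨c, rfl, hc⟩)
      · refine Or.inr fun x hx hxa => ha ?_
        rw [← hxa]
        exact h₂.φ_eq c _ (k₁.adj c x hx) hc
    · rintro ⟨hf, hk | hk⟩
      · obtain ⟨c, hc, -⟩ := (kept_comp _ _ _).1 hk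
        exact ⟨c, hc⟩
      · by_contra hn
        obtain ⟨x, hx⟩ := flag_exists_vert hf
        exact hk x hx (by rw [comp_φ, h₁.φ_eq f x hx hn])
  refine exists_iso k₁ l₁ (fun u w => ?_) fun f => ?_
  · rw [hφ hk₁ hk₂ ha, hφ hl₁ hl₂ hb, h, hab]
  · rw [hψ hk₁ hk₂ ha, hψ hl₁ hl₂ hb, h, hab]

end Grc

/-! ### Comparison of labelled towers with towers of canonical contractions. -/

section Models

variable {α : Type u} {β : Type v} [LinearOrder α]

/-- A labelled tower is isomorphic, by a ladder, to a tower of canonical contractions. -/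
inductive Models : ∀ {Γ Δ : Grc α β}, CanonicalTower Γ → (Γ ≅ Δ) → Tower Δ → Prop
  | last {Γ Δ : Grc α β} (h : Γ.HasEdge) (ℓ : Γ ≅ Δ) (h' : Δ.HasEdge) :
      Models (.last Γ h) ℓ (.last Δ h')
  | step {Γ Γ₁ Δ Δ₁ : Grc α β} {π : Γ ⟶ Γ₁} {x : Γ₁.Vert} (hπ : Grc.IsCanonicalContraction π x)
      {C : CanonicalTower Γ₁} (ℓ : Γ ≅ Δ) (σ : Γ₁ ≅ Δ₁) {τ : Δ ⟶ Δ₁} {i : Δ₁.Vert}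
      (hτ : Grc.IsElementaryAt τ i) {R : Tower Δ₁} (comm : π ≫ σ.hom = ℓ.hom ≫ τ)
      (m : Models C σ R) : Models (.step π x hπ C) ℓ (.step τ i hτ R)

namespace Models

theorem exists_canonicalTower {Γ Δ : Grc α β} (ℓ : Γ ≅ Δ) (R : Tower Δ) :
    ∃ C, Models C ℓ R := by
  induction R generalizing Γ with
  | last Δ h => exact ⟨_, .last (Grc.hasEdge_of_iso ℓ h) ℓ h⟩
  | step τ i hτ R ih =>
    obtain ⟨Γ₁, π, x, σ, hπ, comm⟩ := (hτ.isSimpleAt.iso_comp ℓ).exists_canonical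
    obtain ⟨C, hC⟩ := ih σ
    exact ⟨_, .step hπ ℓ σ hτ comm hC⟩

/-- The first contraction is unique by `IsCanonicalContraction.eq_of_comp_iso`; the isomorphism of
the next graphs is then forced, maps being epimorphisms, and the argument repeats. -/
theorem unique {Γ Δ : Grc α β} {ℓ : Γ ≅ Δ} {R : Tower Δ} {C C' : CanonicalTower Γ}
    (h : Models C ℓ R) (h' : Models C' ℓ R) : C = C' := by
  induction h with
  | last =>
    cases h'
    rfl
  | step hπ ℓ σ hτ comm m ih =>
    cases h' with
    | step hπ' _ σ' _ comm' m' =>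
      have hs := hπ.eq_of_comp_iso hπ' σ σ' (comm.trans comm'.symm)
      cases hs
      obtain rfl : σ = σ' := Iso.ext (Grc.hom_epi _ (comm.trans comm'.symm))
      rw [ih m']

theorem presents_iff {Γ Δ : Grc α β} {ℓ : Γ ≅ Δ} {R : Tower Δ} {T : GTree α β} :
    R.Presents Γ ℓ T ↔ ∃ C, Models C ℓ R ∧ C.tree = T := by
  induction R generalizing Γ T with
  | last Δ h =>
    constructor
    · rintro rfl
      exact ⟨_, .last (Grc.hasEdge_of_iso ℓ h) ℓ h, rfl⟩
    · rintro ⟨C, hC, rfl⟩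
      cases hC
      rfl
  | step τ i hτ R ih =>
    constructor
    · rintro ⟨Γ₁, π, x, σ, T₁, hπ, comm, hT₁, rfl⟩
      obtain ⟨C, hC, rfl⟩ := ih.1 hT₁
      exact ⟨_, .step hπ ℓ σ hτ comm hC, rfl⟩
    · rintro ⟨C, hC, rfl⟩
      cases hC with
      | step hπ _ σ _ comm m => exact ⟨_, _, _, σ, _, hπ, comm, ih.2 ⟨_, m, rfl⟩, rfl⟩

theorem trans_ladder {Γ Δ Δ' : Grc α β} {ℓ : Γ ≅ Δ} {R : Tower Δ} {R' : Tower Δ'}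
    {C : CanonicalTower Γ} {σ : Δ ≅ Δ'} (h : Tower.Ladder σ R R') (hC : Models C ℓ R) :
    Models C (ℓ ≪≫ σ) R' := by
  induction h generalizing Γ with
  | last σ _ h' =>
    cases hC with
    | last h => exact .last h _ h'
  | @step Δ₀ Δ₁ Δ₀' Δ₁' σ₀ σ₁ τ i hi R τ' i' hi' R' comm l ih =>
    cases hC with
    | step hπ _ σ _ comm' m =>
      refine .step hπ _ (σ ≪≫ σ₁) hi' ?_ (ih m)
      rw [Iso.trans_hom, Iso.trans_hom, ← Category.assoc, comm', Category.assoc, comm,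
        Category.assoc]

/-- Labelled towers with the same canonical tower are isomorphic by an isomorphism of the first
type, passing through the canonical tower at each level. -/
theorem ladder {Γ Δ Δ' : Grc α β} {ℓ : Γ ≅ Δ} {ℓ' : Γ ≅ Δ'} {R : Tower Δ} {R' : Tower Δ'}
    {C : CanonicalTower Γ} (h : Models C ℓ R) (h' : Models C ℓ' R') :
    Tower.Ladder (ℓ.symm ≪≫ ℓ') R R' := by
  induction h generalizing Δ' with
  | last =>
    cases h'
    exact .last _ _ _
  | step hπ ℓ σ hτ comm m ih =>
    cases h' with
    | step _ _ σ' hτ' comm' m' =>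
      refine .step _ (σ.symm ≪≫ σ') ?_ (ih m')
      rw [Iso.trans_hom, Iso.trans_hom, Iso.symm_hom, Iso.symm_hom, Category.assoc, ← comm',
        ← Category.assoc, ← Category.assoc, (Iso.eq_inv_comp ℓ).2 comm.symm]
      simp only [Category.assoc, Iso.hom_inv_id_assoc]

/-- The canonical tower of the first side is interchanged by `IsCanonicalContraction.exists_swap`.
The result models the second side, so by uniqueness it is its canonical tower, and the two trees
differ by commuting graftings. -/
theorem tree_eq_of_swap {Γ Δ : Grc α β} {ℓ : Γ ≅ Δ} {R R' : Tower Δ} {C C' : CanonicalTower Γ}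
    (h : Tower.Swap R R') (hC : Models C ℓ R) (hC' : Models C' ℓ R') : C.tree = C'.tree := by
  induction h generalizing Γ with
  | @here Δ P Q S τ₁ τ₂ ρ₁ ρ₂ a b i j hτ₁ hτ₂ hρ₁ hρ₂ ha hb hij comm R =>
    cases hC with
    | @step _ P' _ _ π₁ x₁ hπ₁ _ _ σP _ _ _ _ comm₁ m₁ =>
    cases m₁ with
    | @step _ S' _ _ π₂ x₂ hπ₂ C₀ _ σS _ _ _ _ comm₂ m₂ =>
    have hx₁ : σP.hom.φ x₁ = a :=
      (hπ₁.isSimpleAt.comp_iso σP).unique (comm₁ ▸ hτ₁.isSimpleAt.iso_comp ℓ)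
    have hx₂ : σS.hom.φ x₂ = j :=
      (hπ₂.isSimpleAt.comp_iso σS).unique (comm₂ ▸ hτ₂.isSimpleAt.iso_comp σP)
    have hi : σS.hom.φ (π₂.φ x₁) = i := by
      rw [← Grc.comp_φ, comm₂, Grc.comp_φ, hx₁, ha]
    have hne : π₂.φ x₁ ≠ x₂ := by
      intro h
      rw [h, hx₂] at hi
      exact hij hi.symm
    obtain ⟨Q', κ₁, κ₂, b', hκ₁, hκ₂, hb', hcomm, hfib₁, hfib₂⟩ := hπ₁.exists_swap hπ₂ hne
    have hg : κ₁ ≫ κ₂ ≫ σS.hom = (ℓ.hom ≫ ρ₁) ≫ ρ₂ := by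
      rw [← Category.assoc, ← hcomm, Category.assoc, comm₂, ← Category.assoc, comm₁,
        Category.assoc, comm, Category.assoc]
    -- The middle graphs of the two interchanged factorizations are isomorphic, because both
    -- contract first the subgraph over the same vertex of `S`.
    obtain ⟨σQ, hσQ⟩ := Grc.exists_iso_of_comp_eq hκ₁.isSimpleAt (hκ₂.isSimpleAt.comp_iso σS)
      (hρ₁.isSimpleAt.iso_comp ℓ) hρ₂.isSimpleAt
      (by
        rw [Grc.comp_φ, hb']
        exact fun h => hne (Grc.iso_φ_injective σS h).symm)
      (by
        rw [hb]
        exact hij.symm)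
      (by rw [Grc.comp_φ, hb', hx₂, hb]) hg
    have hm : Models (.step κ₁ b' hκ₁ (.step κ₂ _ hκ₂ C₀)) ℓ (.step ρ₁ b hρ₁ (.step ρ₂ i hρ₂ R)) := by
      refine .step hκ₁ ℓ σQ hρ₁ hσQ (.step hκ₂ σQ σS hρ₂ (Grc.hom_epi κ₁ ?_) m₂)
      rw [hg, ← hσQ, Category.assoc]
    rw [hC'.unique hm]
    obtain ⟨hT, -, -⟩ := C₀.tree_spec
    have hb'x : (b' : α) = x₂ := by
      rw [← hb', hκ₂.φ_eq b']
      rw [hb']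
      exact hne.symm
    simp only [CanonicalTower.tree]
    rw [hfib₁, hfib₂, hb'x, hπ₂.φ_eq x₁ hne, GTree.graft_congr _ _ hT (x₂ : α) (x₁ : α)]
    rw [GTree.graft_comm (x := (x₁ : α)) (x' := (x₂ : α))]
    · refine GTree.graft_congr _ _ ?_ _ _
      have h1 := (CanonicalTower.step κ₂ _ hκ₂ C₀).tree_spec.1
      rw [CanonicalTower.tree, hfib₂, hπ₂.φ_eq x₁ hne] at h1
      exact h1
    · intro h
      refine hne (Subtype.ext ?_)
      rw [hπ₂.φ_eq x₁ hne, h]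
    · rw [← hfib₂, ← hb'x, Grc.fiber_mem_V', hb']
      exact hne.symm
    · rw [Grc.fiber_mem_V']
      exact hne
  | there τ i hi s ih =>
    cases hC with
    | step hπ _ σ _ comm m =>
    cases hC' with
    | step hπ' _ σ' _ comm' m' =>
      have hs := hπ.eq_of_comp_iso hπ' σ σ' (comm.trans comm'.symm)
      cases hs
      obtain rfl : σ = σ' := Iso.ext (Grc.hom_epi _ (comm.trans comm'.symm))
      rw [CanonicalTower.tree, CanonicalTower.tree, ih m m']

/-- Starting from the last graph, each source is straightened with respect to the composite to the
target already chosen. -/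
theorem exists_labelledTower {Γ : Grc α β} (C : CanonicalTower Γ) :
    ∃ (Δ : Grc α β) (ℓ : Γ ≅ Δ) (R : Tower Δ), Models C ℓ R := by
  induction C with
  | last Γ h => exact ⟨Γ, Iso.refl Γ, .last Γ h, .last h _ h⟩
  | step π x hπ C ih =>
    obtain ⟨Δ₁, σ, R, m⟩ := ih
    obtain ⟨Δ, ℓ, hℓ⟩ := Grc.exists_straightens (π ≫ σ.hom)
    have hτ := hℓ.isElementaryAt (hπ.isSimpleAt.comp_iso σ)
    exact ⟨Δ, ℓ, .step _ _ hτ R, .step hπ ℓ σ hτ (Iso.hom_inv_id_assoc ℓ _).symm m⟩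

/-- Both middle graphs and the common source are straightened with respect to their maps to the same
final graph. As the two composites agree, one straightened source makes both first maps elementary.
-/
theorem exists_swap {Γ : Grc α β} {C C' : CanonicalTower Γ} (h : CanonicalTower.Swap C C') :
    ∃ (Δ : Grc α β) (ℓ : Γ ≅ Δ) (R R' : Tower Δ),
      Models C ℓ R ∧ Models C' ℓ R' ∧ Tower.Swap R R' := by
  induction h with
  | @here Γ P Q S π₁ π₂ κ₁ κ₂ a b i j hπ₁ hπ₂ hκ₁ hκ₂ ha hb hij comm C =>
    obtain ⟨D, σ, R, m⟩ := exists_labelledTower C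
    obtain ⟨P', ℓP, hP⟩ := Grc.exists_straightens (π₂ ≫ σ.hom)
    obtain ⟨Q', ℓQ, hQ⟩ := Grc.exists_straightens (κ₂ ≫ σ.hom)
    obtain ⟨Δ, ℓ, hℓ⟩ := Grc.exists_straightens (π₁ ≫ π₂ ≫ σ.hom)
    have hℓ' : Grc.Straightens (κ₁ ≫ κ₂ ≫ σ.hom) ℓ := by
      rwa [← Category.assoc, ← comm, Category.assoc]
    have h₁ := hℓ.isElementaryAt_of_isCanonicalContraction hP hπ₁ fun y hy => by
      refine (hπ₂.isSimpleAt.isTrivialAt ?_).1 y (Grc.iso_φ_injective σ hy)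
      rwa [ha]
    have h₂ := hP.isElementaryAt (hπ₂.isSimpleAt.comp_iso σ)
    have h₃ := hℓ'.isElementaryAt_of_isCanonicalContraction hQ hκ₁ fun y hy => by
      refine (hκ₂.isSimpleAt.isTrivialAt ?_).1 y (Grc.iso_φ_injective σ hy)
      rw [hb]
      exact hij.symm
    have h₄ := hQ.isElementaryAt (hκ₂.isSimpleAt.comp_iso σ)
    refine ⟨Δ, ℓ, _, _, .step hπ₁ ℓ ℓP h₁ (by simp) (.step hπ₂ ℓP σ h₂ (by simp) m),
      .step hκ₁ ℓ ℓQ h₃ (by simp) (.step hκ₂ ℓQ σ h₄ (by simp) m),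
      .here h₁ h₂ h₃ h₄ ?_ ?_ ?_ ?_ R⟩
    · rw [Grc.comp_φ, Grc.inv_hom_φ, Grc.comp_φ, ha]
    · rw [Grc.comp_φ, Grc.inv_hom_φ, Grc.comp_φ, hb]
    · exact fun h => hij (Grc.iso_φ_injective σ h)
    · simp only [Category.assoc, Iso.hom_inv_id_assoc]
      rw [← Category.assoc π₁, comm, Category.assoc]
  | there π x hπ s ih =>
    obtain ⟨Δ₁, σ, R, R', m, m', hs⟩ := ih
    obtain ⟨Δ, ℓ, hℓ⟩ := Grc.exists_straightens (π ≫ σ.hom)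
    have hτ := hℓ.isElementaryAt (hπ.isSimpleAt.comp_iso σ)
    exact ⟨Δ, ℓ, .step _ _ hτ R, .step _ _ hτ R',
      .step hπ ℓ σ hτ (Iso.hom_inv_id_assoc ℓ _).symm m,
      .step hπ ℓ σ hτ (Iso.hom_inv_id_assoc ℓ _).symm m', .there _ _ hτ hs⟩

end Models

/-! ### The tree as an invariant of components, and its completeness. -/

namespace LabelledTower

variable {Γ : Grc α β}

/-- The tower of canonical contractions isomorphic to a labelled tower. -/
noncomputable def canonical (𝒯 : LabelledTower Γ) : CanonicalTower Γ :=
  (Models.exists_canonicalTower 𝒯.ℓ 𝒯.tower).choose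

theorem models_canonical (𝒯 : LabelledTower Γ) : Models 𝒯.canonical 𝒯.ℓ 𝒯.tower :=
  (Models.exists_canonicalTower 𝒯.ℓ 𝒯.tower).choose_spec

/-- The graph-tree of a labelled tower. -/
noncomputable def toGTr (𝒯 : LabelledTower Γ) : GTr Γ :=
  ⟨𝒯.canonical.tree, ⟨𝒯.canonical.tree_spec.1, 𝒯.canonical.tree_spec.2.1⟩,
    𝒯.canonical.tree_spec.2.2⟩

theorem toGTr_eq_iff (𝒯 : LabelledTower Γ) (T : GTr Γ) :
    𝒯.toGTr = T ↔ 𝒯.tower.Presents Γ 𝒯.ℓ T.1 := by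
  rw [Models.presents_iff]
  constructor
  · rintro rfl
    exact ⟨_, 𝒯.models_canonical, rfl⟩
  · rintro ⟨C, hC, hT⟩
    rw [hC.unique 𝒯.models_canonical] at hT
    exact Subtype.ext hT

theorem toGTr_eq_of_generator {𝒯 𝒮 : LabelledTower Γ} (g : Generator 𝒯 𝒮) :
    𝒯.toGTr = 𝒮.toGTr := by
  apply Subtype.ext
  cases g with
  | first f =>
    have h := Models.trans_ladder f.ladder 𝒯.models_canonical
    rw [f.comm] at h
    change 𝒯.canonical.tree = 𝒮.canonical.tree
    rw [h.unique 𝒮.models_canonical]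
  | second h =>
    obtain ⟨Δ, ℓ, h⟩ := h
    exact Models.tree_eq_of_swap h (models_canonical _) (models_canonical _)

/-- The graph-tree of a labelled tower as a functor. -/
noncomputable def toGTrFunctor (Γ : Grc α β) : LTw Γ ⥤ Discrete (GTr Γ) :=
  CategoryTheory.Quotient.lift _
    (Quiver.FreeGroupoid.lift
      { obj := fun 𝒯 => Discrete.mk 𝒯.toGTr
        map := fun g => Discrete.eqToHom (toGTr_eq_of_generator g) })
    fun _ _ _ _ _ => Subsingleton.elim _ _

theorem mk_eq_of_generator {𝒯 𝒮 : LabelledTower Γ} (g : Generator 𝒯 𝒮) :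
    CategoryTheory.ConnectedComponents.mk 𝒯.toLTw = CategoryTheory.ConnectedComponents.mk 𝒮.toLTw :=
  _root_.Quotient.sound (Zigzag.of_hom ((CategoryTheory.Quotient.functor _).map g.toFree))

theorem mk_eq_of_models {𝒯 𝒮 : LabelledTower Γ} {C : CanonicalTower Γ}
    (h : Models C 𝒯.ℓ 𝒯.tower) (h' : Models C 𝒮.ℓ 𝒮.tower) :
    CategoryTheory.ConnectedComponents.mk 𝒯.toLTw = CategoryTheory.ConnectedComponents.mk 𝒮.toLTw :=
  mk_eq_of_generator (.first ⟨𝒯.ℓ.symm ≪≫ 𝒮.ℓ, by simp, h.ladder h'⟩)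

/-- An interchange is realized only between particular labelled towers modelled by the two sides;
the given ones are joined to these by isomorphisms of the first type. In a chain, each intermediate
canonical tower is likewise represented by some labelled tower. -/
theorem mk_eq_of_eqvGen {C C' : CanonicalTower Γ}
    (h : Relation.EqvGen CanonicalTower.Swap C C') :
    ∀ {𝒯 𝒮 : LabelledTower Γ}, Models C 𝒯.ℓ 𝒯.tower → Models C' 𝒮.ℓ 𝒮.tower →
      CategoryTheory.ConnectedComponents.mk 𝒯.toLTw = CategoryTheory.ConnectedComponents.mk 𝒮.toLTw := by
  induction h with
  | rel C C' h =>
    intro 𝒯 𝒮 h𝒯 h𝒮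
    obtain ⟨Δ, ℓ, R, R', m, m', hs⟩ := Models.exists_swap h
    exact (mk_eq_of_models (𝒮 := ⟨Δ, ℓ, R⟩) h𝒯 m).trans
      ((mk_eq_of_generator (.second (.mk Δ ℓ hs))).trans
        (mk_eq_of_models (𝒯 := ⟨Δ, ℓ, R'⟩) m' h𝒮))
  | refl C => exact mk_eq_of_models
  | symm _ _ _ ih => exact fun h𝒯 h𝒮 => (ih h𝒮 h𝒯).symm
  | trans _ C _ _ _ ih₁ ih₂ =>
    intro 𝒯 𝒮 h𝒯 h𝒮
    obtain ⟨Δ, ℓ, R, m⟩ := Models.exists_labelledTower C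
    exact (ih₁ (𝒮 := ⟨Δ, ℓ, R⟩) h𝒯 m).trans (ih₂ (𝒯 := ⟨Δ, ℓ, R⟩) m h𝒮)

end LabelledTower

end Models

theorem mainTheorem8 {α : Type u} {β : Type v} [LinearOrder α] (Γ : Grc α β) :
    ∃ e : CategoryTheory.ConnectedComponents (LTw Γ) ≃ GTr Γ,
      ∀ (𝒯 : LabelledTower Γ) (T : GTr Γ),
        e (CategoryTheory.ConnectedComponents.mk 𝒯.toLTw) = T ↔ 𝒯.tower.Presents Γ 𝒯.ℓ T.1 := by
  -- The tree descends to components because it is a functor to a discrete category.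
  set e := CategoryTheory.ConnectedComponents.liftFunctor _ (LabelledTower.toGTrFunctor Γ)
  have he : ∀ 𝒯 : LabelledTower Γ, e (CategoryTheory.ConnectedComponents.mk 𝒯.toLTw) = 𝒯.toGTr := fun 𝒯 => rfl
  have hmk : ∀ c : CategoryTheory.ConnectedComponents (LTw Γ), ∃ 𝒯 : LabelledTower Γ,
      CategoryTheory.ConnectedComponents.mk 𝒯.toLTw = c := fun c =>
    -- Neither the free groupoid nor the quotient by relations changes the objects, so every object
    -- is a labelled tower up to two wrappers.
    _root_.Quotient.inductionOn c fun X => ⟨X.as.as, rfl⟩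
  refine ⟨Equiv.ofBijective e ⟨fun c c' h => ?_, fun T => ?_⟩, fun 𝒯 T => ?_⟩
  · obtain ⟨𝒯, rfl⟩ := hmk c
    obtain ⟨𝒮, rfl⟩ := hmk c'
    rw [he, he] at h
    exact LabelledTower.mk_eq_of_eqvGen
      (CanonicalTower.eqvGen_of_tree_eq _ _ (congrArg Subtype.val h))
      𝒯.models_canonical 𝒮.models_canonical
  · obtain ⟨C, hC⟩ := CanonicalTower.exists_tree_eq T.2.1.2 T.2.1.1 T.2.2
    obtain ⟨Δ, ℓ, R, m⟩ := Models.exists_labelledTower C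
    refine ⟨CategoryTheory.ConnectedComponents.mk (LabelledTower.mk Δ ℓ R).toLTw, ?_⟩
    rw [he, LabelledTower.toGTr_eq_iff, Models.presents_iff]
    exact ⟨C, m, hC⟩
  · exact LabelledTower.toGTr_eq_iff 𝒯 T
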